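/- **Theorem.** Let $\mathbb{T}=\mathbb{R}/\mathbb{Z}$, let $\widehat f(n)=\int_{\mathbb T} f(x)e^{-2\pi i n x}\,dx$ for $n\in\mathbb{Z}$, and for $s\in\mathbb{R}$ let $$\|f\|_{H^s(\mathbb{T})}=\Big(\sum_{n\in\mathbb{Z}}(1+n^2)^{s}|\widehat f(n)|^2\Big)^{1/2}.$$ For $\alpha>0$ consider the cubic fractional nonlinear Schrödinger equation (with either choice of sign) $$ i\partial_t u+(-\partial_x^2)^{\alpha}u\pm|u|^2u=0 \quad\text{on } \mathbb{T}, \qquad\qquad (\ast)$$ where $(-\partial_x^2)^\alpha$ is the Fourier multiplier with symbol $|2\pi n|^{2\alpha}$, and put $s_{\mathrm{crit}}^\alpha=\frac12-\alpha$. Given $\alpha>0$, let (i) $s\le s_{\mathrm{crit}}^\alpha$ if $s_{\mathrm{crit}}^\alpha\le-\frac12$, or (ii) $s<s_{\mathrm{crit}}^\alpha$ and $s\neq0$ if $s_{\mathrm{crit}}^\alpha>-\frac12$. Then, given any $\varepsilon>0$, there exist a time $t\in(0,\varepsilon)$ and a smooth solution $u$ of $(\ast)$, defined on an open time interval containing $[0,t]$,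 such that $$\|u(0)\|_{H^s(\mathbb{T})}<\varepsilon\qquad\text{and}\qquad \|u(t)\|_{H^s(\mathbb{T})}>\varepsilon^{-1}.$$ Here a smooth solution on an open interval $I$ is a function $u:I\times\mathbb{T}\to\mathbb{C}$ that is $C^\infty$ in $x$, with all its $x$-derivatives continuous on $I\times\mathbb{T}$, that is differentiable in $t$ and satisfies $(\ast)$ at every point. -/

import Mathlib

open scoped ContDiff

noncomputable section

/-- The fractional Laplacian `(-∂ₓ²)^α` on the circle `𝕋 = ℝ/ℤ`: the Fourier multiplier with symbol
`|2πn|^(2α)`, applied to a smooth function (for which the series converges absolutely). -/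
def fracLaplacian (α : ℝ) (f : UnitAddCircle → ℂ) (x : UnitAddCircle) : ℂ :=
  ∑' n : ℤ, (((|2 * Real.pi * (n : ℝ)|) ^ (2 * α) : ℝ) : ℂ) * fourierCoeff f n * fourier n x

/-- The inhomogeneous Sobolev norm
`‖f‖_{H^s(𝕋)} = (∑ₙ ⟨n⟩^(2s) |f̂(n)|²)^(1/2)`, `⟨n⟩ = (1 + |n|²)^(1/2)`.
It is only used for smooth `f`, for which the series converges for every real `s`. -/
def sobolevNorm (s : ℝ) (f : UnitAddCircle → ℂ) : ℝ :=
  Real.sqrt (∑' n : ℤ, ((1 + (n : ℝ) ^ 2) ^ (1 / 2 : ℝ)) ^ (2 * s) * ‖fourierCoeff f n‖ ^ 2)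

/-- `u : (a, b) × 𝕋 → ℂ` is a smooth solution of `i ∂ₜu + (-∂ₓ²)^α u + κ |u|² u = 0`: it belongs to
`C((a, b); C^∞(𝕋))`, is differentiable in time, and satisfies the equation at every point. -/
structure IsSmoothSolution (α κ a b : ℝ) (u : ℝ → UnitAddCircle → ℂ) : Prop where
  /-- each `u(t)` is a smooth function on the circle -/
  smooth : ∀ t ∈ Set.Ioo a b, ContDiff ℝ ∞ (fun x : ℝ => u t (x : UnitAddCircle))
  /-- every spatial derivative is jointly continuous in time and space -/
  continuous_deriv : ∀ k : ℕ, ContinuousOn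
    (fun p : ℝ × ℝ => iteratedDeriv k (fun x : ℝ => u p.1 (x : UnitAddCircle)) p.2)
    (Set.Ioo a b ×ˢ Set.univ)
  /-- time differentiability -/
  differentiable : ∀ t ∈ Set.Ioo a b, ∀ x : UnitAddCircle,
    DifferentiableAt ℝ (fun τ : ℝ => u τ x) t
  /-- the equation -/
  equation : ∀ t ∈ Set.Ioo a b, ∀ x : UnitAddCircle,
    Complex.I * deriv (fun τ : ℝ => u τ x) t + fracLaplacian α (u t) x
      + (κ : ℂ) * (‖u t x‖ : ℂ) ^ 2 * u t x = 0

end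

/-!
Norm inflation is obtained from large solutions over short times, for which the dispersion is
negligible compared with the nonlinearity.

Writing `u(t) = A v(A²t)`, the equation becomes `i ∂ₜv + A⁻² (-∂ₓ²)^α v + κ |v|² v = 0`. If the
data live at frequencies of order `N`, then for rescaled times `t` such that `t N^(2α) / A²` is
small the solution `v` stays close to the solution `φ e^{iκt|φ|²}` of the ordinary differential
equation `i ∂ₜv + κ |v|² v = 0`. To make this precise, the equation in interaction form is solved in
the Banach algebras `WienerSpace ρ M`, whose norm controls both `∑ e^{ρ|n|} |f̂(n)|` and
`M sup_n e^{ρ|n|} |f̂(n)|`. With `ρ = 1 / N` the data have norm of order one, the multiplier is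
bounded by `θ e^{ρ|n|}` with `θ ≈ N^(2α) / A²`, and half of the exponential weight pays for it. A
Grönwall argument (`exists_solution_near_approximate`, `exists_interaction_solution`) gives
existence and an error bound proportional to `θ` for every single Fourier coefficient, with a gain
of `1 / M`; the exponential decay of the coefficients makes the solution smooth
(`exists_smooth_solution`).

For `s < 0` the data are the indicator of two frequency blocks of length about `m` at `N` and `2N`.
Their `H^s` norm is small since `N` is large, while the first Picard iterate of the cubic
nonlinearity at rescaled time `τ` has, after scaling back, size at least a constant times `A τ / m`
at all frequencies from `0` to `m`, without cancellation (`exists_low_frequency_growth`); the `H^s`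
norm of this low frequency part is large for a suitable choice of `A`, `m`, `N` and `τ`. For `α ≥ 1`
this works with `N = 2m`; at the endpoint `α = 1`, `s = -1/2` the divergence is only logarithmic,
and comes from the harmonic series. For `α < 1` the blocks are much shorter than `N`.

For `s > 0` the data are a bump of width `1 / M`, with amplitude `A` such that its `H^s` norm is at
most `ε / 2`; then `θ → 0` as `M → ∞` because `s < 1/2 - α`. After a large rescaled time `K` the phase
`e^{iκK|φ|²}` oscillates at frequency `KM`. The moments of the Fourier coefficients of
`φ e^{iκK|φ|²}` are computed from its derivatives by Parseval's identity, and show that the mass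
sits at frequencies of order `KM` (`moments_of_phase_bump`, `le_tsum_rpow_of_moments`). Hence the
`H^s` norm grows by a factor of order `K^s`, and `K` is arbitrary.
-/

open Complex Filter Topology Set
open scoped NNReal ENNReal ComplexConjugate

/-! ### Weighted Wiener spaces -/

/-- The exponential weight `e^{ρ|n|}` on `ℤ`. -/
noncomputable def expWeight (ρ : ℝ≥0) (n : ℤ) : ℝ := Real.exp (ρ * |(n : ℝ)|)

lemma expWeight_pos (ρ : ℝ≥0) (n : ℤ) : 0 < expWeight ρ n := Real.exp_pos _

lemma one_le_expWeight (ρ : ℝ≥0) (n : ℤ) : 1 ≤ expWeight ρ n :=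
  Real.one_le_exp (by positivity)

lemma expWeight_add_le (ρ : ℝ≥0) (m n : ℤ) :
    expWeight ρ (m + n) ≤ expWeight ρ m * expWeight ρ n := by
  rw [expWeight, expWeight, expWeight, ← Real.exp_add, ← mul_add]
  push_cast
  gcongr
  exact abs_add_le _ _

lemma expWeight_neg (ρ : ℝ≥0) (n : ℤ) : expWeight ρ (-n) = expWeight ρ n := by
  simp [expWeight]

lemma expWeight_two_mul (ρ : ℝ≥0) (n : ℤ) :
    expWeight (2 * ρ) n = expWeight ρ n * expWeight ρ n := by
  rw [expWeight, expWeight, ← Real.exp_add]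
  push_cast
  ring_nf

/-- The closed subspace `{(p, M p)}` of `ℓ¹ × ℓ^∞` underlying `WienerSpace ρ M`. -/
noncomputable def wienerSubmodule (_ρ M : ℝ≥0) :
    Submodule ℂ (lp (fun _ : ℤ => ℂ) 1 × lp (fun _ : ℤ => ℂ) ∞) where
  carrier := {p | ∀ n, p.2 n = (M : ℂ) * p.1 n}
  add_mem' := by
    intro a b ha hb n
    simp only [mem_ofPred_eq] at ha hb
    simp [ha n, hb n, mul_add]
  zero_mem' := by intro n; simp
  smul_mem' := by
    intro c a ha n
    simp only [mem_ofPred_eq] at ha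
    simp [ha n, mul_left_comm]

/-- The Banach space of sequences `a : ℤ → ℂ` with norm
`max (∑ₙ e^{ρ|n|} |aₙ|) (M * supₙ e^{ρ|n|} |aₙ|)`. It is encoded as the space of pairs `(p, M p)`
in `ℓ¹ × ℓ^∞`, where `pₙ = e^{ρ|n|} aₙ`. The second component lets a single norm
record both that a function has size `O(1)` in the Wiener algebra and that each of its
Fourier coefficients is `O(1 / M)`. -/
def WienerSpace (ρ M : ℝ≥0) : Type := wienerSubmodule ρ M

noncomputable instance (ρ M : ℝ≥0) : NormedAddCommGroup (WienerSpace ρ M) :=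
  inferInstanceAs (NormedAddCommGroup (wienerSubmodule ρ M))

noncomputable instance (ρ M : ℝ≥0) : NormedSpace ℂ (WienerSpace ρ M) :=
  inferInstanceAs (NormedSpace ℂ (wienerSubmodule ρ M))

instance (ρ M : ℝ≥0) : CompleteSpace (WienerSpace ρ M) := by
  refine IsClosed.completeSpace_coe (hs := ?_)
  have h : ∀ n : ℤ, IsClosed {p : lp (fun _ : ℤ => ℂ) 1 × lp (fun _ : ℤ => ℂ) ∞ |
      p.2 n = (M : ℂ) * p.1 n} := fun n => by
    have h1 : Continuous fun x : lp (fun _ : ℤ => ℂ) 1 => x n :=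
      (lp.lipschitzWith_one_eval 1 n).continuous
    have h2 : Continuous fun x : lp (fun _ : ℤ => ℂ) ∞ => x n :=
      (lp.lipschitzWith_one_eval ∞ n).continuous
    exact isClosed_eq (h2.comp continuous_snd) (continuous_const.mul (h1.comp continuous_fst))
  have hset : (wienerSubmodule ρ M : Set (lp (fun _ : ℤ => ℂ) 1 × lp (fun _ : ℤ => ℂ) ∞)) =
      ⋂ n : ℤ, {p | p.2 n = (M : ℂ) * p.1 n} := by
    ext p
    rw [mem_iInter]
    rfl
  rw [hset]
  exact isClosed_iInter h

namespace WienerSpace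

variable {ρ M : ℝ≥0}

/-- The `n`-th Fourier coefficient of an element of `WienerSpace ρ M`. -/
noncomputable def coef (x : WienerSpace ρ M) (n : ℤ) : ℂ := ((expWeight ρ n)⁻¹ : ℝ) * x.1.1 n

lemma expWeight_mul_norm_coef (x : WienerSpace ρ M) (n : ℤ) :
    expWeight ρ n * ‖coef x n‖ = ‖x.1.1 n‖ := by
  have := expWeight_pos ρ n
  rw [coef, norm_mul, Complex.norm_real, Real.norm_of_nonneg (by positivity)]
  field_simp

lemma coef_ext {x y : WienerSpace ρ M} (h : ∀ n, coef x n = coef y n) : x = y := by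
  have h1 : ∀ n, x.1.1 n = y.1.1 n := fun n => by
    have h0 : (((expWeight ρ n)⁻¹ : ℝ) : ℂ) ≠ 0 := by
      exact_mod_cast (inv_pos.2 (expWeight_pos ρ n)).ne'
    exact mul_left_cancel₀ h0 (h n)
  refine Subtype.ext (Prod.ext (lp.ext (funext h1)) (lp.ext (funext fun n => ?_)))
  rw [x.2 n, y.2 n, h1]

@[simp] lemma coef_add (x y : WienerSpace ρ M) (n : ℤ) :
    coef (x + y) n = coef x n + coef y n := mul_add _ _ _

@[simp] lemma coef_sub (x y : WienerSpace ρ M) (n : ℤ) :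
    coef (x - y) n = coef x n - coef y n := mul_sub _ _ _

@[simp] lemma coef_smul (c : ℂ) (x : WienerSpace ρ M) (n : ℤ) :
    coef (c • x) n = c * coef x n := mul_left_comm _ _ _

lemma summable_coef (x : WienerSpace ρ M) : Summable fun n => expWeight ρ n * ‖coef x n‖ := by
  simp_rw [expWeight_mul_norm_coef]
  simpa using (lp.memℓp x.1.1).summable (by simp)

lemma norm_fst (x : WienerSpace ρ M) : ‖x.1.1‖ = ∑' n, expWeight ρ n * ‖coef x n‖ := by
  simp_rw [expWeight_mul_norm_coef]
  simpa using lp.norm_eq_tsum_rpow (by simp) x.1.1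

lemma tsum_coef_le (x : WienerSpace ρ M) : ∑' n, expWeight ρ n * ‖coef x n‖ ≤ ‖x‖ := by
  rw [← norm_fst]
  exact le_max_left _ _

lemma norm_snd_apply (x : WienerSpace ρ M) (n : ℤ) :
    ‖x.1.2 n‖ = M * (expWeight ρ n * ‖coef x n‖) := by
  rw [x.2 n, expWeight_mul_norm_coef, norm_mul]
  simp

lemma coef_le (x : WienerSpace ρ M) (n : ℤ) : M * (expWeight ρ n * ‖coef x n‖) ≤ ‖x‖ := by
  rw [← norm_snd_apply]
  exact (lp.norm_apply_le_norm (by simp) x.1.2 n).trans (le_max_right _ _)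

lemma expWeight_coef_le (x : WienerSpace ρ M) (n : ℤ) : expWeight ρ n * ‖coef x n‖ ≤ ‖x‖ :=
  ((summable_coef x).le_tsum n fun m _ => mul_nonneg (expWeight_pos ρ m).le (norm_nonneg _)).trans
    (tsum_coef_le x)

lemma norm_coef_le (x : WienerSpace ρ M) (n : ℤ) : ‖coef x n‖ ≤ ‖x‖ :=
  (le_mul_of_one_le_left (norm_nonneg _) (one_le_expWeight ρ n)).trans (expWeight_coef_le x n)

lemma summable_norm_coef (x : WienerSpace ρ M) : Summable fun n => ‖coef x n‖ :=
  (summable_coef x).of_nonneg_of_le (fun _ => norm_nonneg _) fun n =>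
    le_mul_of_one_le_left (norm_nonneg _) (one_le_expWeight ρ n)

lemma norm_le_of_coef (x : WienerSpace ρ M) {C : ℝ} (hC : 0 ≤ C)
    (h1 : ∑' n, expWeight ρ n * ‖coef x n‖ ≤ C)
    (h2 : ∀ n, M * (expWeight ρ n * ‖coef x n‖) ≤ C) : ‖x‖ ≤ C := by
  refine max_le ?_ ?_
  · rwa [← norm_fst] at h1
  · refine lp.norm_le_of_forall_le hC fun n => ?_
    exact (norm_snd_apply x n).le.trans (h2 n)

/-- The element of `WienerSpace ρ M` with prescribed Fourier coefficients. -/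
noncomputable def ofCoef (a : ℤ → ℂ) (h : Summable fun n => expWeight ρ n * ‖a n‖) :
    WienerSpace ρ M :=
  have h1 : Memℓp (fun n => (expWeight ρ n : ℂ) * a n) 1 := by
    refine memℓp_gen ?_
    simpa [abs_of_pos (expWeight_pos ρ _)] using h
  have h2 : Memℓp (fun n => (M : ℂ) * ((expWeight ρ n : ℂ) * a n)) ∞ :=
    (h1.of_exponent_ge le_top).const_mul _
  ⟨(⟨_, h1⟩, ⟨_, h2⟩), fun n => rfl⟩

@[simp] lemma coef_ofCoef (a : ℤ → ℂ) (h : Summable fun n => expWeight ρ n * ‖a n‖) (n : ℤ) :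
    coef (ofCoef a h : WienerSpace ρ M) n = a n := by
  have h0 : (expWeight ρ n : ℂ) ≠ 0 := by exact_mod_cast (expWeight_pos ρ n).ne'
  change ((expWeight ρ n)⁻¹ : ℝ) * ((expWeight ρ n : ℂ) * a n) = a n
  push_cast
  field_simp

lemma norm_le_of_expWeight_le {ρ' : ℝ≥0} (x : WienerSpace ρ M) (y : WienerSpace ρ' M) {C : ℝ}
    (hC : 0 ≤ C)
    (h : ∀ n, expWeight ρ n * ‖coef x n‖ ≤ C * (expWeight ρ' n * ‖coef y n‖)) :
    ‖x‖ ≤ C * ‖y‖ := by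
  refine norm_le_of_coef x (by positivity) ?_ fun n => ?_
  · calc _ ≤ ∑' n, C * (expWeight ρ' n * ‖coef y n‖) :=
        (summable_coef x).tsum_le_tsum h ((summable_coef y).mul_left C)
      _ = C * ∑' n, (expWeight ρ' n * ‖coef y n‖) := tsum_mul_left
      _ ≤ C * ‖y‖ := by gcongr; exact tsum_coef_le y
  · calc _ ≤ M * (C * (expWeight ρ' n * ‖coef y n‖)) := by exact mul_le_mul_of_nonneg_left (h n) M.2
      _ = C * (M * (expWeight ρ' n * ‖coef y n‖)) := by ring
      _ ≤ _ := by gcongr; exact coef_le y n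

/-- The `n`-th Fourier coefficient as a continuous linear functional. -/
noncomputable def coefL (n : ℤ) : WienerSpace ρ M →L[ℂ] ℂ :=
  LinearMap.mkContinuous
    { toFun := fun x => coef x n, map_add' := fun x y => coef_add x y n,
      map_smul' := fun c x => coef_smul c x n } 1 fun x => by simpa using norm_coef_le x n

/-! ### Convolution -/

lemma summable_antidiagonal_mul {R : Type*} [NormedRing R] [CompleteSpace R] {a b : ℤ → R}
    (ha : Summable fun n => ‖a n‖) (hb : Summable fun n => ‖b n‖) :
    Summable fun p : ℤ × ℤ => a p.2 * b (p.1 - p.2) := by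
  let e : ℤ × ℤ ≃ ℤ × ℤ :=
    { toFun := fun p => (p.2, p.1 - p.2), invFun := fun p => (p.1 + p.2, p.1)
      left_inv := fun p => by simp, right_inv := fun p => by simp }
  exact (e.summable_iff (f := fun p : ℤ × ℤ => a p.1 * b p.2)).2
    (summable_mul_of_summable_norm ha hb)

lemma tsum_antidiagonal_mul {R : Type*} [NormedRing R] [CompleteSpace R] {a b : ℤ → R}
    (ha : Summable fun n => ‖a n‖) (hb : Summable fun n => ‖b n‖) :
    ∑' n, ∑' m, a m * b (n - m) = (∑' n, a n) * ∑' n, b n := by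
  let e : ℤ × ℤ ≃ ℤ × ℤ :=
    { toFun := fun p => (p.2, p.1 - p.2), invFun := fun p => (p.1 + p.2, p.1)
      left_inv := fun p => by simp, right_inv := fun p => by simp }
  rw [tsum_mul_tsum_of_summable_norm ha hb, ← e.tsum_eq (fun p : ℤ × ℤ => a p.1 * b p.2)]
  exact ((summable_antidiagonal_mul ha hb).tsum_prod).symm

variable (x y z : WienerSpace ρ M)

lemma summable_coef_mul (n : ℤ) : Summable fun m => coef x m * coef y (n - m) :=
  (summable_antidiagonal_mul (summable_norm_coef x) (summable_norm_coef y)).prod_factor n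

lemma summable_weighted_mul (n : ℤ) : Summable fun m =>
    (expWeight ρ m * ‖coef x m‖) * (expWeight ρ (n - m) * ‖coef y (n - m)‖) :=
  (summable_antidiagonal_mul (summable_coef x).norm (summable_coef y).norm).prod_factor n

lemma expWeight_conv_le (n : ℤ) : expWeight ρ n * ‖∑' m, coef x m * coef y (n - m)‖ ≤
    ∑' m, (expWeight ρ m * ‖coef x m‖) * (expWeight ρ (n - m) * ‖coef y (n - m)‖) := by
  rw [← abs_of_pos (expWeight_pos ρ n), ← Real.norm_eq_abs, ← Complex.norm_real, ← norm_mul,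
    ← tsum_mul_left]
  refine tsum_of_norm_bounded (summable_weighted_mul x y n).hasSum fun m => ?_
  rw [norm_mul, norm_mul, Complex.norm_real, Real.norm_eq_abs, abs_of_pos (expWeight_pos ρ n)]
  have := expWeight_add_le ρ m (n - m)
  rw [add_sub_cancel] at this
  calc _ ≤ expWeight ρ m * expWeight ρ (n - m) * (‖coef x m‖ * ‖coef y (n - m)‖) := by gcongr
    _ = _ := by ring

lemma summable_expWeight_conv :
    Summable fun n => expWeight ρ n * ‖∑' m, coef x m * coef y (n - m)‖ :=
  (summable_antidiagonal_mul (summable_coef x).norm (summable_coef y).norm).prod.of_nonneg_of_le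
    (fun n => mul_nonneg (expWeight_pos ρ n).le (norm_nonneg _)) (expWeight_conv_le x y)

/-- The product of functions: convolution of the Fourier coefficients. -/
noncomputable def mul : WienerSpace ρ M :=
  ofCoef (fun n => ∑' m, coef x m * coef y (n - m)) (summable_expWeight_conv x y)

lemma coef_mul (n : ℤ) : coef (mul x y) n = ∑' m, coef x m * coef y (n - m) := by simp [mul]

lemma norm_mul_le : ‖mul x y‖ ≤ ‖x‖ * ‖y‖ := by
  refine norm_le_of_coef _ (by positivity) ?_ fun n => ?_ <;> simp only [coef_mul]
  · have hp := summable_antidiagonal_mul (summable_coef x).norm (summable_coef y).norm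
    calc _ ≤ _ := (summable_expWeight_conv x y).tsum_le_tsum (expWeight_conv_le x y) hp.prod
      _ = _ := tsum_antidiagonal_mul (summable_coef x).norm (summable_coef y).norm
      _ ≤ _ := mul_le_mul (tsum_coef_le x) (tsum_coef_le y)
        (tsum_nonneg fun m => mul_nonneg (expWeight_pos ρ m).le (norm_nonneg _)) (norm_nonneg _)
  · calc _ ≤ M * ∑' m, (expWeight ρ m * ‖coef x m‖) *
          (expWeight ρ (n - m) * ‖coef y (n - m)‖) := by gcongr; exact expWeight_conv_le x y n
      _ = ∑' m, (expWeight ρ m * ‖coef x m‖) *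
          (M * (expWeight ρ (n - m) * ‖coef y (n - m)‖)) := by
        rw [← tsum_mul_left]; congr 1; ext m; ring
      _ ≤ ∑' m, (expWeight ρ m * ‖coef x m‖) * ‖y‖ := by
        refine Summable.tsum_le_tsum (fun m => ?_) ?_ ((summable_coef x).mul_right _)
        · have := expWeight_pos ρ m
          gcongr
          exact coef_le y _
        · refine ((summable_weighted_mul x y n).mul_left (M : ℝ)).congr fun m => ?_
          ring
      _ ≤ _ := by
        rw [tsum_mul_right]
        gcongr
        exact tsum_coef_le x

lemma mul_add' : mul x (y + z) = mul x y + mul x z := by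
  refine coef_ext fun n => ?_
  simp only [coef_mul, coef_add, mul_add]
  exact (summable_coef_mul x y n).tsum_add (summable_coef_mul x z n)

lemma add_mul' : mul (x + y) z = mul x z + mul y z := by
  refine coef_ext fun n => ?_
  simp only [coef_mul, coef_add, add_mul]
  exact (summable_coef_mul x z n).tsum_add (summable_coef_mul y z n)

lemma mul_smul' (c : ℂ) : mul x (c • y) = c • mul x y := by
  refine coef_ext fun n => ?_
  simp only [coef_mul, coef_smul, mul_left_comm _ c, tsum_mul_left]

lemma mul_sub' : mul x (y - z) = mul x y - mul x z := by
  rw [eq_sub_iff_add_eq, ← mul_add', sub_add_cancel]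

lemma sub_mul' : mul (x - y) z = mul x z - mul y z := by
  rw [eq_sub_iff_add_eq, ← add_mul', sub_add_cancel]

/-- Multiplication by `x`, as a continuous linear operator. -/
noncomputable def mulL : WienerSpace ρ M →L[ℂ] WienerSpace ρ M :=
  LinearMap.mkContinuous
    { toFun := mul x, map_add' := mul_add' x, map_smul' := fun c y => mul_smul' x y c } ‖x‖
    (norm_mul_le x)

@[simp] lemma mulL_apply : mulL x y = mul x y := rfl

lemma norm_mulL_le : ‖mulL x‖ ≤ ‖x‖ := LinearMap.mkContinuous_norm_le _ (norm_nonneg _) _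

/-! ### Complex conjugation -/

/-- Pointwise complex conjugation of functions. -/
noncomputable def conjugate : WienerSpace ρ M :=
  ofCoef (fun n => starRingEnd ℂ (coef x (-n))) (by
    have := (Equiv.neg ℤ).summable_iff.2 (summable_coef x)
    simpa [Function.comp_def, expWeight_neg] using this)

@[simp] lemma coef_conjugate (n : ℤ) : coef (conjugate x) n = starRingEnd ℂ (coef x (-n)) := by
  simp [conjugate]

lemma norm_conjugate_le : ‖conjugate x‖ ≤ ‖x‖ := by
  have h : ∀ n, expWeight ρ n * ‖coef (conjugate x) n‖ = expWeight ρ (-n) * ‖coef x (-n)‖ :=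
    fun n => by simp [expWeight_neg]
  refine norm_le_of_coef _ (norm_nonneg _) ?_ fun n => ?_
  · simp_rw [h]
    exact ((Equiv.neg ℤ).tsum_eq (fun n => expWeight ρ n * ‖coef x n‖)).trans_le (tsum_coef_le x)
  · rw [h]
    exact coef_le x _

lemma conjugate_sub : conjugate (x - y) = conjugate x - conjugate y := coef_ext fun n => by simp

end WienerSpace

/-! ### Differential equations near an approximate solution -/

section ODE

variable {E : Type*} [NormedAddCommGroup E] [NormedSpace ℝ E]

/-- The radial retraction of a normed space onto the closed ball of radius `R`. -/
noncomputable def radialRetraction (R : ℝ) (x : E) : E := (R / max R ‖x‖) • x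

lemma norm_radialRetraction_le {R : ℝ} (hR : 0 < R) (x : E) : ‖radialRetraction R x‖ ≤ R := by
  have hm : 0 < max R ‖x‖ := lt_max_of_lt_left hR
  rw [radialRetraction, norm_smul, Real.norm_of_nonneg (by positivity), div_mul_eq_mul_div,
    div_le_iff₀ hm]
  exact mul_le_mul_of_nonneg_left (le_max_right _ _) hR.le

lemma radialRetraction_of_norm_le {R : ℝ} (hR : 0 < R) {x : E} (hx : ‖x‖ ≤ R) :
    radialRetraction R x = x := by
  rw [radialRetraction, max_eq_left hx, div_self hR.ne', one_smul]

lemma lipschitzWith_radialRetraction {R : ℝ} (hR : 0 < R) :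
    LipschitzWith 2 (radialRetraction R : E → E) := by
  refine LipschitzWith.of_dist_le_mul fun x y => ?_
  rw [dist_eq_norm, dist_eq_norm]
  have hx : 0 < max R ‖x‖ := lt_max_of_lt_left hR
  have hy : 0 < max R ‖y‖ := lt_max_of_lt_left hR
  have key : |max R ‖y‖ - max R ‖x‖| ≤ ‖x - y‖ := by
    rw [max_comm R, max_comm R]
    refine (abs_max_sub_max_le_abs _ _ _).trans ?_
    rw [norm_sub_rev]
    exact abs_norm_sub_norm_le _ _
  have h1 : radialRetraction R x - radialRetraction R y =
      (R / max R ‖x‖) • (x - y) + (R / max R ‖x‖ - R / max R ‖y‖) • y := by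
    simp only [radialRetraction, smul_sub, sub_smul]
    abel
  rw [h1]
  have h2 : ‖(R / max R ‖x‖) • (x - y)‖ ≤ 1 * ‖x - y‖ := by
    rw [norm_smul, Real.norm_of_nonneg (by positivity)]
    gcongr
    exact (div_le_one hx).2 (le_max_left _ _)
  have h3 : ‖(R / max R ‖x‖ - R / max R ‖y‖) • y‖ ≤ 1 * ‖x - y‖ := by
    have : R / max R ‖x‖ - R / max R ‖y‖ =
        R / max R ‖x‖ * (max R ‖y‖ - max R ‖x‖) / max R ‖y‖ := by field_simp
    rw [norm_smul, this, Real.norm_eq_abs, abs_div, abs_mul, abs_of_pos hy,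
      abs_of_pos (div_pos hR hx), div_mul_eq_mul_div, div_le_iff₀ hy]
    have : R / max R ‖x‖ ≤ 1 := (div_le_one hx).2 (le_max_left _ _)
    have h5 := le_max_right R ‖y‖
    gcongr
  calc _ ≤ 1 * ‖x - y‖ + 1 * ‖x - y‖ := (norm_add_le _ _).trans (add_le_add h2 h3)
    _ = _ := by norm_num; ring

variable [CompleteSpace E]

/-- A bounded and globally Lipschitz vector field has solutions on arbitrarily long intervals. -/
lemma exists_hasDerivAt_of_bounded_lipschitz {f : ℝ → E → E} {K L : ℝ≥0}
    (hf : ∀ t, LipschitzWith K (f t)) (hc : ∀ x, Continuous fun t => f t x)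
    (hL : ∀ t x, ‖f t x‖ ≤ L) (x₀ : E) {T : ℝ} (hT : 0 < T) :
    ∃ v : ℝ → E, v 0 = x₀ ∧ ∀ t ∈ Ioo (-T) T, HasDerivAt v (f t (v t)) t := by
  have h0 : (0 : ℝ) ∈ Icc (-T) T := ⟨by linarith, hT.le⟩
  have hP : IsPicardLindelof f ⟨0, h0⟩ x₀ (L * T.toNNReal) 0 L K :=
    { lipschitzOnWith := fun t _ => (hf t).lipschitzOnWith
      continuousOn := fun x _ => (hc x).continuousOn
      norm_le := fun t _ x _ => hL t x
      mul_max_le := by simp [hT.le] }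
  obtain ⟨v, hv0, hv⟩ := hP.exists_eq_forall_mem_Icc_hasDerivWithinAt₀
  exact ⟨v, hv0, fun t ht => (hv t (Ioo_subset_Icc_self ht)).hasDerivAt (Icc_mem_nhds ht.1 ht.2)⟩

lemma gronwallBound_zero_le {K δ T t : ℝ} (hK : 0 ≤ K) (hδ : 0 ≤ δ) (ht : 0 ≤ t) (htT : t ≤ T) :
    gronwallBound 0 K δ t ≤ δ * T * Real.exp (K * T) := by
  refine (gronwallBound_mono le_rfl hδ hK htT).trans ?_
  have hT := ht.trans htT
  rcases hK.eq_or_lt with rfl | hK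
  · simp [gronwallBound_K0]
  · rw [gronwallBound_of_K_ne_0 hK.ne']
    have h1 : Real.exp (K * T) - 1 ≤ K * T * Real.exp (K * T) := by
      have h2 := Real.add_one_le_exp (-(K * T))
      have h3 : Real.exp (K * T) * Real.exp (-(K * T)) = 1 := by rw [← Real.exp_add]; simp
      nlinarith [Real.exp_pos (K * T)]
    calc _ = δ / K * (Real.exp (K * T) - 1) := by ring
      _ ≤ δ / K * (K * T * Real.exp (K * T)) := by gcongr
      _ = _ := by field_simp

/-- If a vector field is Lipschitz on the ball of radius `2R`, then near a sufficiently good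
approximate solution with values in the ball of radius `R` there is a true solution, living on a
neighbourhood of the same time interval. The field is cut off outside the larger ball, and
Grönwall's inequality shows that the solution of the cut-off equation never feels the cut-off. -/
lemma exists_solution_near_approximate {f : ℝ → E → E} {K L : ℝ≥0} {R T δ : ℝ} (hR : 0 < R)
    (hT : 0 < T) (hδ : 0 ≤ δ)
    (hf : ∀ t x y, ‖x‖ ≤ 2 * R → ‖y‖ ≤ 2 * R → ‖f t x - f t y‖ ≤ K * ‖x - y‖)
    (hc : ∀ x, Continuous fun t => f t x)
    (hL : ∀ t x, ‖x‖ ≤ 2 * R → ‖f t x‖ ≤ L)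
    {w w' : ℝ → E} (hw : ∀ t, HasDerivAt w (w' t) t) (hwR : ∀ t ∈ Icc 0 T, ‖w t‖ ≤ R)
    (hw' : ∀ t ∈ Icc 0 T, ‖w' t - f t (w t)‖ ≤ δ)
    (hsmall : δ * T * Real.exp (2 * K * T) < R) :
    ∃ (a b : ℝ) (v : ℝ → E), a < 0 ∧ T < b ∧ v 0 = w 0 ∧
      (∀ t ∈ Ioo a b, HasDerivAt v (f t (v t)) t ∧ ‖v t‖ ≤ 2 * R) ∧
      ∀ t ∈ Icc 0 T, ‖v t - w t‖ ≤ δ * T * Real.exp (2 * K * T) := by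
  have h2R : 0 < 2 * R := by positivity
  -- In a general normed space the radial retraction is only `2`-Lipschitz.
  have hgL : ∀ t, LipschitzWith (2 * K) fun x => f t (radialRetraction (2 * R) x) := fun t => by
    refine LipschitzWith.of_dist_le_mul fun x y => ?_
    rw [dist_eq_norm]
    refine (hf t _ _ (norm_radialRetraction_le h2R x) (norm_radialRetraction_le h2R y)).trans ?_
    have := (lipschitzWith_radialRetraction h2R).dist_le_mul x y
    rw [dist_eq_norm] at this
    calc _ ≤ K * (2 * dist x y) := by gcongr; exact this
      _ = _ := by push_cast; ring
  obtain ⟨v, hv0, hv⟩ := exists_hasDerivAt_of_bounded_lipschitz hgL (fun x => hc _)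
    (fun t x => hL t _ (norm_radialRetraction_le h2R x)) (w 0) (T := T + 1) (by linarith)
  have hI : ∀ t ∈ Icc 0 T, t ∈ Ioo (-(T + 1)) (T + 1) := fun t ht =>
    ⟨by linarith [ht.1], by linarith [ht.2]⟩
  have hclose : ∀ t ∈ Icc 0 T, ‖v t - w t‖ ≤ δ * T * Real.exp (2 * K * T) := by
    intro t ht
    have := dist_le_of_approx_trajectories_ODE (v := fun t x => f t (radialRetraction (2 * R) x))
      (K := 2 * K) (f := v) (g := w) (f' := fun t => f t (radialRetraction (2 * R) (v t)))
      (g' := w') (a := 0) (b := T) (εf := 0) (εg := δ) (δ := 0) hgL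
      (fun t ht => (hv t (hI t ht)).continuousAt.continuousWithinAt)
      (fun t ht => (hv t (hI t (Ico_subset_Icc_self ht))).hasDerivWithinAt)
      (fun t ht => by simp)
      (fun t ht => (hw t).continuousAt.continuousWithinAt)
      (fun t ht => (hw t).hasDerivWithinAt)
      (fun t ht => by
        have ht' := Ico_subset_Icc_self ht
        have := hwR t ht'
        rw [radialRetraction_of_norm_le h2R (by linarith), dist_eq_norm]
        exact hw' t ht')
      (by simp [hv0]) t ht
    rw [dist_eq_norm, zero_add, sub_zero] at this
    refine this.trans ?_
    push_cast
    exact gronwallBound_zero_le (by positivity) hδ ht.1 ht.2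
  have hlt : ∀ t ∈ Icc 0 T, ‖v t‖ < 2 * R := fun t ht => by
    have h1 := hclose t ht
    have h2 := hwR t ht
    have h3 : ‖v t‖ ≤ ‖v t - w t‖ + ‖w t‖ := by simpa using norm_add_le (v t - w t) (w t)
    linarith
  have hev : ∀ t ∈ Icc 0 T, ∀ᶠ s in 𝓝 t, ‖v s‖ < 2 * R := fun t ht =>
    (hv t (hI t ht)).continuousAt.norm.eventually_lt_const (hlt t ht)
  obtain ⟨a, ha, ha'⟩ : ∃ a < 0, ∀ s ∈ Ioc a 0, ‖v s‖ < 2 * R := by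
    obtain ⟨l, u, h0, hlu⟩ := (mem_nhds_iff_exists_Ioo_subset).1 (hev 0 ⟨le_rfl, hT.le⟩)
    exact ⟨l, h0.1, fun s hs => hlu ⟨hs.1, hs.2.trans_lt h0.2⟩⟩
  obtain ⟨b, hb, hb'⟩ : ∃ b > T, ∀ s ∈ Ico T b, ‖v s‖ < 2 * R := by
    obtain ⟨l, u, h0, hlu⟩ := (mem_nhds_iff_exists_Ioo_subset).1 (hev T ⟨hT.le, le_rfl⟩)
    exact ⟨u, h0.2, fun s hs => hlu ⟨h0.1.trans_le hs.1, hs.2⟩⟩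
  refine ⟨max a (-(T + 1)), min b (T + 1), v, max_lt ha (by linarith), lt_min hb (by linarith),
    hv0, fun t ht => ?_, hclose⟩
  have hnorm : ‖v t‖ < 2 * R := by
    rcases le_total t 0 with h | h
    · exact ha' t ⟨(le_max_left _ _).trans_lt ht.1, h⟩
    rcases le_total T t with h' | h'
    · exact hb' t ⟨h', ht.2.trans_le (min_le_left _ _)⟩
    · exact hlt t ⟨h, h'⟩
  have := hv t ⟨(le_max_right _ _).trans_lt ht.1, ht.2.trans_le (min_le_right _ _)⟩
  rw [radialRetraction_of_norm_le h2R hnorm.le] at this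
  exact ⟨this, hnorm.le⟩

end ODE

lemma norm_fourier_apply (n : ℤ) (x : UnitAddCircle) : ‖(fourier n x : ℂ)‖ = 1 := by
  rw [fourier_apply, Circle.norm_coe]

/-! ### Linear flows -/

section LinearFlow

variable {E : Type*} [NormedAddCommGroup E] [NormedSpace ℂ E] [CompleteSpace E]

/-- The solution `e^{tA} φ` of the linear equation `w' = A w`. -/
noncomputable def linearFlow (A : E →L[ℂ] E) (φ : E) (t : ℝ) : E := NormedSpace.exp (t • A) φ

omit [CompleteSpace E] in
lemma linearFlow_zero (A : E →L[ℂ] E) (φ : E) : linearFlow A φ 0 = φ := by simp [linearFlow]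

lemma hasDerivAt_linearFlow (A : E →L[ℂ] E) (φ : E) (t : ℝ) :
    HasDerivAt (linearFlow A φ) (A (linearFlow A φ t)) t := by
  have h := hasDerivAt_exp_smul_const' (𝕂 := ℝ) A t
  exact (((ContinuousLinearMap.apply ℂ E φ).restrictScalars ℝ).hasFDerivAt.comp_hasDerivAt t h)

lemma norm_linearFlow_le (A : E →L[ℂ] E) (φ : E) {t : ℝ} (ht : 0 ≤ t) :
    ‖linearFlow A φ t‖ ≤ Real.exp (‖A‖ * t) * ‖φ‖ := by
  have := norm_le_gronwallBound_of_norm_deriv_right_le (f := linearFlow A φ)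
    (f' := fun t => A (linearFlow A φ t)) (δ := ‖φ‖) (K := ‖A‖) (ε := 0) (a := 0) (b := t)
    (fun s _ => (hasDerivAt_linearFlow A φ s).continuousAt.continuousWithinAt)
    (fun s _ => (hasDerivAt_linearFlow A φ s).hasDerivWithinAt) (by rw [linearFlow_zero])
    (fun s _ => by simpa using A.le_opNorm _) t ⟨ht, le_rfl⟩
  rw [gronwallBound_ε0, sub_zero] at this
  linarith

/-- Second order Taylor estimate for a linear flow. -/
lemma norm_linearFlow_sub_sub_le (A : E →L[ℂ] E) (φ : E) {t : ℝ} (ht : 0 ≤ t) :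
    ‖linearFlow A φ t - φ - t • A φ‖ ≤ t ^ 2 * ‖A‖ ^ 2 * Real.exp (‖A‖ * t) * ‖φ‖ := by
  have hn : ∀ s ∈ Icc 0 t, ‖linearFlow A φ s‖ ≤ Real.exp (‖A‖ * t) * ‖φ‖ := fun s hs =>
    (norm_linearFlow_le A φ hs.1).trans (by gcongr; exact hs.2)
  have h1 : ∀ s ∈ Icc 0 t, ‖linearFlow A φ s - φ‖ ≤ ‖A‖ * (Real.exp (‖A‖ * t) * ‖φ‖) * t := by
    intro s hs
    have := norm_image_sub_le_of_norm_deriv_le_segment' (f := linearFlow A φ)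
      (f' := fun s => A (linearFlow A φ s)) (a := 0) (b := t)
      (C := ‖A‖ * (Real.exp (‖A‖ * t) * ‖φ‖))
      (fun s _ => (hasDerivAt_linearFlow A φ s).hasDerivWithinAt)
      (fun s hs => (A.le_opNorm _).trans (by gcongr; exact hn s (Ico_subset_Icc_self hs))) s hs
    rw [linearFlow_zero] at this
    refine this.trans ?_
    gcongr
    linarith [hs.2]
  have hd : ∀ s, HasDerivAt (fun s => linearFlow A φ s - φ - s • A φ)
      (A (linearFlow A φ s) - A φ) s := fun s => by
    simpa using ((hasDerivAt_linearFlow A φ s).sub_const φ).fun_sub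
      ((hasDerivAt_id s).smul_const (A φ))
  have := norm_image_sub_le_of_norm_deriv_le_segment' (f := fun s => linearFlow A φ s - φ - s • A φ)
      (f' := fun s => A (linearFlow A φ s) - A φ) (a := 0) (b := t)
      (C := ‖A‖ * (‖A‖ * (Real.exp (‖A‖ * t) * ‖φ‖) * t))
      (fun s _ => (hd s).hasDerivWithinAt)
      (fun s hs => by
        rw [← map_sub]
        exact (A.le_opNorm _).trans (by gcongr; exact h1 s (Ico_subset_Icc_self hs)))
      t ⟨ht, le_rfl⟩
  simp only [linearFlow_zero, sub_self, zero_smul, sub_zero] at this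
  exact this.trans (le_of_eq (by ring))

/-- A functional that intertwines `A` with multiplication by a scalar `c` intertwines the flow of
`A` with multiplication by `e^{tc}`. -/
lemma apply_linearFlow (A : E →L[ℂ] E) (φ : E) (ℓ : E →L[ℂ] ℂ) {c : ℂ}
    (h : ∀ x, ℓ (A x) = c * ℓ x) (t : ℝ) : ℓ (linearFlow A φ t) = cexp (t * c) * ℓ φ := by
  have hd : ∀ s : ℝ, HasDerivAt (fun s : ℝ => cexp (-(s * c)) * ℓ (linearFlow A φ s)) 0 s := by
    intro s
    have h1 := (ℓ.restrictScalars ℝ).hasFDerivAt.comp_hasDerivAt s (hasDerivAt_linearFlow A φ s)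
    have h2 : HasDerivAt (fun s : ℝ => cexp (-(s * c))) (cexp (-(s * c)) * -(1 * c)) s :=
      ((((hasDerivAt_id s).ofReal_comp).mul_const c).neg).cexp
    refine (h2.mul h1).congr_deriv ?_
    rw [Function.comp_apply, ContinuousLinearMap.coe_restrictScalars', h]
    ring
  have := is_const_of_deriv_eq_zero (fun s => (hd s).differentiableAt) (fun s => (hd s).deriv) t 0
  simp only [linearFlow_zero, ofReal_zero, zero_mul, neg_zero, Complex.exp_zero, one_mul] at this
  rw [← this, ← mul_assoc, ← Complex.exp_add]
  simp

end LinearFlow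

namespace WienerSpace

variable {ρ M : ℝ≥0}

/-! ### Evaluation at points of the circle -/

lemma summable_coef_mul_fourier (f : WienerSpace ρ M) (x : UnitAddCircle) :
    Summable fun n : ℤ => ‖coef f n * fourier n x‖ := by
  simpa only [norm_mul, norm_fourier_apply, mul_one] using summable_norm_coef f

/-- The function on the circle with the given Fourier coefficients. -/
noncomputable def eval (f : WienerSpace ρ M) (x : UnitAddCircle) : ℂ :=
  ∑' n : ℤ, coef f n * fourier n x

lemma norm_eval_le (f : WienerSpace ρ M) (x : UnitAddCircle) : ‖eval f x‖ ≤ ‖f‖ := by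
  refine (norm_tsum_le_tsum_norm (summable_coef_mul_fourier f x)).trans
    (le_trans ?_ (tsum_coef_le f))
  refine (summable_coef_mul_fourier f x).tsum_le_tsum (fun n => ?_) (summable_coef f)
  rw [norm_mul, norm_fourier_apply, mul_one]
  exact le_mul_of_one_le_left (norm_nonneg _) (one_le_expWeight ρ n)

/-- Evaluation at a point, as a continuous linear functional. -/
noncomputable def evalL (x : UnitAddCircle) : WienerSpace ρ M →L[ℂ] ℂ :=
  LinearMap.mkContinuous
    { toFun := fun f => eval f x
      map_add' := fun f g => by
        simp only [eval, coef_add, add_mul]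
        exact (summable_coef_mul_fourier f x).of_norm.tsum_add
          (summable_coef_mul_fourier g x).of_norm
      map_smul' := fun c f => by
        simp only [eval, coef_smul, mul_assoc, tsum_mul_left]
        rfl } 1
    fun f => by simpa using norm_eval_le f x

@[simp] lemma evalL_apply (f : WienerSpace ρ M) (x : UnitAddCircle) : evalL x f = eval f x := rfl

lemma eval_mul (f g : WienerSpace ρ M) (x : UnitAddCircle) :
    eval (mul f g) x = eval f x * eval g x := by
  rw [eval, eval, eval, ← tsum_antidiagonal_mul (summable_coef_mul_fourier f x)
    (summable_coef_mul_fourier g x)]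
  congr 1
  ext n
  rw [coef_mul, ← tsum_mul_right]
  congr 1
  ext m
  have : (fourier n x : ℂ) = fourier m x * fourier (n - m) x := by
    rw [← fourier_add, add_sub_cancel]
  rw [this]
  ring

lemma eval_conjugate (f : WienerSpace ρ M) (x : UnitAddCircle) :
    eval (conjugate f) x = starRingEnd ℂ (eval f x) := by
  rw [eval, eval, ← (Equiv.neg ℤ).tsum_eq, Complex.conj_tsum]
  congr 1
  ext n
  simp only [Equiv.neg_apply, coef_conjugate, neg_neg, fourier_neg, map_mul]

lemma eval_smul (c : ℂ) (f : WienerSpace ρ M) (x : UnitAddCircle) :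
    eval (c • f) x = c * eval f x := (evalL x).map_smul c f

lemma fourierCoeff_tsum {a : ℤ → ℂ} (ha : Summable fun n => ‖a n‖) (k : ℤ) :
    fourierCoeff (fun x : UnitAddCircle => ∑' n : ℤ, a n * fourier n x) k = a k := by
  have hS : Summable fun n : ℤ => a n • (fourier n : C(UnitAddCircle, ℂ)) := by
    refine Summable.of_norm ?_
    simpa [norm_smul, -fourier_apply, fourier_norm] using ha
  have hev : (fun x : UnitAddCircle => ∑' n : ℤ, a n * fourier n x) =
      ⇑(∑' n : ℤ, a n • (fourier n : C(UnitAddCircle, ℂ))) := by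
    ext x
    rw [← ContinuousMap.tsum_apply hS]
    rfl
  have h2 : Summable fun n : ℤ => a n • fourierBasis (T := 1) n := by
    refine Summable.of_norm ?_
    simpa only [norm_smul, fourierBasis.orthonormal.1, mul_one] using ha
  have h3 : fourierCoeff (⇑(∑' n : ℤ, a n • (fourier n : C(UnitAddCircle, ℂ)))) k =
      fourierBasis.repr (∑' n, a n • fourierBasis (T := 1) n) k := by
    rw [← fourierCoeff_toLp, ← fourierBasis_repr]
    rw [(ContinuousMap.toLp 2 AddCircle.haarAddCircle ℂ).map_tsum hS]
    simp [coe_fourierBasis, fourierLp]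
  rw [hev, h3, HilbertBasis.repr_apply_apply]
  rw [← innerSL_apply_apply ℂ, (innerSL ℂ _).map_tsum h2, tsum_eq_single k]
  · rw [innerSL_apply_apply, inner_smul_right, orthonormal_iff_ite.1 fourierBasis.orthonormal,
      if_pos rfl, mul_one]
  · intro n hn
    rw [innerSL_apply_apply, inner_smul_right, orthonormal_iff_ite.1 fourierBasis.orthonormal,
      if_neg hn.symm, mul_zero]

lemma fourierCoeff_eval (f : WienerSpace ρ M) (n : ℤ) : fourierCoeff (eval f) n = coef f n :=
  fourierCoeff_tsum (summable_norm_coef f) n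

lemma eval_ext {f g : WienerSpace ρ M} (h : ∀ x, eval f x = eval g x) : f = g :=
  coef_ext fun n => by rw [← fourierCoeff_eval, ← fourierCoeff_eval, funext h]

/-! ### The free propagator -/

section Phase

variable (σ : ℤ → ℝ)

/-- The free evolution `S(t)`, multiplying the `n`-th Fourier coefficient by `e^{i t σₙ}`. -/
noncomputable def propagator (t : ℝ) (x : WienerSpace ρ M) : WienerSpace ρ M :=
  ofCoef (fun n => cexp ((t * σ n : ℝ) * I) * coef x n) (by
    simpa [norm_exp_ofReal_mul_I, -ofReal_mul] using summable_coef x)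

@[simp] lemma coef_propagator (t : ℝ) (x : WienerSpace ρ M) (n : ℤ) :
    coef (propagator σ t x) n = cexp ((t * σ n : ℝ) * I) * coef x n := by simp [propagator]

lemma norm_coef_propagator (t : ℝ) (x : WienerSpace ρ M) (n : ℤ) :
    ‖coef (propagator σ t x) n‖ = ‖coef x n‖ := by
  rw [coef_propagator, norm_mul, norm_exp_ofReal_mul_I, one_mul]

@[simp] lemma norm_propagator (t : ℝ) (x : WienerSpace ρ M) : ‖propagator σ t x‖ = ‖x‖ := by
  apply le_antisymm
  · simpa using norm_le_of_expWeight_le (propagator σ t x) x zero_le_one fun n => by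
      rw [norm_coef_propagator, one_mul]
  · simpa using norm_le_of_expWeight_le x (propagator σ t x) zero_le_one fun n => by
      rw [norm_coef_propagator, one_mul]

lemma propagator_sub (t : ℝ) (x y : WienerSpace ρ M) :
    propagator σ t (x - y) = propagator σ t x - propagator σ t y :=
  coef_ext fun n => by simp [mul_sub]

lemma continuous_propagator (x : WienerSpace ρ M) : Continuous fun t => propagator σ t x := by
  refine continuous_iff_continuousAt.2 fun s => ?_
  rw [ContinuousAt, tendsto_iff_norm_sub_tendsto_zero]
  let g : ℝ → ℝ := fun t => ∑' n, expWeight ρ n * ‖coef (propagator σ t x - propagator σ s x) n‖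
  have hg : Continuous g := by
    refine continuous_tsum (u := fun n => 2 * (expWeight ρ n * ‖coef x n‖)) (fun n => ?_)
      ((summable_coef x).mul_left 2) fun n t => ?_
    · simp only [coef_sub, coef_propagator]
      fun_prop
    · have := expWeight_pos ρ n
      rw [Real.norm_of_nonneg (by positivity), coef_sub]
      have h := norm_sub_le (coef (propagator σ t x) n) (coef (propagator σ s x) n)
      rw [norm_coef_propagator, norm_coef_propagator] at h
      calc _ ≤ expWeight ρ n * (‖coef x n‖ + ‖coef x n‖) := by gcongr
        _ = _ := by ring
  have hg0 : g s = 0 := by simp [g]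
  have hlim : Tendsto (fun t => (1 + M) * g t) (𝓝 s) (𝓝 0) := by
    have := (hg.tendsto s).const_mul (1 + (M : ℝ))
    rwa [hg0, mul_zero] at this
  refine squeeze_zero (fun _ => norm_nonneg _) (fun t => ?_) hlim
  have hnn : ∀ n, 0 ≤ expWeight ρ n * ‖coef (propagator σ t x - propagator σ s x) n‖ := fun n =>
    mul_nonneg (expWeight_pos ρ n).le (norm_nonneg _)
  have hgt : 0 ≤ g t := tsum_nonneg hnn
  refine norm_le_of_coef _ (by positivity) ?_ fun n => ?_
  · change g t ≤ _
    nlinarith [M.2, mul_nonneg M.2 hgt]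
  · have h1 : _ ≤ g t := (summable_coef _).le_tsum n fun m _ => hnn m
    calc _ ≤ M * g t := by gcongr
      _ ≤ _ := by nlinarith

end Phase

/-! ### Comparison of different weights -/

/-- The inclusion of the space with weight `e^{2ρ|n|}` into the space with weight `e^{ρ|n|}`. -/
noncomputable def incl (x : WienerSpace (2 * ρ) M) : WienerSpace ρ M :=
  ofCoef (coef x) ((summable_coef x).of_nonneg_of_le
    (fun n => mul_nonneg (expWeight_pos ρ n).le (norm_nonneg _)) fun n => by
      rw [expWeight_two_mul]
      gcongr
      exact le_mul_of_one_le_left (expWeight_pos ρ n).le (one_le_expWeight ρ n))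

@[simp] lemma coef_incl (x : WienerSpace (2 * ρ) M) (n : ℤ) :
    coef (incl x : WienerSpace ρ M) n = coef x n := by simp [incl]

lemma norm_incl_le (x : WienerSpace (2 * ρ) M) : ‖(incl x : WienerSpace ρ M)‖ ≤ ‖x‖ := by
  simpa using norm_le_of_expWeight_le (incl x : WienerSpace ρ M) x zero_le_one fun n => by
    rw [coef_incl, one_mul, expWeight_two_mul]
    gcongr
    exact le_mul_of_one_le_left (expWeight_pos ρ n).le (one_le_expWeight ρ n)

/-- The inclusion, as a continuous linear map. -/
noncomputable def inclL : WienerSpace (2 * ρ) M →L[ℂ] WienerSpace ρ M :=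
  LinearMap.mkContinuous
    { toFun := incl
      map_add' := fun x y => coef_ext fun n => by simp
      map_smul' := fun c x => coef_ext fun n => by simp } 1
    fun x => by simpa using norm_incl_le x

lemma incl_mul (x y : WienerSpace (2 * ρ) M) :
    (incl (mul x y) : WienerSpace ρ M) = mul (incl x) (incl y) :=
  coef_ext fun n => by simp [coef_mul]

lemma incl_conjugate (x : WienerSpace (2 * ρ) M) :
    (incl (conjugate x) : WienerSpace ρ M) = conjugate (incl x) := coef_ext fun n => by simp

lemma incl_propagator (σ : ℤ → ℝ) (t : ℝ) (x : WienerSpace (2 * ρ) M) :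
    (incl (propagator σ t x) : WienerSpace ρ M) = propagator σ t (incl x) :=
  coef_ext fun n => by simp

lemma norm_exp_mul_I_sub_one_le (x : ℝ) : ‖cexp (x * I) - 1‖ ≤ |x| := by
  simpa [mul_comm] using Real.norm_exp_I_mul_ofReal_sub_one_le (x := x)

/-- Over time `t`, the free evolution moves a function by at most `|t|` times the size of the
symbol, at the price of half of the exponential weight. -/
lemma norm_propagator_incl_sub_le {σ : ℤ → ℝ} {θ : ℝ} (hσ : ∀ n, |σ n| ≤ θ * expWeight ρ n)
    (t : ℝ) (x : WienerSpace (2 * ρ) M) :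
    ‖propagator σ t (incl x) - (incl x : WienerSpace ρ M)‖ ≤ |t| * θ * ‖x‖ := by
  have hθ : 0 ≤ θ := by
    have := (abs_nonneg _).trans (hσ 0)
    exact nonneg_of_mul_nonneg_left this (expWeight_pos ρ 0)
  refine norm_le_of_expWeight_le _ _ (by positivity) fun n => ?_
  have h1 : coef (propagator σ t (incl x) - (incl x : WienerSpace ρ M)) n =
      (cexp ((t * σ n : ℝ) * I) - 1) * coef x n := by
    rw [coef_sub, coef_propagator, coef_incl]; ring
  have h2 := norm_exp_mul_I_sub_one_le (t * σ n)
  rw [abs_mul] at h2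
  have h0 := expWeight_pos ρ n
  rw [h1, norm_mul, expWeight_two_mul]
  calc _ ≤ expWeight ρ n * (|t| * (θ * expWeight ρ n) * ‖coef x n‖) := by
        gcongr
        exact h2.trans (by gcongr; exact hσ n)
    _ = _ := by ring

/-! ### The cubic nonlinearity -/

/-- The nonlinearity `iκ |x|² x`. -/
noncomputable def nonlin (κ : ℝ) (x : WienerSpace ρ M) : WienerSpace ρ M :=
  (κ * I : ℂ) • mul (mul x (conjugate x)) x

lemma eval_nonlin (κ : ℝ) (f : WienerSpace ρ M) (x : UnitAddCircle) :
    eval (nonlin κ f) x = κ * I * (‖eval f x‖ ^ 2 * eval f x) := by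
  rw [nonlin, eval_smul, eval_mul, eval_mul, eval_conjugate, Complex.mul_conj, normSq_eq_norm_sq]
  push_cast
  ring

lemma incl_nonlin (κ : ℝ) (x : WienerSpace (2 * ρ) M) :
    (incl (nonlin κ x) : WienerSpace ρ M) = nonlin κ (incl x) := by
  rw [nonlin, nonlin, ← incl_conjugate, ← incl_mul, ← incl_mul]
  exact inclL.map_smul _ _

variable {κ : ℝ} (hκ : |κ| = 1)
include hκ

lemma norm_mul_I_eq_one : ‖(κ * I : ℂ)‖ = 1 := by simp [hκ]

lemma norm_nonlin_le (x : WienerSpace ρ M) : ‖nonlin κ x‖ ≤ ‖x‖ ^ 3 := by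
  rw [nonlin, norm_smul, norm_mul_I_eq_one hκ, one_mul]
  have h1 := norm_mul_le (mul x (conjugate x)) x
  have h2 := norm_mul_le x (conjugate x)
  have h3 := norm_conjugate_le x
  calc _ ≤ ‖x‖ * ‖conjugate x‖ * ‖x‖ := h1.trans (by gcongr)
    _ ≤ ‖x‖ * ‖x‖ * ‖x‖ := by gcongr
    _ = _ := by ring

lemma norm_nonlin_sub_le {x y : WienerSpace ρ M} {R : ℝ} (hx : ‖x‖ ≤ R) (hy : ‖y‖ ≤ R) :
    ‖nonlin κ x - nonlin κ y‖ ≤ 3 * R ^ 2 * ‖x - y‖ := by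
  have hR : 0 ≤ R := (norm_nonneg _).trans hx
  have h : nonlin κ x - nonlin κ y = (κ * I : ℂ) • (mul (mul (x - y) (conjugate x)) x +
      mul (mul y (conjugate (x - y))) x + mul (mul y (conjugate y)) (x - y)) := by
    rw [nonlin, nonlin, ← smul_sub, conjugate_sub]
    simp only [sub_mul', mul_sub']
    congr 1
    abel
  have hb : ∀ a b c : WienerSpace ρ M, ‖mul (mul a (conjugate b)) c‖ ≤ ‖a‖ * ‖b‖ * ‖c‖ :=
    fun a b c => (norm_mul_le _ _).trans (by
      gcongr
      exact (norm_mul_le _ _).trans (by gcongr; exact norm_conjugate_le b))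
  rw [h, norm_smul, norm_mul_I_eq_one hκ, one_mul]
  refine (norm_add₃_le).trans ?_
  calc _ ≤ ‖x - y‖ * ‖x‖ * ‖x‖ + ‖y‖ * ‖x - y‖ * ‖x‖ + ‖y‖ * ‖y‖ * ‖x - y‖ :=
        add_le_add_three (hb _ _ _) (hb _ _ _) (hb _ _ _)
    _ ≤ ‖x - y‖ * R * R + R * ‖x - y‖ * R + R * R * ‖x - y‖ := by gcongr
    _ = _ := by ring

/-! ### The dispersionless flow -/

omit hκ in
/-- The solution `φ e^{iκt|φ|²}` of the dispersionless equation `w' = iκ |w|² w`. -/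
noncomputable def dispersionless (κ : ℝ) (φ : WienerSpace ρ M) : ℝ → WienerSpace ρ M :=
  linearFlow ((κ * I : ℂ) • mulL (mul φ (conjugate φ))) φ

omit hκ in
lemma eval_dispersionless (κ : ℝ) (φ : WienerSpace ρ M) (t : ℝ) (x : UnitAddCircle) :
    eval (dispersionless κ φ t) x = cexp ((t * (κ * ‖eval φ x‖ ^ 2) : ℝ) * I) * eval φ x := by
  have := apply_linearFlow ((κ * I : ℂ) • mulL (mul φ (conjugate φ))) φ (evalL x)
    (c := κ * I * ‖eval φ x‖ ^ 2) (fun y => by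
      rw [smul_apply, mulL_apply, evalL_apply, eval_smul, eval_mul, eval_mul,
        eval_conjugate, Complex.mul_conj, normSq_eq_norm_sq, evalL_apply]
      push_cast
      ring) t
  rw [evalL_apply, evalL_apply] at this
  rw [dispersionless, this]
  push_cast
  ring_nf

omit hκ in
lemma norm_eval_dispersionless (κ : ℝ) (φ : WienerSpace ρ M) (t : ℝ) (x : UnitAddCircle) :
    ‖eval (dispersionless κ φ t) x‖ = ‖eval φ x‖ := by
  rw [eval_dispersionless, norm_mul, norm_exp_ofReal_mul_I, one_mul]

omit hκ in
lemma hasDerivAt_dispersionless (κ : ℝ) (φ : WienerSpace ρ M) (t : ℝ) :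
    HasDerivAt (dispersionless κ φ) (nonlin κ (dispersionless κ φ t)) t := by
  refine (hasDerivAt_linearFlow ((κ * I : ℂ) • mulL (mul φ (conjugate φ))) φ t).congr_deriv ?_
  refine eval_ext fun x => Eq.symm ?_
  rw [smul_apply, mulL_apply, eval_nonlin, eval_smul, eval_mul, eval_mul,
    eval_conjugate, Complex.mul_conj, normSq_eq_norm_sq, norm_eval_dispersionless]
  push_cast
  rfl

omit hκ in
lemma dispersionless_zero (κ : ℝ) (φ : WienerSpace ρ M) : dispersionless κ φ 0 = φ :=
  linearFlow_zero _ _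

lemma norm_generator_le (φ : WienerSpace ρ M) :
    ‖((κ * I : ℂ) • mulL (mul φ (conjugate φ)) : WienerSpace ρ M →L[ℂ] WienerSpace ρ M)‖ ≤
      ‖φ‖ ^ 2 := by
  rw [norm_smul, norm_mul_I_eq_one hκ, one_mul, sq]
  exact (norm_mulL_le _).trans ((norm_mul_le _ _).trans (by gcongr; exact norm_conjugate_le φ))

lemma norm_dispersionless_le {φ : WienerSpace ρ M} {r t : ℝ} (hφ : ‖φ‖ ≤ r) (ht : 0 ≤ t) :
    ‖dispersionless κ φ t‖ ≤ r * Real.exp (r ^ 2 * t) := by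
  have hr := (norm_nonneg _).trans hφ
  refine (norm_linearFlow_le _ φ ht).trans ?_
  rw [mul_comm]
  gcongr
  exact (norm_generator_le hκ φ).trans (by gcongr)

/-- For small times the dispersionless flow is given by its first Picard iterate. -/
lemma norm_dispersionless_sub_le {φ : WienerSpace ρ M} {r t : ℝ} (hφ : ‖φ‖ ≤ r) (ht : 0 ≤ t) :
    ‖dispersionless κ φ t - φ - t • nonlin κ φ‖ ≤ t ^ 2 * r ^ 5 * Real.exp (r ^ 2 * t) := by
  have hr := (norm_nonneg _).trans hφ
  have h := norm_generator_le hκ φ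
  have h' := h.trans (pow_le_pow_left₀ (norm_nonneg _) hφ 2)
  refine (norm_linearFlow_sub_sub_le _ φ ht).trans ?_
  calc _ ≤ t ^ 2 * (r ^ 2) ^ 2 * Real.exp (r ^ 2 * t) * r := by gcongr
    _ = _ := by ring

end WienerSpace

namespace WienerSpace

variable {ρ M : ℝ≥0}

/-! ### The equation in the interaction picture -/

lemma continuous_propagator_comp (σ : ℤ → ℝ) {h : ℝ → ℝ} {g : ℝ → WienerSpace ρ M} {s : Set ℝ}
    (hh : ContinuousOn h s) (hg : ContinuousOn g s) :
    ContinuousOn (fun t => propagator σ (h t) (g t)) s := by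
  have h1 : Continuous fun p : ℝ × WienerSpace ρ M => propagator σ p.1 p.2 := by
    refine continuous_prod_of_continuous_lipschitzWith'
      (fun p : ℝ × WienerSpace ρ M => propagator σ p.1 p.2) 1 (fun t => ?_)
      (fun x => continuous_propagator σ x)
    exact LipschitzWith.of_dist_le_mul fun x y => by
      rw [dist_eq_norm, dist_eq_norm, ← propagator_sub, norm_propagator, NNReal.coe_one, one_mul]
  have h2 := h1.comp_continuousOn (hh.prodMk hg)
  simpa only [Function.comp_def] using h2

lemma continuous_nonlin {κ : ℝ} (hκ : |κ| = 1) :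
    Continuous (nonlin κ : WienerSpace ρ M → WienerSpace ρ M) := by
  refine LocallyLipschitz.continuous fun x => ?_
  refine ⟨(3 * (‖x‖ + 1) ^ 2).toNNReal, Metric.ball 0 (‖x‖ + 1),
    Metric.isOpen_ball.mem_nhds (by simp), ?_⟩
  refine LipschitzOnWith.of_dist_le_mul fun y hy z hz => ?_
  rw [dist_eq_norm, dist_eq_norm, Real.coe_toNNReal _ (by positivity)]
  rw [mem_ball_zero_iff] at hy hz
  exact norm_nonlin_sub_le hκ hy.le hz.le

/-- The nonlinear vector field in the interaction picture: if `w' = iσw + iκ|w|²w`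
then `v(t) = S(-t) w(t)` solves `v' = interaction t v`. -/
noncomputable def interaction (σ : ℤ → ℝ) (κ t : ℝ) (x : WienerSpace ρ M) : WienerSpace ρ M :=
  propagator σ (-t) (nonlin κ (propagator σ t x))

section

variable {κ : ℝ} (hκ : |κ| = 1)
include hκ

lemma norm_interaction_sub_le (σ : ℤ → ℝ) (t : ℝ) {x y : WienerSpace ρ M} {R : ℝ} (hx : ‖x‖ ≤ R)
    (hy : ‖y‖ ≤ R) : ‖interaction σ κ t x - interaction σ κ t y‖ ≤ 3 * R ^ 2 * ‖x - y‖ := by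
  rw [interaction, interaction, ← propagator_sub, norm_propagator]
  have := norm_nonlin_sub_le hκ (x := propagator σ t x) (y := propagator σ t y) (R := R)
    (by simpa) (by simpa)
  rwa [← propagator_sub, norm_propagator] at this

lemma norm_interaction_le (σ : ℤ → ℝ) (t : ℝ) (x : WienerSpace ρ M) :
    ‖interaction σ κ t x‖ ≤ ‖x‖ ^ 3 := by
  rw [interaction, norm_propagator]
  simpa using norm_nonlin_le hκ (propagator σ t x)

lemma continuous_interaction (σ : ℤ → ℝ) (x : WienerSpace ρ M) :
    Continuous fun t => interaction σ κ t x := by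
  rw [← continuousOn_univ]
  refine continuous_propagator_comp σ continuous_neg.continuousOn
    ((continuous_nonlin hκ).comp_continuousOn ?_)
  exact continuous_propagator_comp σ continuous_id.continuousOn continuousOn_const

/-- For a small symbol the interaction field is close to the pure nonlinearity. -/
lemma norm_interaction_incl_sub_le {σ : ℤ → ℝ} {θ : ℝ} (hσ : ∀ n, |σ n| ≤ θ * expWeight ρ n)
    {t T R : ℝ} (ht : t ∈ Icc 0 T) {x : WienerSpace (2 * ρ) M} (hx : ‖x‖ ≤ R) :
    ‖(incl (nonlin κ x) : WienerSpace ρ M) - interaction σ κ t (incl x)‖ ≤ 4 * T * θ * R ^ 3 := by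
  have hθ : 0 ≤ θ := nonneg_of_mul_nonneg_left ((abs_nonneg _).trans (hσ 0)) (expWeight_pos ρ 0)
  have hT : 0 ≤ T := ht.1.trans ht.2
  have hR : 0 ≤ R := (norm_nonneg _).trans hx
  have h1 := norm_propagator_incl_sub_le (M := M) hσ (-t) (nonlin κ (propagator σ t x))
  have h2 := norm_nonlin_le hκ (propagator σ t x)
  have h3 := norm_propagator_incl_sub_le (M := M) hσ t x
  have hi : ‖(incl x : WienerSpace ρ M)‖ ≤ R := (norm_incl_le x).trans hx
  have h4 := norm_nonlin_sub_le hκ (x := propagator σ t (incl x : WienerSpace ρ M)) (y := incl x)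
    (R := R) (by simpa) hi
  rw [abs_neg, abs_of_nonneg ht.1] at h1
  rw [abs_of_nonneg ht.1] at h3
  rw [norm_propagator] at h2
  rw [incl_nonlin, incl_propagator] at h1
  rw [incl_nonlin, interaction, norm_sub_rev]
  calc _ ≤ _ := norm_sub_le_norm_sub_add_norm_sub _ (nonlin κ (propagator σ t (incl x))) _
    _ ≤ T * θ * R ^ 3 + 3 * R ^ 2 * (T * θ * R) := by
      refine add_le_add (h1.trans ?_) (h4.trans ?_)
      · have : ‖x‖ ^ 3 ≤ R ^ 3 := by gcongr
        gcongr
        · exact ht.2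
        · exact h2.trans this
      · gcongr
        refine h3.trans ?_
        gcongr
        exact ht.2
    _ = _ := by ring

omit hκ in
/-- The constant in the comparison of the dispersive and the dispersionless flow. -/
noncomputable def gapConst (r T : ℝ) : ℝ :=
  4 * (r * Real.exp (r ^ 2 * T)) ^ 3 * Real.exp (24 * (r * Real.exp (r ^ 2 * T)) ^ 2 * T)

/-- If the symbol is small enough compared to the time `T`, the solution with data `φ` exists up to
time `T` and stays close to the dispersionless solution. -/
lemma exists_interaction_solution {σ : ℤ → ℝ} {θ : ℝ} (hσ : ∀ n, |σ n| ≤ θ * expWeight ρ n)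
    {φ : WienerSpace (2 * ρ) M} {r T : ℝ} (hφ : ‖φ‖ ≤ r) (hr : 0 < r) (hT : 0 < T)
    (hsmall : T ^ 2 * θ * gapConst r T < r) :
    ∃ (a b R : ℝ) (v : ℝ → WienerSpace ρ M), a < 0 ∧ T < b ∧ v 0 = incl φ ∧
      (∀ t ∈ Ioo a b, HasDerivAt v (interaction σ κ t (v t)) t ∧ ‖v t‖ ≤ R) ∧
      ‖v T - incl (dispersionless κ φ T)‖ ≤ T ^ 2 * θ * gapConst r T := by
  have hθ : 0 ≤ θ := nonneg_of_mul_nonneg_left ((abs_nonneg _).trans (hσ 0)) (expWeight_pos ρ 0)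
  set R := r * Real.exp (r ^ 2 * T) with hRdef
  have hR : 0 < R := by positivity
  have hrR : r ≤ R := le_mul_of_one_le_right hr.le (Real.one_le_exp (by positivity))
  have hgap : T ^ 2 * θ * gapConst r T =
      4 * T * θ * R ^ 3 * T * Real.exp (2 * ((12 * R ^ 2).toNNReal : ℝ) * T) := by
    rw [gapConst, ← hRdef, Real.coe_toNNReal _ (by positivity)]
    ring_nf
  have hdn : ∀ t ∈ Icc 0 T, ‖dispersionless κ φ t‖ ≤ R := fun t ht =>
    (norm_dispersionless_le hκ hφ ht.1).trans (by rw [hRdef]; gcongr; exact ht.2)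
  obtain ⟨a, b, v, ha, hb, hv0, hv, hvw⟩ := exists_solution_near_approximate
    (f := fun t => interaction σ κ t) (K := (12 * R ^ 2).toNNReal) (L := ((2 * R) ^ 3).toNNReal)
    (R := R) (T := T) (δ := 4 * T * θ * R ^ 3) hR hT (by positivity)
    (fun t x y hx hy => by
      refine (norm_interaction_sub_le hκ σ t hx hy).trans (le_of_eq ?_)
      rw [Real.coe_toNNReal _ (by positivity)]
      ring)
    (continuous_interaction hκ σ)
    (fun t x hx => by
      rw [Real.coe_toNNReal _ (by positivity)]
      exact (norm_interaction_le hκ σ t x).trans (by gcongr))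
    (w := fun t => (incl (dispersionless κ φ t) : WienerSpace ρ M))
    (w' := fun t => incl (nonlin κ (dispersionless κ φ t)))
    (fun t => ((inclL (ρ := ρ) (M := M)).restrictScalars ℝ).hasFDerivAt.comp_hasDerivAt t
      (hasDerivAt_dispersionless κ φ t))
    (fun t ht => (norm_incl_le _).trans (hdn t ht))
    (fun t ht => norm_interaction_incl_sub_le hκ hσ ht (hdn t ht))
    (by rw [← hgap]; linarith)
  refine ⟨a, b, 2 * R, v, ha, hb, by rw [hv0, dispersionless_zero], hv, ?_⟩
  rw [hgap]
  exact hvw T ⟨hT.le, le_rfl⟩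

end

end WienerSpace

/-! ### Smoothness of Fourier series -/

lemma summable_pow_mul_expWeight_inv {ρ : ℝ≥0} (hρ : 0 < ρ) (k : ℕ) :
    Summable fun n : ℤ => |2 * Real.pi * (n : ℝ)| ^ k * (expWeight ρ n)⁻¹ := by
  have h := (Real.summable_pow_mul_exp_neg_nat_mul k (r := ρ) hρ).mul_left ((2 * Real.pi) ^ k)
  have hp : |2 * Real.pi| = 2 * Real.pi := abs_of_pos Real.two_pi_pos
  refine Summable.of_nat_of_neg (h.congr fun n => ?_) (h.congr fun n => ?_) <;>
  · rw [expWeight, ← Real.exp_neg, abs_mul, hp]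
    simp
    ring_nf

/-- The Fourier coefficients of the derivative of the function with Fourier coefficients `a`. -/
noncomputable def derivCoef (a : ℤ → ℂ) (n : ℤ) : ℂ := 2 * Real.pi * I * n * a n

lemma norm_derivCoef (a : ℤ → ℂ) (n : ℤ) : ‖derivCoef a n‖ = |2 * Real.pi * n| * ‖a n‖ := by
  rw [derivCoef, norm_mul]
  congr 1
  simp [abs_mul]

lemma norm_iterate_derivCoef (a : ℤ → ℂ) (k : ℕ) (n : ℤ) :
    ‖derivCoef^[k] a n‖ = |2 * Real.pi * n| ^ k * ‖a n‖ := by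
  induction k with
  | zero => simp
  | succ k ih => rw [Function.iterate_succ_apply', norm_derivCoef, ih, pow_succ]; ring

lemma hasDerivAt_fourierSeries {a : ℤ → ℂ} (h0 : Summable fun n => ‖a n‖)
    (h1 : Summable fun n => ‖derivCoef a n‖) (x : ℝ) :
    HasDerivAt (fun x : ℝ => ∑' n : ℤ, a n * fourier n (x : UnitAddCircle))
      (∑' n : ℤ, derivCoef a n * fourier n (x : UnitAddCircle)) x := by
  refine hasDerivAt_tsum (𝕜 := ℝ) (F := ℂ)
    (g := fun (n : ℤ) (x : ℝ) => a n * fourier n (x : UnitAddCircle))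
    (g' := fun (n : ℤ) (x : ℝ) => derivCoef a n * fourier n (x : UnitAddCircle))
    (u := fun n => ‖derivCoef a n‖) h1 (fun n y => ?_)
    (fun n y => ?_) (y₀ := 0) ?_ x
  · refine ((hasDerivAt_fourier 1 n y).const_mul (a n)).congr_deriv ?_
    rw [derivCoef]
    push_cast
    ring
  · rw [norm_mul, norm_fourier_apply, mul_one]
  · exact (h0.congr fun n => by rw [norm_mul, norm_fourier_apply, mul_one]).of_norm

lemma iteratedDeriv_fourierSeries {a : ℤ → ℂ} (h : ∀ k, Summable fun n => ‖derivCoef^[k] a n‖)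
    (k : ℕ) : iteratedDeriv k (fun x : ℝ => ∑' n : ℤ, a n * fourier n (x : UnitAddCircle)) =
      fun x : ℝ => ∑' n : ℤ, derivCoef^[k] a n * fourier n (x : UnitAddCircle) := by
  induction k with
  | zero => simp
  | succ k ih =>
    rw [iteratedDeriv_succ, ih]
    ext x
    have h1 := h (k + 1)
    simp only [Function.iterate_succ_apply'] at h1 ⊢
    exact (hasDerivAt_fourierSeries (h k) h1 x).deriv

lemma contDiff_fourierSeries {a : ℤ → ℂ} (h : ∀ k, Summable fun n => ‖derivCoef^[k] a n‖) :
    ContDiff ℝ ∞ fun x : ℝ => ∑' n : ℤ, a n * fourier n (x : UnitAddCircle) := by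
  refine contDiff_of_differentiable_iteratedDeriv fun k _ => ?_
  rw [iteratedDeriv_fourierSeries h]
  intro x
  refine (hasDerivAt_fourierSeries (h k) ?_ x).differentiableAt
  simpa only [Function.iterate_succ_apply'] using h (k + 1)

namespace WienerSpace

variable {ρ M : ℝ≥0}

lemma norm_coef_le_div (f : WienerSpace ρ M) (n : ℤ) : ‖coef f n‖ ≤ ‖f‖ * (expWeight ρ n)⁻¹ := by
  rw [← div_eq_mul_inv, le_div_iff₀ (expWeight_pos ρ n), mul_comm]
  exact expWeight_coef_le f n

lemma norm_iterate_derivCoef_coef_le (f : WienerSpace ρ M) {R : ℝ} (hf : ‖f‖ ≤ R) (k : ℕ) (n : ℤ) :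
    ‖derivCoef^[k] (coef f) n‖ ≤ R * (|2 * Real.pi * (n : ℝ)| ^ k * (expWeight ρ n)⁻¹) := by
  have := expWeight_pos ρ n
  rw [norm_iterate_derivCoef]
  calc _ ≤ |2 * Real.pi * (n : ℝ)| ^ k * (R * (expWeight ρ n)⁻¹) := by
        gcongr
        exact (norm_coef_le_div f n).trans (by gcongr)
    _ = _ := by ring

lemma summable_iterate_derivCoef (hρ : 0 < ρ) (f : WienerSpace ρ M) (k : ℕ) :
    Summable fun n => ‖derivCoef^[k] (coef f) n‖ :=
  ((summable_pow_mul_expWeight_inv hρ k).mul_left _).of_nonneg_of_le (fun _ => norm_nonneg _)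
    (norm_iterate_derivCoef_coef_le f le_rfl k)

lemma contDiff_eval (hρ : 0 < ρ) (f : WienerSpace ρ M) :
    ContDiff ℝ ∞ fun x : ℝ => eval f (x : UnitAddCircle) :=
  contDiff_fourierSeries (summable_iterate_derivCoef hρ f)

/-- A bounded continuous curve in a Wiener space with positive exponential weight is a continuous
curve in `C^∞`. -/
lemma continuousOn_iteratedDeriv_eval (hρ : 0 < ρ) {z : ℝ → WienerSpace ρ M} {s : Set ℝ} {R : ℝ}
    (hz : ContinuousOn z s) (hR : ∀ t ∈ s, ‖z t‖ ≤ R) (k : ℕ) :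
    ContinuousOn (fun p : ℝ × ℝ =>
      iteratedDeriv k (fun x : ℝ => eval (z p.1) (x : UnitAddCircle)) p.2) (s ×ˢ univ) := by
  have h : ∀ p : ℝ × ℝ, iteratedDeriv k (fun x : ℝ => eval (z p.1) (x : UnitAddCircle)) p.2 =
      ∑' n : ℤ, derivCoef^[k] (coef (z p.1)) n * fourier n (p.2 : UnitAddCircle) := fun p =>
    congrFun (iteratedDeriv_fourierSeries (summable_iterate_derivCoef hρ (z p.1)) k) p.2
  simp_rw [h]
  have hd : ∀ (n : ℤ), ∃ c : ℂ, ∀ a : ℤ → ℂ, derivCoef^[k] a n = c * a n := by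
    intro n
    refine ⟨(2 * Real.pi * I * n) ^ k, fun a => ?_⟩
    clear h
    induction k with
    | zero => simp
    | succ k ih => rw [Function.iterate_succ_apply', derivCoef, ih, pow_succ]; ring
  refine continuousOn_tsum (fun n => ?_) ((summable_pow_mul_expWeight_inv hρ k).mul_left R)
    fun n p hp => ?_
  · obtain ⟨c, hc⟩ := hd n
    simp_rw [hc]
    have h1 : ContinuousOn (fun p : ℝ × ℝ => coef (z p.1) n) (s ×ˢ univ) :=
      (coefL n).continuous.comp_continuousOn (hz.comp continuousOn_fst fun p hp => hp.1)
    have h2 : Continuous fun p : ℝ × ℝ => (fourier n (p.2 : UnitAddCircle) : ℂ) :=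
      (fourier n).continuous.comp ((AddCircle.continuous_mk' 1).comp continuous_snd)
    exact (continuousOn_const.mul h1).mul h2.continuousOn
  · rw [norm_mul, norm_fourier_apply, mul_one]
    exact norm_iterate_derivCoef_coef_le _ (hR _ hp.1) k n

end WienerSpace

namespace WienerSpace

variable {ρ M : ℝ≥0}

/-! ### Solutions of the fractional equation -/

/-- The symbol of `A⁻² (-∂ₓ²)^α`. -/
noncomputable def fracSymbol (α A : ℝ) (n : ℤ) : ℝ := |2 * Real.pi * (n : ℝ)| ^ (2 * α) / A ^ 2

lemma fracSymbol_nonneg (α A : ℝ) (n : ℤ) : 0 ≤ fracSymbol α A n := by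
  rw [fracSymbol]; positivity

lemma summable_fracSymbol (hρ : 0 < ρ) {α : ℝ} (hα : 0 < α) (A : ℝ) :
    Summable fun n : ℤ => fracSymbol α A n * (expWeight ρ n)⁻¹ := by
  obtain ⟨k, hk⟩ := exists_nat_ge (2 * α)
  refine (((summable_pow_mul_expWeight_inv hρ 0).add
    (summable_pow_mul_expWeight_inv hρ k)).mul_left (A ^ 2)⁻¹).of_nonneg_of_le
    (fun n => mul_nonneg (fracSymbol_nonneg α A n) (inv_pos.2 (expWeight_pos ρ n)).le) fun n => ?_
  have h : |2 * Real.pi * (n : ℝ)| ^ (2 * α) ≤ 1 + |2 * Real.pi * (n : ℝ)| ^ k := by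
    rcases le_total |2 * Real.pi * (n : ℝ)| 1 with h1 | h1
    · have := Real.rpow_le_one (abs_nonneg _) h1 (by positivity : 0 ≤ 2 * α)
      have : 0 ≤ |2 * Real.pi * (n : ℝ)| ^ k := by positivity
      linarith
    · have := Real.rpow_le_rpow_of_exponent_le h1 hk
      rw [Real.rpow_natCast] at this
      linarith
  have h0 := expWeight_pos ρ n
  rw [fracSymbol, pow_zero, ← add_mul, div_eq_inv_mul, mul_assoc]
  gcongr

section

variable {α κ A : ℝ} (hα : 0 < α) (hκ : |κ| = 1) (hA : 0 < A) (hρ : 0 < ρ)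
  {v : ℝ → WienerSpace ρ M} {a b R : ℝ}
  (hv : ∀ t ∈ Ioo a b, HasDerivAt v (interaction (fracSymbol α A) κ t (v t)) t ∧ ‖v t‖ ≤ R)
include hα hκ hA hρ hv

omit hα hκ hA hρ in
lemma hasDerivAt_coef_propagator {t : ℝ} (ht : A ^ 2 * t ∈ Ioo a b) (n : ℤ) :
    HasDerivAt (fun t => coef (propagator (fracSymbol α A) (A ^ 2 * t) (v (A ^ 2 * t))) n)
      (A ^ 2 * (I * fracSymbol α A n * coef (propagator (fracSymbol α A) (A ^ 2 * t)
        (v (A ^ 2 * t))) n + coef (nonlin κ (propagator (fracSymbol α A) (A ^ 2 * t)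
        (v (A ^ 2 * t)))) n)) t := by
  simp only [coef_propagator]
  have h1 : HasDerivAt (fun t : ℝ => A ^ 2 * t) (A ^ 2) t := by
    simpa using (hasDerivAt_id t).const_mul (A ^ 2)
  have h2 : HasDerivAt (fun t => coef (v t) n)
      (coef (interaction (fracSymbol α A) κ (A ^ 2 * t) (v (A ^ 2 * t))) n) (A ^ 2 * t) :=
    ((coefL n).restrictScalars ℝ).hasFDerivAt.comp_hasDerivAt _ (hv _ ht).1
  have h3 : HasDerivAt (fun t => coef (v (A ^ 2 * t)) n) _ t := h2.scomp t h1
  have h4 : HasDerivAt (fun t : ℝ => cexp ((A ^ 2 * t * fracSymbol α A n : ℝ) * I))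
      (cexp ((A ^ 2 * t * fracSymbol α A n : ℝ) * I) *
        ((A ^ 2 * fracSymbol α A n : ℝ) * I)) t :=
    (((h1.mul_const (fracSymbol α A n)).ofReal_comp).mul_const I).cexp
  refine (h4.mul h3).congr_deriv ?_
  have h5 : cexp ((A ^ 2 * t * fracSymbol α A n : ℝ) * I) *
      cexp ((-(A ^ 2 * t) * fracSymbol α A n : ℝ) * I) = 1 := by
    rw [← Complex.exp_add, ← Complex.exp_zero]
    congr 1
    push_cast
    ring
  rw [interaction, coef_propagator, real_smul]
  push_cast at h5 ⊢
  linear_combination (A : ℂ) ^ 2 * coef (nonlin κ (propagator (fracSymbol α A) (A ^ 2 * t)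
        (v (A ^ 2 * t)))) n * h5

/-- Undoing the interaction picture and the rescaling produces a smooth solution. -/
lemma isSmoothSolution_eval : IsSmoothSolution α κ (a / A ^ 2) (b / A ^ 2) fun t x =>
    A * eval (propagator (fracSymbol α A) (A ^ 2 * t) (v (A ^ 2 * t))) x := by
  have hA2 : 0 < A ^ 2 := by positivity
  have hI : ∀ t, t ∈ Ioo (a / A ^ 2) (b / A ^ 2) ↔ A ^ 2 * t ∈ Ioo a b := fun t => by
    rw [mem_Ioo, mem_Ioo, div_lt_iff₀' hA2, lt_div_iff₀' hA2]
  set z : ℝ → WienerSpace ρ M := fun t => propagator (fracSymbol α A) (A ^ 2 * t) (v (A ^ 2 * t))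
    with hz
  have hzc : ContinuousOn z (Ioo (a / A ^ 2) (b / A ^ 2)) := by
    refine continuous_propagator_comp _ (by fun_prop) fun t ht => ?_
    have h1 : ContinuousAt (fun t : ℝ => A ^ 2 * t) t := by fun_prop
    exact (ContinuousAt.comp' (hv _ ((hI t).1 ht)).1.continuousAt h1).continuousWithinAt
  have hzR : ∀ t ∈ Ioo (a / A ^ 2) (b / A ^ 2), ‖z t‖ ≤ R := fun t ht => by
    rw [hz, norm_propagator]
    exact (hv _ ((hI t).1 ht)).2
  -- The series for `u` can be differentiated termwise in time.
  have hderiv : ∀ t ∈ Ioo (a / A ^ 2) (b / A ^ 2), ∀ x : UnitAddCircle,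
      HasDerivAt (fun τ => (A : ℂ) * eval (z τ) x)
        (A * ∑' n : ℤ, A ^ 2 * (I * fracSymbol α A n * coef (z t) n + coef (nonlin κ (z t)) n) *
          fourier n x) t := by
    intro t ht x
    refine HasDerivAt.const_mul (A : ℂ) ?_
    refine hasDerivAt_tsum_of_isPreconnected (𝕜 := ℝ) (F := ℂ)
      (g := fun n τ => coef (z τ) n * fourier n x)
      (g' := fun n τ => A ^ 2 * (I * fracSymbol α A n * coef (z τ) n + coef (nonlin κ (z τ)) n) *
          fourier n x)
      (u := fun n => A ^ 2 * (R * (fracSymbol α A n * (expWeight ρ n)⁻¹) +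
        R ^ 3 * (|2 * Real.pi * (n : ℝ)| ^ 0 * (expWeight ρ n)⁻¹)))
      ((((summable_fracSymbol hρ hα A).mul_left R).add
        ((summable_pow_mul_expWeight_inv hρ 0).mul_left (R ^ 3))).mul_left _)
      isOpen_Ioo isPreconnected_Ioo (fun n τ hτ => ?_) (fun n τ hτ => ?_) ht
      (summable_coef_mul_fourier (z t) x).of_norm ht
    · exact (hasDerivAt_coef_propagator hv ((hI τ).1 hτ) n).mul_const _
    · have h1 := norm_coef_le_div (z τ) n
      have h2 := norm_coef_le_div (nonlin κ (z τ)) n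
      have h3 := hzR τ hτ
      have h4 := (norm_nonlin_le hκ (z τ)).trans (pow_le_pow_left₀ (norm_nonneg _) h3 3)
      have h5 := fracSymbol_nonneg α A n
      have h6 := expWeight_pos ρ n
      rw [norm_mul, norm_fourier_apply, mul_one, norm_mul, norm_pow, norm_real,
        Real.norm_of_nonneg hA.le, pow_zero, one_mul]
      gcongr
      refine (norm_add_le _ _).trans (add_le_add ?_ ?_)
      · rw [norm_mul, norm_mul, norm_I, norm_real, Real.norm_of_nonneg h5, one_mul]
        calc _ ≤ fracSymbol α A n * (R * (expWeight ρ n)⁻¹) := by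
              gcongr
              exact h1.trans (by gcongr)
          _ = _ := by ring
      · exact h2.trans (by gcongr)
  have hsum : ∀ t ∈ Ioo (a / A ^ 2) (b / A ^ 2), ∀ x : UnitAddCircle,
      Summable fun n : ℤ => fracSymbol α A n * coef (z t) n * fourier n x := fun t ht x => by
    refine ((summable_fracSymbol hρ hα A).mul_left R).of_norm_bounded fun n => ?_
    have h1 := norm_coef_le_div (z t) n
    have h5 := fracSymbol_nonneg α A n
    have h6 := expWeight_pos ρ n
    rw [norm_mul, norm_fourier_apply, mul_one, norm_mul, norm_real, Real.norm_of_nonneg h5]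
    calc _ ≤ fracSymbol α A n * (R * (expWeight ρ n)⁻¹) := by
          gcongr
          exact h1.trans (by gcongr; exact hzR t ht)
      _ = _ := by ring
  refine ⟨fun t ht => ?_, fun k => ?_, fun t ht x => (hderiv t ht x).differentiableAt,
    fun t ht x => ?_⟩
  · exact contDiff_const.mul (contDiff_eval hρ (z t))
  · have h := continuousOn_iteratedDeriv_eval hρ hzc hzR k
    have h1 := (continuousOn_const (c := (A : ℂ))).mul h
    refine h1.congr fun p _ => ?_
    change iteratedDeriv k (fun x : ℝ => (A : ℂ) * eval (z p.1) (x : UnitAddCircle)) p.2 = _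
    rw [iteratedDeriv_const_mul_field]
    rfl
  · have hfrac : fracLaplacian α (fun x => A * eval (z t) x) x =
        A ^ 3 * ∑' n : ℤ, fracSymbol α A n * coef (z t) n * fourier n x := by
      rw [fracLaplacian, ← tsum_mul_left]
      congr 1
      ext n
      rw [fourierCoeff.const_mul, fourierCoeff_eval, fracSymbol]
      have : (A : ℂ) ≠ 0 := by exact_mod_cast hA.ne'
      push_cast
      field_simp
    have hd : A * ∑' n : ℤ, A ^ 2 * (I * fracSymbol α A n * coef (z t) n +
          coef (nonlin κ (z t)) n) * fourier n x =
        A ^ 3 * (I * ∑' n : ℤ, fracSymbol α A n * coef (z t) n * fourier n x +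
          eval (nonlin κ (z t)) x) := by
      rw [eval, ← tsum_mul_left (a := I), ← ((hsum t ht x).mul_left I).tsum_add
        (summable_coef_mul_fourier _ x).of_norm, ← tsum_mul_left, ← tsum_mul_left]
      congr 1
      ext n
      ring
    rw [(hderiv t ht x).deriv, hfrac, hd, eval_nonlin, norm_mul, norm_real,
      Real.norm_of_nonneg hA.le]
    push_cast
    linear_combination (A : ℂ) ^ 3 * ((∑' n : ℤ, fracSymbol α A n * coef (z t) n * fourier n x) +
      κ * ‖eval (z t) x‖ ^ 2 * eval (z t) x) * I_sq

end

/-- The approximation theorem: as soon as the rescaled symbol is small compared with `T`, the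
solution with initial data `A φ` exists up to time `T / A²`, where its Fourier coefficients are
those of the dispersionless solution, up to phases and a small error. -/
theorem exists_smooth_solution {α κ A θ r T : ℝ} (hα : 0 < α) (hκ : |κ| = 1) (hA : 0 < A)
    (hρ : 0 < ρ) (hθ : ∀ n, fracSymbol α A n ≤ θ * expWeight ρ n) {φ : WienerSpace (2 * ρ) M}
    (hφ : ‖φ‖ ≤ r) (hr : 0 < r) (hT : 0 < T) (hsmall : T ^ 2 * θ * gapConst r T < r) :
    ∃ (a b : ℝ) (u : ℝ → UnitAddCircle → ℂ), a < 0 ∧ T / A ^ 2 < b ∧ IsSmoothSolution α κ a b u ∧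
      (∀ n, fourierCoeff (u 0) n = A * coef φ n) ∧
      (∀ n, M * (expWeight ρ n * ‖fourierCoeff (u (T / A ^ 2)) n -
        A * (cexp ((T * fracSymbol α A n : ℝ) * I) * coef (dispersionless κ φ T) n)‖) ≤
          A * (T ^ 2 * θ * gapConst r T)) ∧
      ∃ C, ∀ n, ‖fourierCoeff (u (T / A ^ 2)) n‖ ≤ C * (expWeight ρ n)⁻¹ := by
  have hA2 : 0 < A ^ 2 := by positivity
  obtain ⟨a, b, R, v, ha, hb, hv0, hv, hvT⟩ := exists_interaction_solution hκ
    (σ := fracSymbol α A) (fun n => by rw [abs_of_nonneg (fracSymbol_nonneg α A n)]; exact hθ n)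
    hφ hr hT hsmall
  refine ⟨a / A ^ 2, b / A ^ 2, _, div_neg_of_neg_of_pos ha hA2, by gcongr,
    isSmoothSolution_eval hα hκ hA hρ hv, fun n => ?_, fun n => ?_,
    A * ‖v T‖, fun n => ?_⟩
  · rw [fourierCoeff.const_mul, fourierCoeff_eval, coef_propagator, mul_zero, hv0, coef_incl]
    simp
  · rw [fourierCoeff.const_mul, fourierCoeff_eval, coef_propagator, mul_div_cancel₀ _ hA2.ne',
      ← mul_sub, ← mul_sub, norm_mul, norm_mul, norm_exp_ofReal_mul_I, one_mul, norm_real,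
      Real.norm_of_nonneg hA.le]
    have := coef_le (v T - incl (dispersionless κ φ T)) n
    rw [coef_sub, coef_incl] at this
    calc _ = A * (M * (expWeight ρ n * ‖coef (v T) n - coef (dispersionless κ φ T) n‖)) := by ring
      _ ≤ _ := mul_le_mul_of_nonneg_left (this.trans hvT) hA.le
  · rw [fourierCoeff.const_mul, fourierCoeff_eval, mul_div_cancel₀ _ hA2.ne', norm_mul, norm_real,
      Real.norm_of_nonneg hA.le, norm_coef_propagator, mul_assoc]
    exact mul_le_mul_of_nonneg_left (norm_coef_le_div _ n) hA.le

/-- Exponential weights at frequency scale `1/ρ` absorb the symbol at the cost of `ρ^{-2α}`. -/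
lemma fracSymbol_le (hρ : 0 < ρ) {α : ℝ} (hα : 0 < α) (A : ℝ) (n : ℤ) :
    fracSymbol α A n ≤ (4 * Real.pi * α / ρ) ^ (2 * α) / A ^ 2 * expWeight ρ n := by
  have hρ' : (0 : ℝ) < ρ := hρ
  have h : |2 * Real.pi * (n : ℝ)| ≤
      4 * Real.pi * α / ρ * Real.exp (ρ * |(n : ℝ)| / (2 * α)) := by
    have h1 : ρ * |(n : ℝ)| / (2 * α) ≤ Real.exp (ρ * |(n : ℝ)| / (2 * α)) :=
      (le_add_of_nonneg_right zero_le_one).trans (Real.add_one_le_exp _)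
    calc |2 * Real.pi * (n : ℝ)| = 4 * Real.pi * α / ρ * (ρ * |(n : ℝ)| / (2 * α)) := by
          rw [abs_mul, abs_of_pos Real.two_pi_pos]; field_simp; ring
      _ ≤ _ := by gcongr
  have h2 := Real.rpow_le_rpow (abs_nonneg _) h (by positivity : 0 ≤ 2 * α)
  rw [Real.mul_rpow (by positivity) (Real.exp_pos _).le, ← Real.exp_mul,
    div_mul_cancel₀ _ (by positivity)] at h2
  rw [fracSymbol, expWeight, div_mul_eq_mul_div]
  gcongr

end WienerSpace

/-! ### Sobolev norms -/

lemma sobolevNorm_eq (s : ℝ) (f : UnitAddCircle → ℂ) :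
    sobolevNorm s f = √(∑' n : ℤ, (1 + (n : ℝ) ^ 2) ^ s * ‖fourierCoeff f n‖ ^ 2) := by
  have h : ∀ n : ℤ, ((1 + (n : ℝ) ^ 2) ^ (1 / 2 : ℝ)) ^ (2 * s) = (1 + (n : ℝ) ^ 2) ^ s :=
    fun n => by
      rw [← Real.rpow_mul (by positivity)]
      congr 1
      ring
  simp only [sobolevNorm, h]

lemma summable_sobolev {ρ : ℝ≥0} (hρ : 0 < ρ) (s : ℝ) {a : ℤ → ℂ} {C : ℝ}
    (ha : ∀ n, ‖a n‖ ≤ C * (expWeight ρ n)⁻¹) :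
    Summable fun n : ℤ => (1 + (n : ℝ) ^ 2) ^ s * ‖a n‖ ^ 2 := by
  obtain ⟨k, hk⟩ := exists_nat_ge s
  have hC : 0 ≤ C := nonneg_of_mul_nonneg_left ((norm_nonneg _).trans (ha 0))
    (inv_pos.2 (expWeight_pos ρ 0))
  refine (((summable_pow_mul_expWeight_inv hρ 0).add
    (summable_pow_mul_expWeight_inv hρ (2 * k))).mul_left (2 ^ k * C ^ 2)).of_nonneg_of_le
    (fun n => by positivity) fun n => ?_
  have h1 : (1 + (n : ℝ) ^ 2) ^ s ≤ (1 + (n : ℝ) ^ 2) ^ k := by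
    rw [← Real.rpow_natCast _ k]
    exact Real.rpow_le_rpow_of_exponent_le (le_add_of_nonneg_right (sq_nonneg _)) hk
  have h2 : (1 + (n : ℝ) ^ 2) ^ k ≤ 2 ^ k * (1 + |2 * Real.pi * (n : ℝ)| ^ (2 * k)) := by
    have hn : (n : ℝ) ^ 2 ≤ |2 * Real.pi * (n : ℝ)| ^ 2 := by
      rw [sq_abs, mul_pow]
      exact le_mul_of_one_le_left (sq_nonneg _) (one_le_pow₀ (by linarith [Real.pi_gt_three]))
    rw [pow_mul]
    calc (1 + (n : ℝ) ^ 2) ^ k ≤ (2 * max 1 (|2 * Real.pi * (n : ℝ)| ^ 2)) ^ k := by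
          gcongr
          have := le_max_left 1 (|2 * Real.pi * (n : ℝ)| ^ 2)
          have := le_max_right 1 (|2 * Real.pi * (n : ℝ)| ^ 2)
          linarith
      _ = 2 ^ k * max 1 (|2 * Real.pi * (n : ℝ)| ^ 2) ^ k := mul_pow _ _ _
      _ ≤ _ := by
        gcongr
        rcases max_cases 1 (|2 * Real.pi * (n : ℝ)| ^ 2) with h | h <;> rw [h.1]
        · rw [one_pow]
          have : 0 ≤ (|2 * Real.pi * (n : ℝ)| ^ 2) ^ k := by positivity
          linarith
        · linarith
  have h3 : ‖a n‖ ^ 2 ≤ C ^ 2 * (expWeight ρ n)⁻¹ := by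
    have h4 : (expWeight ρ n)⁻¹ ≤ 1 := inv_le_one_of_one_le₀ (one_le_expWeight ρ n)
    have h5 := inv_pos.2 (expWeight_pos ρ n)
    calc ‖a n‖ ^ 2 ≤ (C * (expWeight ρ n)⁻¹) ^ 2 := by gcongr; exact ha n
      _ = C ^ 2 * ((expWeight ρ n)⁻¹ * (expWeight ρ n)⁻¹) := by ring
      _ ≤ C ^ 2 * (1 * (expWeight ρ n)⁻¹) := by gcongr
      _ = _ := by ring
  calc _ ≤ (2 ^ k * (1 + |2 * Real.pi * (n : ℝ)| ^ (2 * k))) * (C ^ 2 * (expWeight ρ n)⁻¹) := by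
        gcongr
        exact h1.trans h2
    _ = _ := by ring

lemma le_sobolevNorm_of_finset {ρ : ℝ≥0} (hρ : 0 < ρ) (s : ℝ) {f : UnitAddCircle → ℂ} {C c : ℝ}
    (hf : ∀ n, ‖fourierCoeff f n‖ ≤ C * (expWeight ρ n)⁻¹) (hc : 0 ≤ c) {F : Finset ℤ}
    (hF : ∀ n ∈ F, c ≤ ‖fourierCoeff f n‖) :
    c * √(∑ n ∈ F, (1 + (n : ℝ) ^ 2) ^ s) ≤ sobolevNorm s f := by
  rw [sobolevNorm_eq]
  refine Real.le_sqrt_of_sq_le ?_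
  rw [mul_pow, Real.sq_sqrt (Finset.sum_nonneg fun n _ => by positivity), Finset.mul_sum]
  refine le_trans (Finset.sum_le_sum fun n hn => ?_)
    ((summable_sobolev hρ s hf).sum_le_tsum F fun n _ => by positivity)
  rw [mul_comm]
  gcongr
  exact hF n hn

lemma sobolevNorm_le_of_finset {s : ℝ} {f : UnitAddCircle → ℂ} {B W : ℝ} (hB : 0 ≤ B)
    (F : Finset ℤ) (hF : ∀ n ∉ F, fourierCoeff f n = 0) (hf : ∀ n ∈ F, ‖fourierCoeff f n‖ ≤ B)
    (hW : ∀ n ∈ F, (1 + (n : ℝ) ^ 2) ^ s ≤ W) :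
    sobolevNorm s f ≤ B * √(F.card * W) := by
  rw [sobolevNorm_eq, tsum_eq_sum (s := F) fun n hn => by simp [hF n hn]]
  have h : ∑ n ∈ F, (1 + (n : ℝ) ^ 2) ^ s * ‖fourierCoeff f n‖ ^ 2 ≤ B ^ 2 * (F.card * W) := by
    calc _ ≤ ∑ n ∈ F, W * B ^ 2 := Finset.sum_le_sum fun n hn => by
          have := (by positivity : 0 ≤ (1 + (n : ℝ) ^ 2) ^ s).trans (hW n hn)
          gcongr
          · exact hW n hn
          · exact hf n hn
      _ = _ := by rw [Finset.sum_const, nsmul_eq_mul]; ring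
  refine (Real.sqrt_le_sqrt h).trans (le_of_eq ?_)
  rw [Real.sqrt_mul (sq_nonneg B), Real.sqrt_sq hB]

namespace WienerSpace

/-! ### Indicator data -/

section Box

variable (F : Finset ℤ) (M : ℝ≥0)

/-- The function whose Fourier coefficients are `1 / M` on the finite set `F` and `0` elsewhere. -/
noncomputable def indicatorData (ρ : ℝ≥0) : WienerSpace ρ M :=
  ofCoef (fun n => if n ∈ F then (M : ℂ)⁻¹ else 0)
    (summable_of_ne_finset_zero (s := F) fun n hn => by simp [hn])

lemma coef_indicatorData (ρ : ℝ≥0) (n : ℤ) :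
    coef (indicatorData F M ρ) n = if n ∈ F then (M : ℂ)⁻¹ else 0 := by simp [indicatorData]

variable {F M}

lemma norm_indicatorData_le (hM : 0 < M) {ρ : ℝ≥0} {B c : ℝ} (hc : 1 ≤ c) (hcard : F.card ≤ c * M)
    (hF : ∀ n ∈ F, expWeight ρ n ≤ B) (hB : 0 ≤ B) : ‖indicatorData F M ρ‖ ≤ c * B := by
  have hM' : (0 : ℝ) < M := hM
  refine norm_le_of_coef _ (by positivity) ?_ fun n => ?_
  · rw [tsum_eq_sum (s := F) fun n hn => by simp [coef_indicatorData, hn]]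
    calc _ ≤ ∑ n ∈ F, B * (M : ℝ)⁻¹ := Finset.sum_le_sum fun n hn => by
          have := hF n hn
          rw [coef_indicatorData, if_pos hn]
          simp only [norm_inv, norm_real, NNReal.norm_eq]
          gcongr
      _ = F.card * B * (M : ℝ)⁻¹ := by rw [Finset.sum_const, nsmul_eq_mul]; ring
      _ ≤ c * M * B * (M : ℝ)⁻¹ := by gcongr
      _ = _ := by field_simp
  · rw [coef_indicatorData]
    split_ifs with hn
    · have := hF n hn
      simp only [norm_inv, norm_real, NNReal.norm_eq]
      calc _ ≤ M * (B * (M : ℝ)⁻¹) := by gcongr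
        _ = B := by field_simp
        _ ≤ _ := le_mul_of_one_le_left hB hc
    · simp only [norm_zero, mul_zero]
      positivity

end Box

end WienerSpace

namespace WienerSpace

/-! ### Negative regularity: transfer of energy to low frequencies -/

/-- Two blocks of frequencies near `N` and `2N`. Frequencies `n₁, n₃` in the first and `n₂` in the
second block produce low frequencies `n₁ - n₂ + n₃` in the cubic interaction. -/
noncomputable def twoBlocks (m N : ℕ) : Finset ℤ :=
  Finset.Ico (N : ℤ) (N + 2 * m) ∪ Finset.Ico (2 * N : ℤ) (2 * N + 4 * m)

lemma card_twoBlocks_le (m N : ℕ) : (twoBlocks m N).card ≤ 6 * m := by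
  refine (Finset.card_union_le _ _).trans ?_
  rw [Int.card_Ico, Int.card_Ico]
  omega

lemma le_norm_coef_nonlin_twoBlocks {m N : ℕ} (hm : 0 < m) (ρ : ℝ≥0) {κ : ℝ} (hκ : |κ| = 1)
    {n : ℤ} (h0 : 0 ≤ n) (hn : n ≤ m) :
    1 / (4 * m : ℝ) ≤ ‖coef (nonlin κ (indicatorData (twoBlocks m N) (2 * m) ρ)) n‖ := by
  have hmR : (0 : ℝ) < m := by exact_mod_cast hm
  -- All Fourier coefficients of the data are nonnegative, so there is no cancellation.
  let p : ℤ → ℝ := fun n => if n ∈ twoBlocks m N then (2 * m : ℝ)⁻¹ else 0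
  have hp0 : ∀ n, 0 ≤ p n := fun n => by dsimp only [p]; split_ifs <;> positivity
  have hp1 : ∀ n ∈ twoBlocks m N, p n = (2 * m : ℝ)⁻¹ := fun n hn => if_pos hn
  have hcoef : ∀ n, coef (indicatorData (twoBlocks m N) (2 * m) ρ) n = p n := fun n => by
    rw [coef_indicatorData]
    dsimp only [p]
    split_ifs <;> push_cast <;> rfl
  have hconv : coef (mul (mul (indicatorData (twoBlocks m N) (2 * m) ρ)
      (conjugate (indicatorData (twoBlocks m N) (2 * m) ρ)))
      (indicatorData (twoBlocks m N) (2 * m) ρ)) n =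
      ((∑' j, (∑' i, p i * p (i - j)) * p (n - j) : ℝ) : ℂ) := by
    rw [coef_mul, ofReal_tsum]
    congr 1
    ext j
    rw [coef_mul, hcoef, ofReal_mul, ofReal_tsum]
    congr 2
    ext i
    rw [coef_conjugate, hcoef, hcoef, conj_ofReal, ← ofReal_mul, neg_sub]
  rw [nonlin, coef_smul, norm_mul, norm_mul_I_eq_one hκ, one_mul, hconv, norm_real]
  refine le_trans ?_ (le_abs_self _)
  have hinner0 : ∀ j, 0 ≤ ∑' i, p i * p (i - j) := fun j =>
    tsum_nonneg fun i => mul_nonneg (hp0 i) (hp0 _)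
  have hinner : ∀ l ∈ Finset.Ico (N : ℤ) (N + 2 * m),
      (m : ℝ) * ((2 * m : ℝ)⁻¹ * (2 * m : ℝ)⁻¹) ≤ ∑' i, p i * p (i - (n - l)) := by
    intro l hl
    rw [Finset.mem_Ico] at hl
    have hs : Summable fun i => p i * p (i - (n - l)) :=
      summable_of_ne_finset_zero (s := twoBlocks m N) fun i hi => by simp [p, hi]
    refine le_trans (le_of_eq ?_) (hs.sum_le_tsum (Finset.Ico (N + m : ℤ) (N + 2 * m)) fun i _ =>
      mul_nonneg (hp0 i) (hp0 _))
    rw [Finset.sum_congr rfl (g := fun _ => (2 * m : ℝ)⁻¹ * (2 * m : ℝ)⁻¹), Finset.sum_const,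
      Int.card_Ico, nsmul_eq_mul]
    · congr 1
      have : (N + 2 * m - (N + m) : ℤ).toNat = m := by omega
      rw [this]
    · intro i hi
      rw [Finset.mem_Ico] at hi
      rw [hp1 i, hp1 (i - (n - l))]
      · simp only [twoBlocks, Finset.mem_union, Finset.mem_Ico]; omega
      · simp only [twoBlocks, Finset.mem_union, Finset.mem_Ico]; omega
  have hs : Summable fun j => (∑' i, p i * p (i - j)) * p (n - j) := by
    refine summable_of_ne_finset_zero (s := (twoBlocks m N).image (n - ·)) fun j hj => ?_
    have : n - j ∉ twoBlocks m N := fun h => hj (Finset.mem_image.2 ⟨n - j, h, by ring⟩)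
    simp [p, this]
  refine le_trans ?_ (hs.sum_le_tsum ((Finset.Ico (N : ℤ) (N + 2 * m)).image (n - ·)) fun j _ =>
      mul_nonneg (hinner0 j) (hp0 _))
  rw [Finset.sum_image (fun a _ b _ h => by simpa using h)]
  calc 1 / (4 * m : ℝ) = ∑ l ∈ Finset.Ico (N : ℤ) (N + 2 * m),
        (m : ℝ) * ((2 * m : ℝ)⁻¹ * (2 * m : ℝ)⁻¹) * (2 * m : ℝ)⁻¹ := by
        rw [Finset.sum_const, Int.card_Ico, nsmul_eq_mul]
        have : (N + 2 * m - N : ℤ).toNat = 2 * m := by omega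
        rw [this]
        push_cast
        field_simp
        norm_num
    _ ≤ _ := Finset.sum_le_sum fun l hl => by
        rw [sub_sub_cancel, hp1 l (Finset.mem_union_left _ hl)]
        gcongr
        exact hinner l hl

/-- Data concentrated near the frequencies `N` and `2N` develops low frequencies: after the
rescaled time `τ`, all coefficients up to `m` have size at least `A τ / m`. -/
lemma exists_low_frequency_growth : ∃ c : ℝ, 0 < c ∧ c ≤ 1 ∧ ∀ {α κ A τ : ℝ} {m N : ℕ}, 0 < α →
    |κ| = 1 → 0 < A → 0 < τ → 0 < m → 2 * m ≤ N → τ ≤ c →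
    τ * ((4 * Real.pi * α * N) ^ (2 * α) / A ^ 2) ≤ c →
    ∃ (a b : ℝ) (u : ℝ → UnitAddCircle → ℂ), a < 0 ∧ τ / A ^ 2 < b ∧ IsSmoothSolution α κ a b u ∧
      (∀ n, fourierCoeff (u 0) n = A * if n ∈ twoBlocks m N then (2 * m : ℂ)⁻¹ else 0) ∧
      (∀ n : ℤ, 0 ≤ n → n ≤ m → A * τ / (8 * m) ≤ ‖fourierCoeff (u (τ / A ^ 2)) n‖) ∧
      ∃ (ρ : ℝ≥0) (C : ℝ), 0 < ρ ∧
        ∀ n, ‖fourierCoeff (u (τ / A ^ 2)) n‖ ≤ C * (expWeight ρ n)⁻¹ := by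
  set r : ℝ := 3 * Real.exp 8 with hr
  have hr1 : 1 ≤ r := by
    have := Real.one_le_exp (show (0 : ℝ) ≤ 8 by norm_num)
    linarith
  set D : ℝ := r ^ 5 * Real.exp (r ^ 2) with hD
  set G : ℝ := gapConst r 1 with hG
  have hD0 : 0 < D := by positivity
  have hG0 : 0 < G := by rw [hG, gapConst]; positivity
  refine ⟨min 1 (min (1 / (8 * D)) (1 / (8 * G))), by positivity, min_le_left _ _, ?_⟩
  intro α κ A τ m N hα hκ hA hτ hm hmN hτc hτθ
  set θ : ℝ := (4 * Real.pi * α * N) ^ (2 * α) / A ^ 2 with hθ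
  have hθ0 : 0 ≤ θ := by positivity
  have hmR : (0 : ℝ) < m := by exact_mod_cast hm
  have hN : 0 < N := by omega
  have hNR : (0 : ℝ) < N := by exact_mod_cast hN
  have hτ1 : τ ≤ 1 := hτc.trans (min_le_left _ _)
  have hτD : τ * D ≤ 1 / 8 := by
    have := hτc.trans ((min_le_right _ _).trans (min_le_left _ _))
    rw [le_div_iff₀ (by positivity)] at this
    linarith
  have hτG : τ * θ * G ≤ 1 / 8 := by
    have := hτθ.trans ((min_le_right _ _).trans (min_le_right _ _))
    rw [le_div_iff₀ (by positivity)] at this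
    linarith
  set ρ : ℝ≥0 := (N : ℝ≥0)⁻¹ with hρ
  have hρ0 : 0 < ρ := by positivity
  set φ : WienerSpace (2 * ρ) (2 * m) := indicatorData (twoBlocks m N) (2 * m) (2 * ρ) with hφ
  have hφr : ‖φ‖ ≤ r := by
    refine norm_indicatorData_le (by positivity) (by norm_num) ?_ (fun n hn => ?_)
      (Real.exp_pos _).le
    · have := card_twoBlocks_le m N
      have h' : ((twoBlocks m N).card : ℝ) ≤ 6 * m := by exact_mod_cast this
      push_cast
      linarith
    · have h4 : |(n : ℝ)| ≤ 4 * N := by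
        simp only [twoBlocks, Finset.mem_union, Finset.mem_Ico] at hn
        have : |n| ≤ 4 * N := by rw [abs_le]; omega
        exact_mod_cast this
      rw [expWeight, hρ]
      push_cast
      gcongr
      calc 2 * (N : ℝ)⁻¹ * |(n : ℝ)| ≤ 2 * (N : ℝ)⁻¹ * (4 * N) := by gcongr
        _ = 8 := by field_simp; norm_num
  have hgap : gapConst r τ ≤ G := by
    rw [hG, gapConst, gapConst]
    gcongr
  have hgap0 : 0 ≤ gapConst r τ := by rw [gapConst]; positivity
  have herr : τ ^ 2 * θ * gapConst r τ ≤ τ / 8 := by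
    calc _ ≤ τ ^ 2 * θ * G := by gcongr
      _ = τ * (τ * θ * G) := by ring
      _ ≤ τ * (1 / 8) := by gcongr
      _ = _ := by ring
  obtain ⟨a, b, u, ha, hb, hu, hu0, huT, C, hC⟩ := exists_smooth_solution hα hκ hA hρ0
    (θ := θ) (fun n => by
      refine (fracSymbol_le hρ0 hα A n).trans (le_of_eq ?_)
      rw [hθ, hρ]
      push_cast
      rw [div_inv_eq_mul]) hφr (by linarith) hτ (by linarith)
  refine ⟨a, b, u, ha, hb, hu, fun n => ?_, fun n h0 hn => ?_, ρ, C, hρ0, hC⟩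
  · rw [hu0, coef_indicatorData]
    push_cast
    rfl
  · have h1 := huT n
    have h2 := coef_le (dispersionless κ φ τ - φ - τ • nonlin κ φ) n
    have h3 := le_norm_coef_nonlin_twoBlocks hm (2 * ρ) hκ h0 hn (N := N)
    rw [← hφ] at h3
    have hφn : coef φ n = 0 := by
      rw [hφ, coef_indicatorData, if_neg]
      simp only [twoBlocks, Finset.mem_union, Finset.mem_Ico]
      omega
    have hco : coef (dispersionless κ φ τ - φ - τ • nonlin κ φ) n =
        coef (dispersionless κ φ τ) n - τ * coef (nonlin κ φ) n := by
      rw [coef_sub, coef_sub, hφn, sub_zero, ← Complex.coe_smul, coef_smul]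
    have h4 : 2 * m * ‖coef (dispersionless κ φ τ) n - τ * coef (nonlin κ φ) n‖ ≤ τ / 8 := by
      rw [hco] at h2
      have h5 : (2 * m : ℝ) * ‖coef (dispersionless κ φ τ) n - τ * coef (nonlin κ φ) n‖ ≤
          ‖dispersionless κ φ τ - φ - τ • nonlin κ φ‖ := by
        refine le_trans ?_ h2
        push_cast
        gcongr
        exact le_mul_of_one_le_left (norm_nonneg _) (one_le_expWeight _ _)
      refine h5.trans ((norm_dispersionless_sub_le hκ hφr hτ.le).trans ?_)
      calc _ ≤ τ ^ 2 * r ^ 5 * Real.exp (r ^ 2 * 1) := by gcongr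
        _ = τ * (τ * D) := by rw [hD]; ring_nf
        _ ≤ τ * (1 / 8) := by gcongr
        _ = _ := by ring
    have h6 : 2 * m * ‖fourierCoeff (u (τ / A ^ 2)) n -
        A * (cexp ((τ * fracSymbol α A n : ℝ) * I) * coef (dispersionless κ φ τ) n)‖ ≤
        A * (τ / 8) := by
      refine le_trans ?_ (h1.trans (mul_le_mul_of_nonneg_left herr hA.le))
      push_cast
      gcongr
      exact le_mul_of_one_le_left (norm_nonneg _) (one_le_expWeight _ _)
    have h7 : ‖A * (cexp ((τ * fracSymbol α A n : ℝ) * I) * coef (dispersionless κ φ τ) n)‖ =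
        A * ‖coef (dispersionless κ φ τ) n‖ := by
      rw [norm_mul, norm_mul, norm_exp_ofReal_mul_I, one_mul, norm_real, Real.norm_of_nonneg hA.le]
    have h8 : ‖(τ : ℂ) * coef (nonlin κ φ) n‖ = τ * ‖coef (nonlin κ φ) n‖ := by
      rw [norm_mul, norm_real, Real.norm_of_nonneg hτ.le]
    have h9 := norm_le_norm_add_norm_sub' ((τ : ℂ) * coef (nonlin κ φ) n)
      (coef (dispersionless κ φ τ) n)
    have h10 := norm_le_norm_add_norm_sub' (A * (cexp ((τ * fracSymbol α A n : ℝ) * I) *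
      coef (dispersionless κ φ τ) n)) (fourierCoeff (u (τ / A ^ 2)) n)
    rw [h7, norm_sub_rev] at h10
    rw [h8, norm_sub_rev] at h9
    rw [div_le_iff₀ (by positivity)] at h3 ⊢
    have e1 := mul_le_mul_of_nonneg_left h3 hτ.le
    have e2 := mul_le_mul_of_nonneg_right h9 hmR.le
    have e3 := mul_le_mul_of_nonneg_right h10 hmR.le
    clear_value θ ρ φ G D
    generalize ‖coef (dispersionless κ φ τ) n‖ = X at *
    generalize ‖coef (nonlin κ φ) n‖ = Y at *
    generalize ‖coef (dispersionless κ φ τ) n - τ * coef (nonlin κ φ) n‖ = d₁ at *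
    generalize ‖fourierCoeff (u (τ / A ^ 2)) n - A * (cexp ((τ * fracSymbol α A n : ℝ) * I) *
      coef (dispersionless κ φ τ) n)‖ = d₂ at *
    generalize ‖fourierCoeff (u (τ / A ^ 2)) n‖ = U at *
    have e4 : A * (τ / 4 - τ / 16) ≤ A * (X * m) :=
      mul_le_mul_of_nonneg_left (by linarith only [e1, e2, h4]) hA.le
    linarith only [e3, e4, h6]

end WienerSpace

/-- Norm inflation at scale `ε`: some smooth solution has `H^s` norm below `ε` at time `0` and above
`ε⁻¹` at a time before `ε`. -/
def NormInflation (α s κ ε : ℝ) : Prop :=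
  ∃ (a b : ℝ) (u : ℝ → UnitAddCircle → ℂ) (t : ℝ),
    a < 0 ∧ 0 < t ∧ t < b ∧ t < ε ∧ IsSmoothSolution α κ a b u ∧
    sobolevNorm s (u 0) < ε ∧ ε⁻¹ < sobolevNorm s (u t)

namespace WienerSpace

lemma exists_normInflation_of_parameters : ∃ c : ℝ, 0 < c ∧ c ≤ 1 ∧
    ∀ {α s κ ε A τ : ℝ} {m N : ℕ}, 0 < α → |κ| = 1 → s ≤ 0 → 0 < A → 0 < τ → 0 < m → 2 * m ≤ N →
    τ ≤ c → τ * ((4 * Real.pi * α * N) ^ (2 * α) / A ^ 2) ≤ c → τ / A ^ 2 < ε →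
    2 * (A * (N : ℝ) ^ s / √m) < ε →
    ε⁻¹ < A * τ / (8 * m) * √(∑ n ∈ Finset.Icc (0 : ℤ) m, (1 + (n : ℝ) ^ 2) ^ s) →
    NormInflation α s κ ε := by
  obtain ⟨c, hc0, hc1, h⟩ := exists_low_frequency_growth
  refine ⟨c, hc0, hc1, ?_⟩
  intro α s κ ε A τ m N hα hκ hs hA hτ hm hmN hτc hτθ htε hinit hfin
  obtain ⟨a, b, u, ha, hb, hu, hu0, huT, ρ, C, hρ, hC⟩ := h hα hκ hA hτ hm hmN hτc hτθ
  have hmR : (0 : ℝ) < m := by exact_mod_cast hm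
  have hNR : (0 : ℝ) < N := by
    have : 0 < N := by omega
    exact_mod_cast this
  refine ⟨a, b, u, τ / A ^ 2, ha, by positivity, hb, htε, hu, lt_of_le_of_lt ?_ hinit,
    hfin.trans_le ?_⟩
  · have hle := sobolevNorm_le_of_finset (s := s) (f := u 0) (B := A * (2 * m : ℝ)⁻¹)
      (W := ((N : ℝ) ^ s) ^ 2) (by positivity) (twoBlocks m N) (fun n hn => by simp [hu0, hn])
      (fun n hn => by
        rw [hu0, if_pos hn, norm_mul, norm_real, Real.norm_of_nonneg hA.le]
        simp)
      (fun n hn => by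
        have hn' : (N : ℝ) ≤ n := by
          simp only [twoBlocks, Finset.mem_union, Finset.mem_Ico] at hn
          have : (N : ℤ) ≤ n := by omega
          exact_mod_cast this
        have h1 : (N : ℝ) ^ 2 ≤ 1 + (n : ℝ) ^ 2 := by nlinarith
        refine (Real.rpow_le_rpow_of_nonpos (by positivity) h1 hs).trans (le_of_eq ?_)
        rw [← Real.rpow_natCast, ← Real.rpow_natCast, ← Real.rpow_mul hNR.le,
          ← Real.rpow_mul hNR.le, mul_comm])
    refine hle.trans ?_
    have hcard : ((twoBlocks m N).card : ℝ) ≤ 16 * m := by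
      have h1 : ((twoBlocks m N).card : ℝ) ≤ 6 * m := by exact_mod_cast card_twoBlocks_le m N
      linarith
    have hsq : √((twoBlocks m N).card * ((N : ℝ) ^ s) ^ 2) ≤ 4 * √m * (N : ℝ) ^ s := by
      refine Real.sqrt_le_iff.2 ⟨by positivity, ?_⟩
      rw [mul_pow, mul_pow, Real.sq_sqrt hmR.le]
      gcongr
      linarith
    calc _ ≤ A * (2 * m : ℝ)⁻¹ * (4 * √m * (N : ℝ) ^ s) := by gcongr
      _ = 2 * (A * (N : ℝ) ^ s * (√m / m)) := by field_simp; norm_num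
      _ = _ := by rw [Real.sqrt_div_self]; ring
  · refine le_sobolevNorm_of_finset hρ s hC (by positivity) fun n hn => ?_
    rw [Finset.mem_Icc] at hn
    exact huT n hn.1 hn.2

lemma one_le_sum_rpow (s : ℝ) (m : ℕ) :
    1 ≤ ∑ n ∈ Finset.Icc (0 : ℤ) m, (1 + (n : ℝ) ^ 2) ^ s := by
  have h := Finset.single_le_sum (f := fun n : ℤ => (1 + (n : ℝ) ^ 2) ^ s)
    (s := Finset.Icc (0 : ℤ) m) (a := 0) (fun n _ => by positivity)
    (Finset.mem_Icc.2 ⟨le_rfl, Int.natCast_nonneg m⟩)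
  simpa using h

lemma rpow_div_two_le_sum_rpow {s σ : ℝ} (hσ0 : σ ≤ 0) (hσ : σ = -(1 / 2) ∨ -(1 / 2) ≤ σ ∧ σ = s)
    {m : ℕ} (hm : 0 < m) :
    (m : ℝ) ^ (1 + 2 * σ) / 2 ≤ ∑ n ∈ Finset.Icc (0 : ℤ) m, (1 + (n : ℝ) ^ 2) ^ s := by
  have hmR : (1 : ℝ) ≤ m := by exact_mod_cast hm
  rcases hσ with rfl | ⟨hσ, rfl⟩
  · refine le_trans ?_ (one_le_sum_rpow s m)
    norm_num
  · have h2 : (1 / 2 : ℝ) ≤ 2 ^ σ := by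
      calc (1 / 2 : ℝ) = 2 ^ (-1 : ℝ) := by rw [Real.rpow_neg_one]; norm_num
        _ ≤ _ := Real.rpow_le_rpow_of_exponent_le (by norm_num) (by linarith)
    calc (m : ℝ) ^ (1 + 2 * σ) / 2 = m * ((m : ℝ) ^ (2 * σ) * (1 / 2)) := by
          rw [Real.rpow_add (by linarith), Real.rpow_one]; ring
      _ ≤ m * ((m : ℝ) ^ (2 * σ) * 2 ^ σ) := by gcongr
      _ = m * (2 * (m : ℝ) ^ 2) ^ σ := by
        rw [Real.mul_rpow (by norm_num) (by positivity), ← Real.rpow_natCast,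
          ← Real.rpow_mul (by positivity)]
        ring_nf
      _ ≤ (m + 1 : ℕ) * (2 * (m : ℝ) ^ 2) ^ σ := by
        gcongr
        linarith
      _ = ∑ n ∈ Finset.Icc (0 : ℤ) m, (2 * (m : ℝ) ^ 2) ^ σ := by
        rw [Finset.sum_const, Int.card_Icc, nsmul_eq_mul]
        congr 2
      _ ≤ _ := Finset.sum_le_sum fun n hn => by
        rw [Finset.mem_Icc] at hn
        have h0 : (0 : ℝ) ≤ n := by exact_mod_cast hn.1
        have h1 : (n : ℝ) ≤ m := by exact_mod_cast hn.2
        exact Real.rpow_le_rpow_of_nonpos (by positivity) (by nlinarith) hσ0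

/-- At the critical exponent `s = -1/2` of `α = 1` the low frequency sum still diverges, although
only logarithmically. -/
lemma tendsto_sum_rpow_neg_half :
    Tendsto (fun m : ℕ => ∑ n ∈ Finset.Icc (0 : ℤ) m, (1 + (n : ℝ) ^ 2) ^ (-(1 / 2) : ℝ))
      atTop atTop := by
  have h : Tendsto (fun m : ℕ => ∑ i ∈ Finset.range m, 1 / (i + 1 : ℝ)) atTop atTop :=
    Real.tendsto_sum_range_one_div_nat_succ_atTop
  refine tendsto_atTop_mono (fun m => ?_) h
  calc ∑ i ∈ Finset.range m, 1 / (i + 1 : ℝ)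
      ≤ ∑ i ∈ Finset.range m, (1 + ((i : ℤ) : ℝ) ^ 2) ^ (-(1 / 2) : ℝ) := by
        refine Finset.sum_le_sum fun i _ => ?_
        rw [Real.rpow_neg (by positivity), ← Real.sqrt_eq_rpow, ← one_div]
        refine one_div_le_one_div_of_le (by positivity) ?_
        rw [Real.sqrt_le_iff]
        push_cast
        exact ⟨by positivity, by nlinarith [(Nat.cast_nonneg i : (0 : ℝ) ≤ i)]⟩
    _ = ∑ n ∈ (Finset.range m).image (fun i : ℕ => (i : ℤ)),
          (1 + (n : ℝ) ^ 2) ^ (-(1 / 2) : ℝ) := by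
        rw [Finset.sum_image (fun a _ b _ h => by exact_mod_cast h)]
    _ ≤ _ := by
        refine Finset.sum_le_sum_of_subset_of_nonneg (fun n hn => ?_) fun n _ _ => by positivity
        obtain ⟨i, hi, rfl⟩ := Finset.mem_image.1 hn
        rw [Finset.mem_range] at hi
        rw [Finset.mem_Icc]
        omega

lemma tendsto_natCast_rpow {p : ℝ} (hp : 0 < p) :
    Tendsto (fun m : ℕ => (m : ℝ) ^ p) atTop atTop :=
  (tendsto_rpow_atTop hp).comp tendsto_natCast_atTop_atTop

lemma tendsto_natCast_rpow_neg {p : ℝ} (hp : p < 0) :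
    Tendsto (fun m : ℕ => (m : ℝ) ^ p) atTop (𝓝 0) := by
  have h := (tendsto_rpow_neg_atTop (neg_pos.2 hp)).comp (tendsto_natCast_atTop_atTop (R := ℝ))
  simpa [Function.comp_def] using h

/-- The regime `α ≥ 1` in which the low frequency output diverges: the amplitude is chosen just
below the dispersive threshold `N^α` (a small multiple of it), with `N = 2m`, and the
rescaled time is kept fixed. -/
lemma normInflation_of_tendsto {α s κ ε : ℝ} (hα : 1 ≤ α) (hκ : |κ| = 1) (hε : 0 < ε)
    (hs : s ≤ 1 / 2 - α)
    (hdiv : Tendsto (fun m : ℕ => (m : ℝ) ^ (α - 1) *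
      √(∑ n ∈ Finset.Icc (0 : ℤ) m, (1 + (n : ℝ) ^ 2) ^ s)) atTop atTop) :
    NormInflation α s κ ε := by
  obtain ⟨c, hc0, hc1, h⟩ := exists_normInflation_of_parameters
  have hα0 : 0 < α := by linarith
  set B : ℝ := (8 * Real.pi * α) ^ (2 * α) with hB
  have hB0 : 0 < B := by positivity
  obtain ⟨K, hK⟩ : ∃ K : ℝ, 1 + 1 / B + 2 / ε < K := exists_gt _
  have hBinv : 0 < 1 / B := by positivity
  have hεinv : 0 < 2 / ε := by positivity
  have hK1 : 1 < K := by linarith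
  have hK0 : 0 < K := by linarith
  have hBK : 1 ≤ B * K ^ 2 := by
    have h1 : 1 / B ≤ K ^ 2 := by nlinarith
    rwa [div_le_iff₀' hB0] at h1
  have hKε : 2 / K < ε := by
    rw [div_lt_iff₀ hK0]
    have : 2 / ε < K := by linarith
    rwa [div_lt_iff₀' hε] at this
  have hev1 : ∀ᶠ m : ℕ in atTop, (m : ℝ) ^ (-(2 * α)) < ε * B / c :=
    (tendsto_natCast_rpow_neg (by linarith)).eventually_lt_const (by positivity)
  have hev2 := hdiv.eventually_gt_atTop (8 * B * K ^ 3 / (c * ε))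
  obtain ⟨m, hm1, hm2, hm⟩ := (hev1.and (hev2.and (eventually_gt_atTop 0))).exists
  have hmR : (1 : ℝ) ≤ m := by exact_mod_cast hm
  have hm0 : (0 : ℝ) < m := by linarith
  have hA2 : ((m : ℝ) ^ α / K) ^ 2 = (m : ℝ) ^ (2 * α) / K ^ 2 := by
    rw [div_pow, mul_comm 2 α, Real.rpow_mul hm0.le, ← Real.rpow_natCast _ 2]
    norm_num
  have hmα : 0 < (m : ℝ) ^ (2 * α) := by positivity
  refine h (A := (m : ℝ) ^ α / K) (τ := c / (B * K ^ 2)) (m := m) (N := 2 * m) hα0 hκ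
    (by linarith) (by positivity) (by positivity) hm le_rfl (div_le_self hc0.le hBK) ?_ ?_ ?_ ?_
  · have : (4 * Real.pi * α * ((2 * m : ℕ) : ℝ)) ^ (2 * α) = B * (m : ℝ) ^ (2 * α) := by
      rw [hB, ← Real.mul_rpow (by positivity) (by positivity)]
      congr 1
      push_cast
      ring
    rw [this, hA2]
    refine le_of_eq ?_
    field_simp
  · rw [hA2]
    rw [Real.rpow_neg hm0.le, lt_div_iff₀ hc0, inv_mul_lt_iff₀ hmα] at hm1
    rw [div_div, div_lt_iff₀ (by positivity)]
    calc c < (m : ℝ) ^ (2 * α) * (ε * B) := hm1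
      _ = _ := by field_simp
  · refine lt_of_le_of_lt ?_ hKε
    have h1 : ((2 * m : ℕ) : ℝ) ^ s ≤ (m : ℝ) ^ s := by
      refine Real.rpow_le_rpow_of_nonpos hm0 ?_ (by linarith)
      push_cast
      linarith
    have h2 : (m : ℝ) ^ α * (m : ℝ) ^ s / √m ≤ 1 := by
      rw [Real.sqrt_eq_rpow, ← Real.rpow_add hm0, ← Real.rpow_sub hm0]
      exact Real.rpow_le_one_of_one_le_of_nonpos hmR (by linarith)
    calc _ ≤ 2 * ((m : ℝ) ^ α / K * (m : ℝ) ^ s / √m) := by gcongr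
      _ = 2 / K * ((m : ℝ) ^ α * (m : ℝ) ^ s / √m) := by ring
      _ ≤ 2 / K * 1 := by gcongr
      _ = _ := mul_one _
  · set S := √(∑ n ∈ Finset.Icc (0 : ℤ) m, (1 + (n : ℝ) ^ 2) ^ s)
    have h1 : (m : ℝ) ^ (α - 1) = (m : ℝ) ^ α / m := by rw [Real.rpow_sub hm0, Real.rpow_one]
    rw [h1, div_lt_iff₀ (by positivity)] at hm2
    rw [inv_lt_iff_one_lt_mul₀ hε]
    have h3 : 8 * B * K ^ 3 < 8 * B * K ^ 3 * ((m : ℝ) ^ α / K * (c / (B * K ^ 2)) /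
        (8 * m) * S * ε) := by
      refine hm2.trans_le (le_of_eq ?_)
      field_simp
    have h4 : 0 < 8 * B * K ^ 3 := by positivity
    exact (lt_mul_iff_one_lt_right h4).1 h3

/-- For `α = 1` and `s < -1/2` there is room for an amplitude above `m`, so that the symbol is
harmless and the low frequency output is large without any divergence in `m`. -/
lemma normInflation_of_one_of_lt {s κ ε : ℝ} (hκ : |κ| = 1) (hε : 0 < ε) (hs : s < -(1 / 2)) :
    NormInflation 1 s κ ε := by
  obtain ⟨c, hc0, hc1, h⟩ := exists_normInflation_of_parameters
  set B : ℝ := (8 * Real.pi) ^ 2 with hB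
  have hB0 : 0 < B := by positivity
  obtain ⟨K, hK⟩ : ∃ K : ℝ, 1 + B + 8 / (c * ε) < K := exists_gt _
  have hεinv : 0 < 8 / (c * ε) := by positivity
  have hK1 : 1 < K := by linarith
  have hK0 : 0 < K := by linarith
  have hev1 : ∀ᶠ m : ℕ in atTop, (m : ℝ) ^ (1 / 2 + s) < ε / (2 * K) :=
    (tendsto_natCast_rpow_neg (by linarith)).eventually_lt_const (by positivity)
  have hev2 := (tendsto_natCast_atTop_atTop (R := ℝ)).eventually_gt_atTop (1 / ε)
  obtain ⟨m, hm1, hm2, hm⟩ := (hev1.and (hev2.and (eventually_gt_atTop 0))).exists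
  have hmR : (1 : ℝ) ≤ m := by exact_mod_cast hm
  have hm0 : (0 : ℝ) < m := by linarith
  refine h (A := K * m) (τ := c) (m := m) (N := 2 * m) one_pos hκ
    (by linarith) (by positivity) hc0 hm le_rfl le_rfl ?_ ?_ ?_ ?_
  · have h2 : (4 * Real.pi * 1 * ((2 * m : ℕ) : ℝ)) ^ (2 * 1 : ℝ) = B * (m : ℝ) ^ 2 := by
      rw [hB, ← mul_pow, mul_one, ← Real.rpow_natCast]
      push_cast
      rw [mul_one]
      congr 1
      ring
    have h3 : B ≤ K ^ 2 := by nlinarith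
    rw [h2]
    refine mul_le_of_le_one_right hc0.le ?_
    rw [div_le_one (by positivity), mul_pow]
    gcongr
  · rw [div_lt_iff₀ hε] at hm2
    rw [div_lt_iff₀ (by positivity), mul_pow]
    have h3 : (1 : ℝ) ≤ K ^ 2 * m := by nlinarith
    nlinarith
  · have h1 : ((2 * m : ℕ) : ℝ) ^ s ≤ (m : ℝ) ^ s := by
      refine Real.rpow_le_rpow_of_nonpos hm0 ?_ (by linarith)
      push_cast
      linarith
    have h2 : (m : ℝ) * (m : ℝ) ^ s / √m = (m : ℝ) ^ (1 / 2 + s) := by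
      rw [Real.sqrt_eq_rpow, mul_comm, ← Real.rpow_add_one hm0.ne', ← Real.rpow_sub hm0]
      congr 1
      ring
    rw [lt_div_iff₀ (by positivity)] at hm1
    calc _ ≤ 2 * (K * m * (m : ℝ) ^ s / √m) := by gcongr
      _ = (m : ℝ) * (m : ℝ) ^ s / √m * (2 * K) := by ring
      _ < ε := by rw [h2]; exact hm1
  · have h1 := Real.one_le_sqrt.2 (one_le_sum_rpow s m)
    have h2 : 8 / (c * ε) < K := by linarith
    rw [div_lt_iff₀ (by positivity)] at h2
    refine lt_of_lt_of_le ?_ (le_mul_of_one_le_right (by positivity) h1)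
    rw [inv_lt_iff_one_lt_mul₀ hε]
    calc (1 : ℝ) < K * (c * ε) / 8 := by linarith
      _ = _ := by field_simp

/-- For `α < 1` the two blocks have length `m ≈ N^θ` with `θ < 1`, in the window
`2(α + σ) < θ < α / (1/2 - σ)`, where `σ = max (s, -1/2)`. The window is nonempty as
`σ < min (0, 1/2 - α)`; its lower end makes the data small and its upper end the output large. -/
lemma normInflation_of_lt_one {α s κ ε : ℝ} (hα : 0 < α) (hα1 : α < 1) (hκ : |κ| = 1) (hε : 0 < ε)
    (hs0 : s < 0) (hs : s < 1 / 2 - α) : NormInflation α s κ ε := by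
  obtain ⟨c, hc0, hc1, h⟩ := exists_normInflation_of_parameters
  set B : ℝ := (4 * Real.pi * α) ^ (2 * α) with hB
  have hB0 : 0 < B := by positivity
  obtain ⟨σ, hσ0, hsσ, hσα, hσ⟩ : ∃ σ < 0, s ≤ σ ∧ σ < 1 / 2 - α ∧
      (σ = -(1 / 2) ∨ -(1 / 2) ≤ σ ∧ σ = s) := by
    rcases le_total s (-(1 / 2)) with h1 | h1
    · exact ⟨-(1 / 2), by norm_num, h1, by linarith, Or.inl rfl⟩
    · exact ⟨s, hs0, le_rfl, hs, Or.inr ⟨h1, rfl⟩⟩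
  have hσ' : 0 < 1 / 2 - σ := by linarith
  obtain ⟨θ, hθ1, hθ2⟩ : ∃ θ, max 0 (2 * (α + σ)) < θ ∧ θ < α / (1 / 2 - σ) := by
    refine exists_between (max_lt (by positivity) ?_)
    rw [lt_div_iff₀ hσ']
    nlinarith [mul_pos_of_neg_of_neg hσ0 (by linarith : -(1 - 2 * α - 2 * σ) < 0)]
  have hθ0 : 0 < θ := (le_max_left _ _).trans_lt hθ1
  have hθα : 2 * (α + σ) < θ := (le_max_right _ _).trans_lt hθ1
  rw [lt_div_iff₀ hσ'] at hθ2
  have hθ1' : θ < 1 := by nlinarith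
  set τ : ℝ := c / (1 + B) with hτ
  have hτ0 : 0 < τ := by positivity
  have hev1 : ∀ᶠ N : ℕ in atTop, (N : ℝ) ^ (θ - 1) < 1 / 2 :=
    (tendsto_natCast_rpow_neg (by linarith)).eventually_lt_const (by positivity)
  have hev2 : ∀ᶠ N : ℕ in atTop, (N : ℝ) ^ (-(2 * α)) < ε / τ :=
    (tendsto_natCast_rpow_neg (by linarith)).eventually_lt_const (by positivity)
  have hev3 : ∀ᶠ N : ℕ in atTop, (N : ℝ) ^ (α + σ - θ / 2) < ε / 4 :=
    (tendsto_natCast_rpow_neg (by linarith)).eventually_lt_const (by positivity)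
  have hev4 : ∀ᶠ N : ℕ in atTop, 16 / (τ * ε) < (N : ℝ) ^ (α - θ * (1 / 2 - σ)) :=
    (tendsto_natCast_rpow (by linarith)).eventually_gt_atTop _
  obtain ⟨N, h1, h2, h3, h4, hN⟩ :=
    (hev1.and (hev2.and (hev3.and (hev4.and (eventually_gt_atTop 0))))).exists
  have hN1 : (1 : ℝ) ≤ N := by exact_mod_cast hN
  have hN0 : (0 : ℝ) < N := by linarith
  set m : ℕ := ⌊(N : ℝ) ^ θ⌋₊ with hmdef
  have hNθ : 1 ≤ (N : ℝ) ^ θ := Real.one_le_rpow hN1 hθ0.le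
  have hm : 0 < m := Nat.floor_pos.2 hNθ
  have hmR : (1 : ℝ) ≤ m := by exact_mod_cast hm
  have hm0 : (0 : ℝ) < m := by linarith
  have hmle : (m : ℝ) ≤ (N : ℝ) ^ θ := Nat.floor_le (by positivity)
  have hlem : (N : ℝ) ^ θ ≤ 4 * m := by
    have := Nat.lt_floor_add_one ((N : ℝ) ^ θ)
    rw [← hmdef] at this
    linarith
  have hA2 : ((N : ℝ) ^ α) ^ 2 = (N : ℝ) ^ (2 * α) := by
    rw [mul_comm 2 α, Real.rpow_mul hN0.le, ← Real.rpow_natCast _ 2]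
    norm_num
  have hNα : 0 < (N : ℝ) ^ (2 * α) := by positivity
  refine h (A := (N : ℝ) ^ α) (τ := τ) (m := m) (N := N) hα hκ hs0.le (by positivity) hτ0 hm ?_
    (div_le_self hc0.le (by linarith)) ?_ ?_ ?_ ?_
  · rw [Real.rpow_sub hN0, Real.rpow_one, div_lt_iff₀ hN0] at h1
    have : (2 * m : ℝ) ≤ N := by linarith
    exact_mod_cast this
  · rw [hA2, Real.mul_rpow (by positivity) hN0.le, mul_div_cancel_right₀ _ hNα.ne', ← hB, hτ,
      div_mul_eq_mul_div, div_le_iff₀ (by positivity)]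
    nlinarith
  · rw [Real.rpow_neg hN0.le, lt_div_iff₀ hτ0, inv_mul_lt_iff₀ hNα] at h2
    rw [hA2, div_lt_iff₀ hNα]
    linarith
  · have e1 : (N : ℝ) ^ s ≤ (N : ℝ) ^ σ := Real.rpow_le_rpow_of_exponent_le hN1 hsσ
    have e2 : (N : ℝ) ^ (θ / 2) ≤ 2 * √m := by
      have : (N : ℝ) ^ (θ / 2) = √((N : ℝ) ^ θ) := by
        rw [Real.sqrt_eq_rpow, ← Real.rpow_mul hN0.le]
        congr 1
        ring
      rw [this]
      refine Real.sqrt_le_iff.2 ⟨by positivity, ?_⟩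
      rw [mul_pow, Real.sq_sqrt hm0.le]
      linarith
    have e3 : 0 < (N : ℝ) ^ (θ / 2) := by positivity
    have e4 : 0 < √m := Real.sqrt_pos.2 hm0
    calc 2 * ((N : ℝ) ^ α * (N : ℝ) ^ s / √m)
        ≤ 2 * ((N : ℝ) ^ α * (N : ℝ) ^ σ / ((N : ℝ) ^ (θ / 2) / 2)) := by
          gcongr
          linarith
      _ = 4 * (N : ℝ) ^ (α + σ - θ / 2) := by
          rw [Real.rpow_sub hN0, Real.rpow_add hN0]
          field_simp
          norm_num
      _ < ε := by linarith
  · have e1 := rpow_div_two_le_sum_rpow (s := s) hσ0.le hσ hm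
    have e2 : (m : ℝ) ^ (1 / 2 + σ) / 2 ≤
        √(∑ n ∈ Finset.Icc (0 : ℤ) m, (1 + (n : ℝ) ^ 2) ^ s) := by
      refine Real.le_sqrt_of_sq_le (le_trans ?_ e1)
      have : ((m : ℝ) ^ (1 / 2 + σ)) ^ 2 = (m : ℝ) ^ (1 + 2 * σ) := by
        rw [← Real.rpow_natCast, ← Real.rpow_mul hm0.le]
        congr 1
        push_cast
        ring
      rw [div_pow, this]
      have : 0 < (m : ℝ) ^ (1 + 2 * σ) := by positivity
      linarith
    have e3 : (N : ℝ) ^ (-(θ * (1 / 2 - σ))) ≤ (m : ℝ) ^ (1 / 2 + σ) / m := by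
      calc (N : ℝ) ^ (-(θ * (1 / 2 - σ))) = ((N : ℝ) ^ θ) ^ (σ - 1 / 2) := by
            rw [← Real.rpow_mul hN0.le]
            congr 1
            ring
        _ ≤ (m : ℝ) ^ (σ - 1 / 2) := Real.rpow_le_rpow_of_nonpos hm0 hmle (by linarith)
        _ = (m : ℝ) ^ (1 / 2 + σ) / m := by
            rw [← Real.rpow_sub_one hm0.ne']
            congr 1
            ring
    have e4 : (N : ℝ) ^ (α - θ * (1 / 2 - σ)) ≤ (N : ℝ) ^ α * ((m : ℝ) ^ (1 / 2 + σ) / m) := by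
      rw [sub_eq_add_neg, Real.rpow_add hN0]
      gcongr
    have e5 := h4.trans_le e4
    rw [div_lt_iff₀ (by positivity)] at e5
    rw [inv_lt_iff_one_lt_mul₀ hε]
    calc (1 : ℝ) < (N : ℝ) ^ α * ((m : ℝ) ^ (1 / 2 + σ) / m) * (τ * ε) / 16 := by linarith
      _ = (N : ℝ) ^ α * τ / (8 * m) * ((m : ℝ) ^ (1 / 2 + σ) / 2) * ε := by ring
      _ ≤ _ := by gcongr

/-- Norm inflation in negative Sobolev spaces. -/
lemma normInflation_of_neg {α s κ ε : ℝ} (hα : 0 < α) (hκ : |κ| = 1) (hε : 0 < ε) (hs0 : s < 0)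
    (hs : (1 / 2 - α ≤ -(1 / 2) ∧ s ≤ 1 / 2 - α) ∨ (-(1 / 2) < 1 / 2 - α ∧ s < 1 / 2 - α)) :
    NormInflation α s κ ε := by
  rcases hs with ⟨h1, h2⟩ | ⟨h1, h2⟩
  · have hα1 : 1 ≤ α := by linarith
    rcases hα1.eq_or_lt with rfl | hα1
    · rcases (show s ≤ -(1 / 2) by linarith).eq_or_lt with rfl | h3
      · refine normInflation_of_tendsto le_rfl hκ hε h2 ?_
        simp only [sub_self, Real.rpow_zero, one_mul]
        exact Real.tendsto_sqrt_atTop.comp tendsto_sum_rpow_neg_half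
      · exact normInflation_of_one_of_lt hκ hε h3
    · refine normInflation_of_tendsto hα1.le hκ hε h2 ?_
      refine tendsto_atTop_mono (fun m => ?_) (tendsto_natCast_rpow (sub_pos.2 hα1))
      exact le_mul_of_one_le_right (by positivity) (Real.one_le_sqrt.2 (one_le_sum_rpow s m))
  · exact normInflation_of_lt_one hα (by linarith) hκ hε hs0 h2

end WienerSpace

/-! ### Derivatives of self-modulated functions -/

/-- The first two derivatives of `e^{ic|d|²} d`, for a function `d` of modulus at most `1`, with
upper bounds and, for the first one, a lower bound that is linear in `c`. -/
lemma exists_deriv_phase {d d₁ d₂ : ℝ → ℂ} (h1 : ∀ x, HasDerivAt d (d₁ x) x)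
    (h2 : ∀ x, HasDerivAt d₁ (d₂ x) x) {c K L : ℝ} (hcK : |c| = K) (hK : 1 ≤ K)
    (hd : ∀ x, ‖d x‖ ≤ 1) (hd1 : ∀ x, ‖d₁ x‖ ≤ L) :
    ∃ f₁ f₂ : ℝ → ℂ,
      (∀ x, HasDerivAt (fun x => cexp ((c * ‖d x‖ ^ 2 : ℝ) * I) * d x) (f₁ x) x) ∧
      (∀ x, HasDerivAt f₁ (f₂ x) x) ∧
      (∀ x, ‖f₁ x‖ ≤ 3 * K * ‖d₁ x‖) ∧
      (∀ x, ‖f₂ x‖ ≤ 10 * K ^ 2 * L * ‖d₁ x‖ + 3 * K ^ 2 * ‖d₂ x‖) ∧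
      (∀ x, K * (|2 * inner ℝ (d x) (d₁ x)| * ‖d x‖) ≤ ‖f₁ x‖ + ‖d₁ x‖) := by
  set p : ℝ → ℝ := fun x => 2 * inner ℝ (d x) (d₁ x) with hp
  set q : ℝ → ℝ := fun x => 2 * (inner ℝ (d x) (d₂ x) + inner ℝ (d₁ x) (d₁ x)) with hq
  set e : ℝ → ℂ := fun x => cexp ((c * ‖d x‖ ^ 2 : ℝ) * I) with he
  have hp' : ∀ x, HasDerivAt (fun x => ‖d x‖ ^ 2) (p x) x := fun x => (h1 x).norm_sq
  have hq' : ∀ x, HasDerivAt p (q x) x := fun x => ((h1 x).inner ℝ (h2 x)).const_mul 2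
  have he' : ∀ x, HasDerivAt e (e x * ((c * p x : ℝ) * I)) x := fun x =>
    ((((hp' x).const_mul c).ofReal_comp).mul_const I).cexp
  have hen : ∀ x, ‖e x‖ = 1 := fun x => norm_exp_ofReal_mul_I _
  have hpn : ∀ x, |p x| ≤ 2 * ‖d₁ x‖ := fun x => by
    rw [hp, abs_mul, abs_two]
    gcongr
    refine (abs_real_inner_le_norm _ _).trans ?_
    exact mul_le_of_le_one_left (norm_nonneg _) (hd x)
  have hqn : ∀ x, |q x| ≤ 2 * (‖d₂ x‖ + ‖d₁ x‖ ^ 2) := fun x => by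
    rw [hq, abs_mul, abs_two]
    gcongr
    refine (abs_add_le _ _).trans (add_le_add ?_ ?_)
    · refine (abs_real_inner_le_norm _ _).trans ?_
      exact mul_le_of_le_one_left (norm_nonneg _) (hd x)
    · rw [sq]
      exact abs_real_inner_le_norm _ _
  have hcp : ∀ x, ‖((c * p x : ℝ) * I : ℂ)‖ = K * |p x| := fun x => by
    rw [norm_mul, norm_I, mul_one, norm_real, Real.norm_eq_abs, abs_mul, hcK]
  have hcq : ∀ x, ‖((c * q x : ℝ) * I : ℂ)‖ = K * |q x| := fun x => by
    rw [norm_mul, norm_I, mul_one, norm_real, Real.norm_eq_abs, abs_mul, hcK]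
  have hK2 : K ≤ K ^ 2 := by nlinarith
  refine ⟨fun x => e x * (d₁ x + (c * p x : ℝ) * I * d x),
    fun x => e x * ((c * p x : ℝ) * I) * (d₁ x + (c * p x : ℝ) * I * d x) +
      e x * (d₂ x + ((c * q x : ℝ) * I * d x + (c * p x : ℝ) * I * d₁ x)),
    fun x => ?_, fun x => ?_, fun x => ?_, fun x => ?_, fun x => ?_⟩
  · refine ((he' x).mul (h1 x)).congr_deriv ?_
    ring
  · refine (he' x).mul ((h2 x).add (HasDerivAt.mul ?_ (h1 x)))
    exact (((hq' x).const_mul c).ofReal_comp).mul_const I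
  · have h3 := hpn x
    have h4 := hd x
    rw [norm_mul, hen, one_mul]
    refine (norm_add_le _ _).trans ?_
    rw [norm_mul, hcp]
    calc _ ≤ ‖d₁ x‖ + K * (2 * ‖d₁ x‖) * 1 := by gcongr
      _ ≤ _ := by nlinarith [norm_nonneg (d₁ x)]
  · have h3 := hpn x
    have h4 := hd x
    have h5 := hqn x
    have h6 := hd1 x
    have h7 := norm_nonneg (d₁ x)
    have h8 := norm_nonneg (d₂ x)
    have e1 : ‖e x * ((c * p x : ℝ) * I) * (d₁ x + (c * p x : ℝ) * I * d x)‖ ≤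
        K * (2 * ‖d₁ x‖) * (‖d₁ x‖ + K * (2 * ‖d₁ x‖) * 1) := by
      rw [norm_mul, norm_mul, hen, one_mul, hcp]
      gcongr
      refine (norm_add_le _ _).trans ?_
      rw [norm_mul, hcp]
      gcongr
    have e2 : ‖e x * (d₂ x + ((c * q x : ℝ) * I * d x + (c * p x : ℝ) * I * d₁ x))‖ ≤
        ‖d₂ x‖ + (K * (2 * (‖d₂ x‖ + ‖d₁ x‖ ^ 2)) * 1 + K * (2 * ‖d₁ x‖) * ‖d₁ x‖) := by
      rw [norm_mul, hen, one_mul]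
      refine (norm_add_le _ _).trans (add_le_add le_rfl ((norm_add_le _ _).trans ?_))
      rw [norm_mul _ (d x), norm_mul _ (d₁ x), hcp, hcq]
      gcongr
    refine (norm_add_le _ _).trans ((add_le_add e1 e2).trans ?_)
    have e3 : ‖d₁ x‖ ^ 2 ≤ L * ‖d₁ x‖ := by rw [sq]; gcongr
    calc _ = (6 * K + 4 * K ^ 2) * ‖d₁ x‖ ^ 2 + (1 + 2 * K) * ‖d₂ x‖ := by ring
      _ ≤ 10 * K ^ 2 * ‖d₁ x‖ ^ 2 + 3 * K ^ 2 * ‖d₂ x‖ := by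
        gcongr
        · linarith
        · linarith
      _ ≤ 10 * K ^ 2 * (L * ‖d₁ x‖) + 3 * K ^ 2 * ‖d₂ x‖ := by gcongr
      _ = _ := by ring
  · rw [norm_mul, hen, one_mul]
    have := norm_sub_le (d₁ x + (c * p x : ℝ) * I * d x) (d₁ x)
    rw [add_sub_cancel_left, norm_mul, hcp, mul_assoc] at this
    exact this

/-- A function of modulus at most `1` that drops from modulus `1` to `0` on an interval of length
`h` has a phase-generating density `(|d|²)' |d|` of `L²` size at least `h^{-1/2} / 2`. -/
lemma le_integral_of_drop {d d₁ : ℝ → ℂ} (h1 : ∀ x, HasDerivAt d (d₁ x) x) (hc : Continuous d₁)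
    (hd : ∀ x, ‖d x‖ ≤ 1) {h : ℝ} (hh0 : 0 < h) (hh1 : h ≤ 1) (hd0 : ‖d 0‖ = 1) (hdh : d h = 0) :
    1 / (4 * h) ≤ ∫ x in (0 : ℝ)..1, (|2 * inner ℝ (d x) (d₁ x)| * ‖d x‖) ^ 2 := by
  have hdc : Continuous d := continuous_iff_continuousAt.2 fun x => (h1 x).continuousAt
  set p : ℝ → ℝ := fun x => 2 * inner ℝ (d x) (d₁ x) with hp
  have hpc : Continuous p := by fun_prop
  have hder : ∀ x, HasDerivAt (fun x => (‖d x‖ ^ 2) ^ 2 / 2) (‖d x‖ ^ 2 * p x) x := fun x => by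
    refine ((((h1 x).norm_sq).pow 2).div_const 2).congr_deriv ?_
    simp only [hp]
    push_cast
    ring
  have hFTC : ∫ x in (0 : ℝ)..h, ‖d x‖ ^ 2 * p x = -(1 / 2) := by
    rw [intervalIntegral.integral_eq_sub_of_hasDerivAt (fun x _ => hder x)
      (Continuous.intervalIntegrable (by fun_prop) _ _), hd0, hdh]
    norm_num
  have hcont : Continuous fun x => (|p x| * ‖d x‖) ^ 2 := by fun_prop
  -- The Cauchy-Schwarz inequality on `[0, h]` for `∫ (|d|⁴ / 2)' = -1/2`, in the form
  -- `X² ≥ -X / h - 1 / (4 h²)`.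
  calc 1 / (4 * h) = ∫ x in (0 : ℝ)..h, ((-1 / h) * (‖d x‖ ^ 2 * p x) - (1 / (2 * h)) ^ 2) := by
        rw [intervalIntegral.integral_sub (Continuous.intervalIntegrable (by fun_prop) _ _)
          (Continuous.intervalIntegrable (by fun_prop) _ _), intervalIntegral.integral_const_mul,
          hFTC, intervalIntegral.integral_const]
        simp only [smul_eq_mul]
        field_simp
        ring
    _ ≤ ∫ x in (0 : ℝ)..h, (|p x| * ‖d x‖) ^ 2 := by
        refine intervalIntegral.integral_mono hh0.le
          (Continuous.intervalIntegrable (by fun_prop) _ _) (hcont.intervalIntegrable _ _)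
          fun x => ?_
        have e1 : (‖d x‖ ^ 2 * p x) ^ 2 ≤ (|p x| * ‖d x‖) ^ 2 := by
          rw [mul_pow _ (p x), mul_pow |p x|, sq_abs, mul_comm]
          have := hd x
          gcongr
          exact pow_le_of_le_one (norm_nonneg _) this two_ne_zero
        refine le_trans ?_ e1
        have e2 := sq_nonneg (‖d x‖ ^ 2 * p x + 1 / (2 * h))
        have e3 : -1 / h = -(2 * (1 / (2 * h))) := by field_simp
        simp only [e3]
        linarith
    _ ≤ _ := by
        refine intervalIntegral.integral_mono_interval le_rfl hh0.le hh1
          (Eventually.of_forall fun x => sq_nonneg _) (hcont.intervalIntegrable _ _)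

/-- Parseval's identity for continuous functions. -/
lemma hasSum_sq_fourierCoeff_of_continuous {F : UnitAddCircle → ℂ} (hF : Continuous F) :
    HasSum (fun n => ‖fourierCoeff F n‖ ^ 2) (∫ x in (0 : ℝ)..1, ‖F (x : UnitAddCircle)‖ ^ 2) := by
  have h := hasSum_sq_fourierCoeff
    (ContinuousMap.toLp 2 AddCircle.haarAddCircle ℂ (⟨F, hF⟩ : C(UnitAddCircle, ℂ)))
  simp only [fourierCoeff_toLp, ContinuousMap.coe_mk] at h
  convert h using 1
  rw [MeasureTheory.integral_congr_ae (g := fun t => ‖F t‖ ^ 2), AddCircle.integral_haarAddCircle,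
    ← AddCircle.intervalIntegral_preimage 1 0]
  · simp
  · filter_upwards [ContinuousMap.coeFn_toLp (p := 2) (𝕜 := ℂ) AddCircle.haarAddCircle
      (⟨F, hF⟩ : C(UnitAddCircle, ℂ))] with t ht
    rw [ht]
    rfl

lemma continuous_fourierSeries {a : ℤ → ℂ} (ha : Summable fun n => ‖a n‖) :
    Continuous fun x : UnitAddCircle => ∑' n : ℤ, a n * fourier n x :=
  continuous_tsum (fun n => continuous_const.mul (fourier n).continuous) ha fun n x => by
    rw [norm_mul, norm_fourier_apply, mul_one]

lemma hasSum_sq_of_fourierSeries {a : ℤ → ℂ} (ha : Summable fun n => ‖a n‖) :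
    HasSum (fun n => ‖a n‖ ^ 2)
      (∫ x in (0 : ℝ)..1, ‖∑' n : ℤ, a n * fourier n (x : UnitAddCircle)‖ ^ 2) := by
  have := hasSum_sq_fourierCoeff_of_continuous (continuous_fourierSeries ha)
  simpa only [WienerSpace.fourierCoeff_tsum ha] using this

namespace WienerSpace

/-! ### Positive regularity: transfer of energy to high frequencies -/

section Bump

variable (M : ℕ) (ρ : ℝ≥0)

/-- The normalized Dirichlet kernel `M⁻¹ ∑_{0 ≤ n < M} e^{2πinx}`: a bump of height `1` and width
`1 / M`. -/
noncomputable def bump : WienerSpace ρ M := indicatorData (Finset.Ico (0 : ℤ) M) M ρ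

variable {M ρ}

lemma iterate_derivCoef_bump_of_notMem (k : ℕ) {n : ℤ} (hn : n ∉ Finset.Ico (0 : ℤ) M) :
    ‖derivCoef^[k] (coef (bump M ρ)) n‖ = 0 := by
  rw [norm_iterate_derivCoef, bump, coef_indicatorData, if_neg hn, norm_zero, mul_zero]

lemma norm_iterate_derivCoef_bump_le (k : ℕ) {n : ℤ} (hn : n ∈ Finset.Ico (0 : ℤ) M) :
    ‖derivCoef^[k] (coef (bump M ρ)) n‖ ≤ (2 * Real.pi * M) ^ k * (M : ℝ)⁻¹ := by
  rw [norm_iterate_derivCoef, bump, coef_indicatorData, if_pos hn, norm_inv]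
  simp only [NNReal.coe_natCast, norm_natCast, ofReal_natCast]
  rw [Finset.mem_Ico] at hn
  have h0 : (0 : ℝ) ≤ n := by exact_mod_cast hn.1
  have h1 : (n : ℝ) ≤ M := by exact_mod_cast hn.2.le
  have hπ := Real.pi_pos
  rw [abs_of_nonneg (by positivity)]
  gcongr

lemma tsum_norm_iterate_derivCoef_bump_le (hM : 0 < M) (k : ℕ) :
    ∑' n, ‖derivCoef^[k] (coef (bump M ρ)) n‖ ≤ (2 * Real.pi * M) ^ k := by
  have hMR : (0 : ℝ) < M := by exact_mod_cast hM
  rw [tsum_eq_sum (s := Finset.Ico (0 : ℤ) M) fun n hn => iterate_derivCoef_bump_of_notMem k hn]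
  refine (Finset.sum_le_sum fun n hn => norm_iterate_derivCoef_bump_le k hn).trans (le_of_eq ?_)
  rw [Finset.sum_const, Int.card_Ico, nsmul_eq_mul, sub_zero, Int.toNat_natCast]
  field_simp

lemma tsum_sq_iterate_derivCoef_bump_le (hM : 0 < M) (k : ℕ) :
    ∑' n, ‖derivCoef^[k] (coef (bump M ρ)) n‖ ^ 2 ≤ ((2 * Real.pi * M) ^ k) ^ 2 / M := by
  have hMR : (0 : ℝ) < M := by exact_mod_cast hM
  rw [tsum_eq_sum (s := Finset.Ico (0 : ℤ) M) fun n hn => by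
    rw [iterate_derivCoef_bump_of_notMem k hn, zero_pow two_ne_zero]]
  refine (Finset.sum_le_sum fun n hn => pow_le_pow_left₀ (norm_nonneg _)
    (norm_iterate_derivCoef_bump_le k hn) 2).trans (le_of_eq ?_)
  rw [Finset.sum_const, Int.card_Ico, nsmul_eq_mul, sub_zero, Int.toNat_natCast]
  field_simp

lemma eval_bump (x : UnitAddCircle) :
    eval (bump M ρ) x = (M : ℂ)⁻¹ * ∑ k ∈ Finset.range M, (fourier (k : ℤ) x : ℂ) := by
  rw [eval, tsum_eq_sum (s := Finset.Ico (0 : ℤ) M) fun n hn => by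
    rw [bump, coef_indicatorData, if_neg hn, zero_mul], Finset.mul_sum]
  have : Finset.Ico (0 : ℤ) M = (Finset.range M).image fun i : ℕ => (i : ℤ) := by
    ext n
    simp only [Finset.mem_Ico, Finset.mem_image, Finset.mem_range]
    exact ⟨fun h => ⟨n.toNat, by omega, by omega⟩, by rintro ⟨i, hi, rfl⟩; omega⟩
  rw [this, Finset.sum_image fun a _ b _ h => by exact_mod_cast h]
  refine Finset.sum_congr rfl fun k hk => ?_
  rw [bump, coef_indicatorData, if_pos]
  · simp
  · rw [Finset.mem_range] at hk
    rw [Finset.mem_Ico]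
    omega

lemma eval_bump_zero (hM : 0 < M) : eval (bump M ρ) ((0 : ℝ) : UnitAddCircle) = 1 := by
  have : (M : ℂ) ≠ 0 := by exact_mod_cast hM.ne'
  rw [eval_bump]
  simp [this]

lemma eval_bump_inv (hM : 1 < M) :
    eval (bump M ρ) (((M : ℝ)⁻¹ : ℝ) : UnitAddCircle) = 0 := by
  have h : ∀ k : ℕ, (fourier (k : ℤ) (((M : ℝ)⁻¹ : ℝ) : UnitAddCircle) : ℂ) =
      cexp (2 * Real.pi * I / M) ^ k := fun k => by
    rw [fourier_coe_apply, ← Complex.exp_nat_mul]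
    congr 1
    push_cast
    ring
  rw [eval_bump, Finset.sum_congr rfl fun k _ => h k,
    (Complex.isPrimitiveRoot_exp M (by omega)).geom_sum_eq_zero hM, mul_zero]

end Bump

/-- Second and fourth moments of the Fourier coefficients of the bump after multiplication by a
large nonlinear phase. Their sizes `K²M` and `K⁴M³` are those of a sequence with `ℓ²` mass `1 / M`
at frequencies of order `KM`. -/
lemma moments_of_phase_bump {M : ℕ} (hM : 1 < M) {ρ : ℝ≥0} (hρ : 0 < ρ) {f : WienerSpace ρ M}
    {c K : ℝ} (hcK : |c| = K) (hK : 26 ≤ K)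
    (hf : ∀ x, eval f x = cexp ((c * ‖eval (bump M ρ) x‖ ^ 2 : ℝ) * I) * eval (bump M ρ) x) :
    Summable (fun n => ‖derivCoef (coef f) n‖ ^ 2) ∧
    Summable (fun n => ‖derivCoef (derivCoef (coef f)) n‖ ^ 2) ∧
    K ^ 2 * M / 16 ≤ ∑' n, ‖derivCoef (coef f) n‖ ^ 2 ∧
    ∑' n, ‖derivCoef (coef f) n‖ ^ 2 ≤ 9 * K ^ 2 * ((2 * Real.pi * M) ^ 2 / M) ∧
    ∑' n, ‖derivCoef (derivCoef (coef f)) n‖ ^ 2 ≤ 256 * K ^ 4 * ((2 * Real.pi * M) ^ 4 / M) := by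
  have hMR : (1 : ℝ) < M := by exact_mod_cast hM
  have hM0 : (0 : ℝ) < M := by linarith
  set L : ℝ := 2 * Real.pi * M with hL
  have hL0 : 0 < L := by positivity
  set a := coef (bump M ρ) with ha
  have hs : ∀ (g : WienerSpace ρ M) (k : ℕ), Summable fun n => ‖derivCoef^[k] (coef g) n‖ :=
    summable_iterate_derivCoef hρ
  set d : ℝ → ℂ := fun x => eval (bump M ρ) (x : UnitAddCircle) with hd
  set d₁ : ℝ → ℂ := fun x => ∑' n : ℤ, derivCoef a n * fourier n (x : UnitAddCircle) with hd₁
  set d₂ : ℝ → ℂ := fun x =>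
    ∑' n : ℤ, derivCoef (derivCoef a) n * fourier n (x : UnitAddCircle) with hd₂
  have h1 : ∀ x, HasDerivAt d (d₁ x) x := hasDerivAt_fourierSeries (hs _ 0) (hs _ 1)
  have h2 : ∀ x, HasDerivAt d₁ (d₂ x) x := hasDerivAt_fourierSeries (hs _ 1) (hs _ 2)
  have hbound : ∀ (b : ℤ → ℂ), Summable (fun n => ‖b n‖) → ∀ x : UnitAddCircle,
      ‖∑' n : ℤ, b n * fourier n x‖ ≤ ∑' n, ‖b n‖ := fun b hb x => by
    have h : (fun n : ℤ => ‖b n * fourier n x‖) = fun n => ‖b n‖ :=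
      funext fun n => by rw [norm_mul, norm_fourier_apply, mul_one]
    refine (norm_tsum_le_tsum_norm (by rwa [h])).trans (le_of_eq (by rw [h]))
  have hd1 : ∀ x, ‖d x‖ ≤ 1 := fun x => (hbound _ (hs _ 0) _).trans (by
    simpa using tsum_norm_iterate_derivCoef_bump_le (ρ := ρ) (by omega : 0 < M) 0)
  have hd1L : ∀ x, ‖d₁ x‖ ≤ L := fun x => (hbound _ (hs _ 1) _).trans (by
    simpa using tsum_norm_iterate_derivCoef_bump_le (ρ := ρ) (by omega : 0 < M) 1)
  obtain ⟨f₁, f₂, hf1, hf2, hf1n, hf2n, hlow⟩ :=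
    exists_deriv_phase h1 h2 hcK (by linarith) hd1 hd1L
  -- The derivatives of `f` are given by the differentiated Fourier series.
  have hF1 : f₁ = fun x : ℝ => ∑' n : ℤ, derivCoef (coef f) n * fourier n (x : UnitAddCircle) := by
    funext x
    refine (hf1 x).unique ?_
    have h : (fun x : ℝ => cexp ((c * ‖d x‖ ^ 2 : ℝ) * I) * d x) =
        fun x : ℝ => eval f (x : UnitAddCircle) := funext fun y => (hf y).symm
    rw [h]
    exact hasDerivAt_fourierSeries (hs f 0) (hs f 1) x
  have hF2 : f₂ = fun x : ℝ =>
      ∑' n : ℤ, derivCoef (derivCoef (coef f)) n * fourier n (x : UnitAddCircle) := by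
    funext x
    refine (hf2 x).unique ?_
    rw [hF1]
    exact hasDerivAt_fourierSeries (hs f 1) (hs f 2) x
  have hcont : ∀ b : ℤ → ℂ, Summable (fun n => ‖b n‖) →
      Continuous fun x : ℝ => ∑' n : ℤ, b n * fourier n (x : UnitAddCircle) := fun b hb =>
    (continuous_fourierSeries hb).comp (AddCircle.continuous_mk' 1)
  have hd1c : Continuous d₁ := hcont _ (hs _ 1)
  have hd2c : Continuous d₂ := hcont _ (hs _ 2)
  have hf1c : Continuous f₁ := by rw [hF1]; exact hcont _ (hs f 1)
  have hf2c : Continuous f₂ := by rw [hF2]; exact hcont _ (hs f 2)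
  have hdc : Continuous d := continuous_iff_continuousAt.2 fun x => (h1 x).continuousAt
  have S1 : HasSum (fun n => ‖derivCoef (coef f) n‖ ^ 2) (∫ x in (0 : ℝ)..1, ‖f₁ x‖ ^ 2) := by
    rw [hF1]; exact hasSum_sq_of_fourierSeries (hs f 1)
  have S2 : HasSum (fun n => ‖derivCoef (derivCoef (coef f)) n‖ ^ 2)
      (∫ x in (0 : ℝ)..1, ‖f₂ x‖ ^ 2) := by
    rw [hF2]; exact hasSum_sq_of_fourierSeries (hs f 2)
  have I1 : ∫ x in (0 : ℝ)..1, ‖d₁ x‖ ^ 2 ≤ L ^ 2 / M := by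
    refine le_of_eq_of_le (hasSum_sq_of_fourierSeries (hs (bump M ρ) 1)).tsum_eq.symm ?_
    simpa using tsum_sq_iterate_derivCoef_bump_le (ρ := ρ) (by omega : 0 < M) 1
  have I2 : ∫ x in (0 : ℝ)..1, ‖d₂ x‖ ^ 2 ≤ L ^ 4 / M := by
    refine le_of_eq_of_le (hasSum_sq_of_fourierSeries (hs (bump M ρ) 2)).tsum_eq.symm ?_
    refine (tsum_sq_iterate_derivCoef_bump_le (ρ := ρ) (by omega : 0 < M) 2).trans (le_of_eq ?_)
    rw [← pow_mul]
  have hint : ∀ g : ℝ → ℝ, Continuous g → IntervalIntegrable g MeasureTheory.volume 0 1 :=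
    fun g hg => hg.intervalIntegrable _ _
  refine ⟨S1.summable, S2.summable, ?_, ?_, ?_⟩
  · rw [S1.tsum_eq]
    have hdrop := le_integral_of_drop h1 hd1c hd1 (h := (M : ℝ)⁻¹) (by positivity)
      (inv_le_one_of_one_le₀ hMR.le)
      (by rw [hd]; simp only; rw [eval_bump_zero (by omega), norm_one]) (eval_bump_inv hM)
    have hmono : ∫ x in (0 : ℝ)..1, (K ^ 2 / 2 * (|2 * inner ℝ (d x) (d₁ x)| * ‖d x‖) ^ 2 -
        ‖d₁ x‖ ^ 2) ≤ ∫ x in (0 : ℝ)..1, ‖f₁ x‖ ^ 2 := by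
      refine intervalIntegral.integral_mono zero_le_one (hint _ (by fun_prop))
        (hint _ (by fun_prop)) fun x => ?_
      have h3 := hlow x
      have h4 : 0 ≤ K * (|2 * inner ℝ (d x) (d₁ x)| * ‖d x‖) := by positivity
      have h5 := pow_le_pow_left₀ h4 h3 2
      have h6 := sq_nonneg (‖f₁ x‖ - ‖d₁ x‖)
      simp only
      rw [mul_pow] at h5
      linarith
    rw [intervalIntegral.integral_sub (hint _ (by fun_prop)) (hint _ (by fun_prop)),
      intervalIntegral.integral_const_mul] at hmono
    have h7 : L ^ 2 / M = 4 * Real.pi ^ 2 * M := by rw [hL]; field_simp; norm_num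
    have h8 : 1 / (4 * (M : ℝ)⁻¹) = M / 4 := by field_simp
    rw [h8] at hdrop
    have h9 := mul_le_mul_of_nonneg_left hdrop (by positivity : 0 ≤ K ^ 2 / 2)
    -- This is where `K ≥ 26 > 8π` enters.
    have h10 : 4 * Real.pi ^ 2 ≤ K ^ 2 / 16 := by
      have := Real.pi_lt_d2
      have := Real.pi_pos
      nlinarith
    have h11 := mul_le_mul_of_nonneg_right h10 hM0.le
    linarith
  · rw [S1.tsum_eq]
    calc _ ≤ ∫ x in (0 : ℝ)..1, 9 * K ^ 2 * ‖d₁ x‖ ^ 2 := by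
          refine intervalIntegral.integral_mono zero_le_one (hint _ (by fun_prop))
            (hint _ (by fun_prop)) fun x => ?_
          refine (pow_le_pow_left₀ (norm_nonneg _) (hf1n x) 2).trans (le_of_eq ?_)
          ring
      _ ≤ _ := by
        rw [intervalIntegral.integral_const_mul]
        gcongr
  · rw [S2.tsum_eq]
    calc _ ≤ ∫ x in (0 : ℝ)..1, (200 * K ^ 4 * L ^ 2 * ‖d₁ x‖ ^ 2 +
          18 * K ^ 4 * ‖d₂ x‖ ^ 2) := by
          refine intervalIntegral.integral_mono zero_le_one (hint _ (by fun_prop))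
            (hint _ (by fun_prop)) fun x => ?_
          refine (pow_le_pow_left₀ (norm_nonneg _) (hf2n x) 2).trans ?_
          have := sq_nonneg (10 * K ^ 2 * L * ‖d₁ x‖ - 3 * K ^ 2 * ‖d₂ x‖)
          nlinarith
      _ = 200 * K ^ 4 * L ^ 2 * (∫ x in (0 : ℝ)..1, ‖d₁ x‖ ^ 2) +
          18 * K ^ 4 * ∫ x in (0 : ℝ)..1, ‖d₂ x‖ ^ 2 := by
        rw [intervalIntegral.integral_add (hint _ (by fun_prop)) (hint _ (by fun_prop)),
          intervalIntegral.integral_const_mul, intervalIntegral.integral_const_mul]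
      _ ≤ 200 * K ^ 4 * L ^ 2 * (L ^ 2 / M) + 18 * K ^ 4 * (L ^ 4 / M) := by gcongr
      _ = 218 * K ^ 4 * (L ^ 4 / M) := by ring
      _ ≤ _ := by gcongr; norm_num

/-- A lower bound for an `H^s` norm by duality. With `w = (1 + n²)^s` and `y = (2πn)²`, the
Cauchy-Schwarz inequality gives `(∑ y f c)² ≤ (∑ w c²) (∑ w⁻¹ y² f²)`; the left side is bounded
below by the second moment of `f`, as `c` is close to `f`, and the last sum is bounded by the second
and fourth moments of `f`, used for frequencies below and above `N` respectively. -/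
lemma le_tsum_rpow_of_moments {s : ℝ} (hs0 : 0 < s) (hs1 : s ≤ 1) {f c g : ℤ → ℝ}
    (hf0 : ∀ n, 0 ≤ f n) (hfc : ∀ n, f n ≤ c n + g n)
    {H₁ U₁ U₂ G R N : ℝ} (hN : 0 < N) (hH : 0 < H₁) (hU2 : 0 < U₂)
    (hf : Summable f) (hfR : ∑' n, f n ≤ R)
    (h1 : Summable fun n : ℤ => (2 * Real.pi * n) ^ 2 * f n ^ 2)
    (h1l : H₁ ≤ ∑' n : ℤ, (2 * Real.pi * n) ^ 2 * f n ^ 2)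
    (h1u : ∑' n : ℤ, (2 * Real.pi * n) ^ 2 * f n ^ 2 ≤ U₁)
    (h2 : Summable fun n : ℤ => (2 * Real.pi * n) ^ 4 * f n ^ 2)
    (h2u : ∑' n : ℤ, (2 * Real.pi * n) ^ 4 * f n ^ 2 ≤ U₂)
    (hc : Summable fun n : ℤ => (1 + (n : ℝ) ^ 2) ^ s * c n ^ 2)
    (hG0 : 0 ≤ G) (hg : ∀ n : ℤ, (2 * Real.pi * n) ^ 2 * g n ≤ G) (hGR : G * R ≤ H₁ / 2) :
    H₁ ^ 2 / (4 * (N ^ (-(2 * s)) * (U₂ + (2 * Real.pi * N) ^ 2 * U₁))) ≤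
      ∑' n : ℤ, (1 + (n : ℝ) ^ 2) ^ s * c n ^ 2 := by
  have hU1 : 0 < U₁ := hH.trans_le (h1l.trans h1u)
  set Q : ℝ := N ^ (-(2 * s)) * (U₂ + (2 * Real.pi * N) ^ 2 * U₁) with hQ
  have hQ0 : 0 < Q := by positivity
  have hdual : ∀ n : ℤ, ((1 + (n : ℝ) ^ 2) ^ s)⁻¹ * ((2 * Real.pi * n) ^ 4 * f n ^ 2) ≤
      N ^ (-(2 * s)) * ((2 * Real.pi * n) ^ 4 * f n ^ 2 +
        (2 * Real.pi * N) ^ 2 * ((2 * Real.pi * n) ^ 2 * f n ^ 2)) := by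
    intro n
    rcases eq_or_ne n 0 with rfl | hn
    · simp
    have hn0 : (0 : ℝ) < |(n : ℝ)| := by
      rw [abs_pos]; exact_mod_cast hn
    have hw : ((1 + (n : ℝ) ^ 2) ^ s)⁻¹ ≤ |(n : ℝ)| ^ (-(2 * s)) := by
      rw [Real.rpow_neg hn0.le]
      gcongr
      calc |(n : ℝ)| ^ (2 * s) = (|(n : ℝ)| ^ 2) ^ s := by
            rw [← Real.rpow_natCast, ← Real.rpow_mul hn0.le]; norm_num
        _ ≤ _ := by
          rw [sq_abs]
          gcongr
          linarith
    rw [mul_add]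
    rcases le_total N |(n : ℝ)| with h | h
    · have h3 : |(n : ℝ)| ^ (-(2 * s)) ≤ N ^ (-(2 * s)) :=
        Real.rpow_le_rpow_of_nonpos hN h (by linarith)
      refine le_trans ?_ (le_add_of_nonneg_right (by positivity))
      gcongr
      exact hw.trans h3
    · have h3 : |(n : ℝ)| ^ (-(2 * s)) * (n : ℝ) ^ 2 ≤ N ^ (-(2 * s)) * N ^ 2 := by
        rw [← sq_abs (n : ℝ), ← Real.rpow_natCast, ← Real.rpow_natCast, ← Real.rpow_add hn0,
          ← Real.rpow_add hN]
        refine Real.rpow_le_rpow hn0.le h ?_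
        push_cast
        linarith
      refine le_trans ?_ (le_add_of_nonneg_left (by positivity))
      calc _ ≤ |(n : ℝ)| ^ (-(2 * s)) * ((2 * Real.pi * n) ^ 4 * f n ^ 2) := by gcongr
        _ = |(n : ℝ)| ^ (-(2 * s)) * (n : ℝ) ^ 2 *
            ((2 * Real.pi) ^ 2 * ((2 * Real.pi * n) ^ 2 * f n ^ 2)) := by ring
        _ ≤ N ^ (-(2 * s)) * N ^ 2 *
            ((2 * Real.pi) ^ 2 * ((2 * Real.pi * n) ^ 2 * f n ^ 2)) := by gcongr
        _ = _ := by ring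
  set lam : ℝ := 2 * Q / H₁ with hlam
  have hlam0 : 0 < lam := by positivity
  -- The Cauchy-Schwarz inequality enters in its additive form, with parameter `lam`; the choice of
  -- `lam` balances the two terms.
  have hpt : ∀ n : ℤ, (2 * Real.pi * n) ^ 2 * f n ^ 2 ≤
      lam / 2 * ((1 + (n : ℝ) ^ 2) ^ s * c n ^ 2) +
      lam⁻¹ / 2 * (N ^ (-(2 * s)) * ((2 * Real.pi * n) ^ 4 * f n ^ 2 +
        (2 * Real.pi * N) ^ 2 * ((2 * Real.pi * n) ^ 2 * f n ^ 2))) + G * f n := by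
    intro n
    set w : ℝ := (1 + (n : ℝ) ^ 2) ^ s with hw
    have hw0 : 0 < w := by positivity
    have e1 : (2 * Real.pi * n) ^ 2 * f n ^ 2 ≤
        (2 * Real.pi * n) ^ 2 * f n * c n + (2 * Real.pi * n) ^ 2 * g n * f n := by
      have := mul_le_mul_of_nonneg_left (hfc n)
        (mul_nonneg (sq_nonneg (2 * Real.pi * n)) (hf0 n))
      linarith
    have e2 : (2 * Real.pi * n) ^ 2 * f n * c n ≤ lam / 2 * (w * c n ^ 2) +
        lam⁻¹ / 2 * (w⁻¹ * ((2 * Real.pi * n) ^ 4 * f n ^ 2)) := by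
      have h3 := sq_nonneg (lam * w * c n - (2 * Real.pi * n) ^ 2 * f n)
      have h4 : lam / 2 * (w * c n ^ 2) + lam⁻¹ / 2 * (w⁻¹ * ((2 * Real.pi * n) ^ 4 * f n ^ 2)) -
          (2 * Real.pi * n) ^ 2 * f n * c n =
          (lam * w * c n - (2 * Real.pi * n) ^ 2 * f n) ^ 2 / (2 * lam * w) := by
        field_simp
        ring
      have h5 : 0 ≤ (lam * w * c n - (2 * Real.pi * n) ^ 2 * f n) ^ 2 / (2 * lam * w) := by
        positivity
      linarith
    have e3 := mul_le_mul_of_nonneg_left (hdual n) (by positivity : 0 ≤ lam⁻¹ / 2)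
    have e4 := mul_le_mul_of_nonneg_right (hg n) (hf0 n)
    linarith
  have T := (hc.hasSum.mul_left (lam / 2)).add
    ((((h2.hasSum.add (h1.hasSum.mul_left ((2 * Real.pi * N) ^ 2))).mul_left
      (N ^ (-(2 * s)))).mul_left (lam⁻¹ / 2)))
  have T' := hasSum_le hpt h1.hasSum (T.add (hf.hasSum.mul_left G))
  set S := ∑' n : ℤ, (1 + (n : ℝ) ^ 2) ^ s * c n ^ 2
  have hQle : N ^ (-(2 * s)) * (∑' n : ℤ, (2 * Real.pi * n) ^ 4 * f n ^ 2 +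
      (2 * Real.pi * N) ^ 2 * ∑' n : ℤ, (2 * Real.pi * n) ^ 2 * f n ^ 2) ≤ Q := by
    rw [hQ]; gcongr
  have e1 := mul_le_mul_of_nonneg_left hQle (by positivity : 0 ≤ lam⁻¹ / 2)
  have e2 := mul_le_mul_of_nonneg_left hfR hG0
  have e3 : lam⁻¹ / 2 * Q = H₁ / 4 := by rw [hlam]; field_simp; norm_num
  have e4 : H₁ / 4 ≤ lam / 2 * S := by linarith
  rw [hlam] at e4
  rw [div_le_iff₀ (by positivity)]
  calc H₁ ^ 2 = H₁ / 4 * (4 * H₁) := by ring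
    _ ≤ 2 * Q / H₁ / 2 * S * (4 * H₁) := by gcongr
    _ = _ := by field_simp

/-- A bump of width `1 / M` moves, within the rescaled time `K`, mass to frequencies of order
`KM`. The numerical constant is what `moments_of_phase_bump` gives when inserted into
`le_tsum_rpow_of_moments` with `N = KM`. -/
lemma exists_high_frequency_growth {K : ℝ} (hK : 26 ≤ K) : ∃ δ : ℝ, 0 < δ ∧
    ∀ {α κ A s : ℝ} {M : ℕ}, 0 < α → |κ| = 1 → 0 < A → 0 < s → s ≤ 1 → 1 < M →
    (4 * Real.pi * α * M) ^ (2 * α) / A ^ 2 ≤ δ →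
    ∃ (a b : ℝ) (u : ℝ → UnitAddCircle → ℂ), a < 0 ∧ K / A ^ 2 < b ∧ IsSmoothSolution α κ a b u ∧
      (∀ n, fourierCoeff (u 0) n = A * if n ∈ Finset.Ico (0 : ℤ) M then (M : ℂ)⁻¹ else 0) ∧
      A * √((K * M) ^ (2 * s) / (4341760 * Real.pi ^ 4 * M)) ≤
        sobolevNorm s (u (K / A ^ 2)) := by
  have hK0 : 0 < K := by linarith
  set r : ℝ := Real.exp 2 with hr
  have hr1 : 1 < r := Real.one_lt_exp_iff.2 (by norm_num)
  set R : ℝ := r * Real.exp (r ^ 2 * K) with hR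
  have hR1 : 1 ≤ R := by
    have := Real.one_le_exp (show 0 ≤ r ^ 2 * K by positivity)
    nlinarith
  set G : ℝ := gapConst r K with hG
  have hG0 : 0 < G := by rw [hG, gapConst]; positivity
  refine ⟨1 / (8 * K ^ 2 * G * R), by positivity, ?_⟩
  intro α κ A s M hα hκ hA hs0 hs1 hM hθδ
  have hMR : (1 : ℝ) < M := by exact_mod_cast hM
  have hM0 : (0 : ℝ) < M := by linarith
  set θ : ℝ := (4 * Real.pi * α * M) ^ (2 * α) / A ^ 2 with hθ
  have hθ0 : 0 ≤ θ := by positivity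
  set η : ℝ := K ^ 2 * θ * G with hη
  have hη0 : 0 ≤ η := by positivity
  have hηR : η * R ≤ 1 / 8 := by
    rw [le_div_iff₀ (by positivity)] at hθδ
    rw [hη]
    linarith
  have hηr : η < r := by
    have : η ≤ η * R := le_mul_of_one_le_right hη0 hR1
    linarith
  set ρ : ℝ≥0 := (M : ℝ≥0)⁻¹ with hρ
  have hρ0 : 0 < ρ := by
    have : (0 : ℝ≥0) < M := by exact_mod_cast (by omega : 0 < M)
    positivity
  have hφr : ‖bump M (2 * ρ)‖ ≤ r := by
    have := norm_indicatorData_le (F := Finset.Ico (0 : ℤ) M) (M := (M : ℝ≥0)) (ρ := 2 * ρ)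
      (B := r) (c := 1) (by exact_mod_cast (by omega : 0 < M)) le_rfl (by simp) (fun n hn => ?_)
      (Real.exp_pos _).le
    · rwa [one_mul] at this
    · rw [Finset.mem_Ico] at hn
      have h0 : (0 : ℝ) ≤ n := by exact_mod_cast hn.1
      have h1 : (n : ℝ) ≤ M := by exact_mod_cast hn.2.le
      rw [expWeight, hρ, hr, abs_of_nonneg h0]
      push_cast
      gcongr
      calc 2 * (M : ℝ)⁻¹ * n ≤ 2 * (M : ℝ)⁻¹ * M := by gcongr
        _ = 2 := by field_simp
  obtain ⟨a, b, u, ha, hb, hu, hu0, huT, C, hC⟩ := exists_smooth_solution hα hκ hA hρ0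
    (θ := θ) (fun n => by
      refine (fracSymbol_le hρ0 hα A n).trans (le_of_eq ?_)
      rw [hθ, hρ]
      push_cast
      rw [div_inv_eq_mul]) hφr (by linarith) hK0 hηr
  refine ⟨a, b, u, ha, hb, hu, fun n => ?_, ?_⟩
  · rw [hu0, bump, coef_indicatorData]
    push_cast
    rfl
  set f := dispersionless κ (bump M (2 * ρ)) K with hf
  have hfR : ‖f‖ ≤ R := norm_dispersionless_le hκ hφr hK0.le
  obtain ⟨s1, s2, l1, u1, u2⟩ := moments_of_phase_bump hM (mul_pos two_pos hρ0) (f := f)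
    (c := K * κ) (K := K) (by rw [abs_mul, hκ, abs_of_pos hK0, mul_one]) hK
    fun x => by rw [hf, eval_dispersionless, mul_assoc]
  have hd1 : ∀ n : ℤ, ‖derivCoef (coef f) n‖ ^ 2 = (2 * Real.pi * n) ^ 2 * ‖coef f n‖ ^ 2 :=
    fun n => by rw [norm_derivCoef, mul_pow, sq_abs]
  have hd2 : ∀ n : ℤ, ‖derivCoef (derivCoef (coef f)) n‖ ^ 2 =
      (2 * Real.pi * n) ^ 4 * ‖coef f n‖ ^ 2 := fun n => by
    rw [norm_derivCoef, norm_derivCoef, mul_pow, mul_pow, sq_abs]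
    ring
  simp only [hd1] at s1 l1 u1
  simp only [hd2] at s2 u2
  have hsob := le_tsum_rpow_of_moments hs0 hs1 (f := fun n => ‖coef f n‖)
    (c := fun n => ‖fourierCoeff (u (K / A ^ 2)) n‖ / A)
    (g := fun n => η * (expWeight ρ n)⁻¹ / M) (fun n => norm_nonneg _) (fun n => ?_)
    (H₁ := K ^ 2 * M / 16) (G := 8 * Real.pi ^ 2 * M * η) (R := R) (N := K * M)
    (by positivity) (by positivity) (by positivity) (summable_norm_coef f) ?_ s1 l1 u1 s2 u2 ?_
    (by positivity) (fun n => ?_) ?_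
  · have hS := (summable_sobolev hρ0 s hC).tsum_mul_left (A ^ 2)⁻¹
    have hS' : ∑' n : ℤ, (1 + (n : ℝ) ^ 2) ^ s * (‖fourierCoeff (u (K / A ^ 2)) n‖ / A) ^ 2 =
        (A ^ 2)⁻¹ * ∑' n : ℤ, (1 + (n : ℝ) ^ 2) ^ s * ‖fourierCoeff (u (K / A ^ 2)) n‖ ^ 2 := by
      rw [← hS]
      congr 1
      ext n
      rw [div_pow]
      ring
    have hQ : (K ^ 2 * M / 16) ^ 2 / (4 * ((K * M) ^ (-(2 * s)) *
        (256 * K ^ 4 * ((2 * Real.pi * M) ^ 4 / M) + (2 * Real.pi * (K * M)) ^ 2 *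
          (9 * K ^ 2 * ((2 * Real.pi * M) ^ 2 / M))))) =
        (K * M) ^ (2 * s) / (4341760 * Real.pi ^ 4 * M) := by
      have hp : 0 < (K * M) ^ (2 * s) := by positivity
      rw [Real.rpow_neg (by positivity)]
      field_simp
      ring
    rw [hS', hQ] at hsob
    rw [sobolevNorm_eq]
    refine Real.le_sqrt_of_sq_le ?_
    rw [mul_pow, Real.sq_sqrt (by positivity)]
    rwa [inv_mul_eq_div, le_div_iff₀' (by positivity)] at hsob
  · have h1 := huT n
    have hw := expWeight_pos ρ n
    have h2 := norm_le_norm_add_norm_sub' (A * (cexp ((K * fracSymbol α A n : ℝ) * I) * coef f n))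
      (fourierCoeff (u (K / A ^ 2)) n)
    rw [norm_sub_rev, norm_mul, norm_mul, norm_exp_ofReal_mul_I, one_mul, norm_real,
      Real.norm_of_nonneg hA.le] at h2
    simp only [NNReal.coe_natCast] at h1
    have h3 : ‖fourierCoeff (u (K / A ^ 2)) n -
        A * (cexp ((K * fracSymbol α A n : ℝ) * I) * coef f n)‖ ≤
        A * (η * (expWeight ρ n)⁻¹ / M) := by
      rw [← mul_assoc, ← le_div_iff₀' (by positivity)] at h1
      refine h1.trans (le_of_eq ?_)
      rw [← hG, ← hη]
      field_simp
    rw [← sub_le_iff_le_add, le_div_iff₀ hA]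
    linarith
  · refine le_trans ?_ ((tsum_coef_le f).trans hfR)
    exact (summable_norm_coef f).tsum_le_tsum (fun n =>
      le_mul_of_one_le_left (norm_nonneg _) (one_le_expWeight _ n)) (summable_coef f)
  · refine ((summable_sobolev hρ0 s hC).mul_left (A ^ 2)⁻¹).congr fun n => ?_
    rw [div_pow]
    ring
  · have hw := expWeight_pos ρ n
    have h1 : (n : ℝ) ^ 2 ≤ 2 * (M : ℝ) ^ 2 * expWeight ρ n := by
      have h2 := Real.pow_div_factorial_le_exp (ρ * |(n : ℝ)|) (by positivity) 2
      rw [← expWeight, hρ, mul_pow, sq_abs] at h2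
      push_cast at h2
      rw [div_le_iff₀ (by norm_num), inv_pow, inv_mul_le_iff₀ (by positivity)] at h2
      refine h2.trans (le_of_eq ?_)
      norm_num [Nat.factorial]
      ring
    calc (2 * Real.pi * n) ^ 2 * (η * (expWeight ρ n)⁻¹ / M)
        = (2 * Real.pi) ^ 2 * (η * (expWeight ρ n)⁻¹ / M) * (n : ℝ) ^ 2 := by ring
      _ ≤ (2 * Real.pi) ^ 2 * (η * (expWeight ρ n)⁻¹ / M) *
          (2 * (M : ℝ) ^ 2 * expWeight ρ n) := by gcongr
      _ = _ := by field_simp; ring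
  · have hπ : Real.pi ^ 2 ≤ 16 := by
      have := Real.pi_lt_four
      have := Real.pi_pos
      nlinarith
    calc 8 * Real.pi ^ 2 * (M : ℝ) * η * R = 8 * Real.pi ^ 2 * (M : ℝ) * (η * R) := by ring
      _ ≤ 8 * 16 * (M : ℝ) * (1 / 8) := by gcongr
      _ = 512 * M / 16 / 2 := by ring
      _ ≤ K ^ 2 * M / 16 / 2 := by gcongr; nlinarith

/-- Norm inflation in Sobolev spaces of positive order. -/
lemma normInflation_of_pos {α s κ ε : ℝ} (hα : 0 < α) (hκ : |κ| = 1) (hε : 0 < ε) (hs0 : 0 < s)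
    (hs : s < 1 / 2 - α) : NormInflation α s κ ε := by
  set C : ℝ := 4341760 * Real.pi ^ 4 with hC
  have hC0 : 0 < C := by positivity
  obtain ⟨K, hK, hKs⟩ : ∃ K : ℝ, 26 ≤ K ∧ 2 * √C / ε ^ 2 < K ^ s :=
    ((eventually_ge_atTop 26).and ((tendsto_rpow_atTop hs0).eventually_gt_atTop _)).exists
  have hK0 : 0 < K := by linarith
  obtain ⟨δ, hδ0, h⟩ := exists_high_frequency_growth hK
  set B : ℝ := (4 * Real.pi * α) ^ (2 * α) with hB
  have hB0 : 0 < B := by positivity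
  have hev1 : ∀ᶠ M : ℕ in atTop, (M : ℝ) ^ (2 * α + 2 * s - 1) < δ * ε ^ 2 / (4 * B) :=
    (tendsto_natCast_rpow_neg (by linarith)).eventually_lt_const (by positivity)
  have hev2 : ∀ᶠ M : ℕ in atTop, (M : ℝ) ^ (2 * s - 1) < ε ^ 3 / (4 * K) :=
    (tendsto_natCast_rpow_neg (by linarith)).eventually_lt_const (by positivity)
  obtain ⟨M, hM1, hM2, hM⟩ := (hev1.and (hev2.and (eventually_gt_atTop 1))).exists
  have hMR : (1 : ℝ) < M := by exact_mod_cast hM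
  have hM0 : (0 : ℝ) < M := by linarith
  -- The amplitude for which the data have `H^s` norm at most `ε / 2`.
  set A : ℝ := ε / 2 * (M : ℝ) ^ (1 / 2 - s) with hA
  have hA0 : 0 < A := by positivity
  have hA2 : (A ^ 2)⁻¹ = 4 / ε ^ 2 * (M : ℝ) ^ (2 * s - 1) := by
    have h1 : (M : ℝ) ^ (2 * s - 1) = (((M : ℝ) ^ (1 / 2 - s)) ^ 2)⁻¹ := by
      rw [← Real.rpow_natCast, ← Real.rpow_mul hM0.le, ← Real.rpow_neg hM0.le]
      congr 1
      push_cast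
      ring
    rw [h1, hA]
    field_simp
    norm_num
  have hAM : A * (M : ℝ)⁻¹ * (√M * (M : ℝ) ^ s) = ε / 2 := by
    have h1 : (M : ℝ) ^ (1 / 2 - s) * ((M : ℝ)⁻¹ * (√M * (M : ℝ) ^ s)) = 1 := by
      rw [Real.sqrt_eq_rpow, ← Real.rpow_neg_one, ← Real.rpow_add hM0, ← Real.rpow_add hM0,
        ← Real.rpow_add hM0, ← Real.rpow_zero (M : ℝ)]
      congr 1
      ring
    calc _ = ε / 2 * ((M : ℝ) ^ (1 / 2 - s) * ((M : ℝ)⁻¹ * (√M * (M : ℝ) ^ s))) := by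
          rw [hA]; ring
      _ = _ := by rw [h1, mul_one]
  obtain ⟨a, b, u, ha, hb, hu, hu0, huT⟩ := h hα hκ hA0 hs0 (by linarith) hM (by
    rw [Real.mul_rpow (by positivity) hM0.le, div_eq_mul_inv, hA2]
    have h1 : (M : ℝ) ^ (2 * α + 2 * s - 1) = (M : ℝ) ^ (2 * α) * (M : ℝ) ^ (2 * s - 1) := by
      rw [← Real.rpow_add hM0]
      congr 1
      ring
    rw [h1, lt_div_iff₀ (by positivity)] at hM1
    have h2 : B * (M : ℝ) ^ (2 * α) * (4 / ε ^ 2 * (M : ℝ) ^ (2 * s - 1)) =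
        (M : ℝ) ^ (2 * α) * (M : ℝ) ^ (2 * s - 1) * (4 * B) / ε ^ 2 := by ring
    rw [h2, div_le_iff₀ (by positivity)]
    exact hM1.le)
  refine ⟨a, b, u, K / A ^ 2, ha, by positivity, hb, ?_, hu, ?_, ?_⟩
  · rw [div_eq_mul_inv, hA2]
    rw [lt_div_iff₀ (by positivity)] at hM2
    have h2 : K * (4 / ε ^ 2 * (M : ℝ) ^ (2 * s - 1)) =
        (M : ℝ) ^ (2 * s - 1) * (4 * K) / ε ^ 2 := by ring
    rw [h2, div_lt_iff₀ (by positivity)]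
    linarith
  · have hle := sobolevNorm_le_of_finset (s := s) (f := u 0) (B := A * (M : ℝ)⁻¹)
      (W := ((M : ℝ) ^ s) ^ 2) (by positivity) (Finset.Ico (0 : ℤ) M)
      (fun n hn => by rw [hu0, if_neg hn, mul_zero])
      (fun n hn => by
        rw [hu0, if_pos hn, norm_mul, norm_real, Real.norm_of_nonneg hA0.le]
        simp)
      (fun n hn => by
        rw [Finset.mem_Ico] at hn
        have h0 : (0 : ℝ) ≤ n := by exact_mod_cast hn.1
        have h1 : (n : ℝ) + 1 ≤ M := by exact_mod_cast hn.2
        have h2 : 1 + (n : ℝ) ^ 2 ≤ (M : ℝ) ^ 2 := by nlinarith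
        refine (Real.rpow_le_rpow (by positivity) h2 hs0.le).trans (le_of_eq ?_)
        rw [← Real.rpow_natCast, ← Real.rpow_natCast, ← Real.rpow_mul hM0.le,
          ← Real.rpow_mul hM0.le, mul_comm])
    rw [Int.card_Ico, sub_zero, Int.toNat_natCast, Real.sqrt_mul hM0.le,
      Real.sqrt_sq (by positivity), hAM] at hle
    linarith
  · refine lt_of_lt_of_le ?_ huT
    have h1 : √((K * M) ^ (2 * s) / (C * M)) = K ^ s * (M : ℝ) ^ s / (√C * √M) := by
      have h2 : (K * M) ^ (2 * s) = (K ^ s * (M : ℝ) ^ s) ^ 2 := by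
        rw [← Real.mul_rpow hK0.le hM0.le, mul_comm 2 s, Real.rpow_mul (by positivity)]
        norm_num
      rw [h2, Real.sqrt_div (by positivity), Real.sqrt_sq (by positivity), Real.sqrt_mul hC0.le]
    have hsM0 : 0 < √(M : ℝ) := Real.sqrt_pos.2 hM0
    have hsC0 : 0 < √C := Real.sqrt_pos.2 hC0
    have h3 : A * (K ^ s * (M : ℝ) ^ s / (√C * √M)) = ε / 2 * (K ^ s / √C) := by
      rw [← hAM]
      have h4 : (M : ℝ)⁻¹ * √M = 1 / √M := by
        rw [inv_mul_eq_div, Real.sqrt_div_self, one_div]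
      calc _ = A * (1 / √M) * (M : ℝ) ^ s * (K ^ s / √C) := by field_simp
        _ = _ := by rw [← h4]; ring
    rw [h1, h3]
    rw [div_lt_iff₀ (by positivity)] at hKs
    rw [inv_lt_iff_one_lt_mul₀ hε]
    calc (1 : ℝ) = 2 * √C * (1 / (2 * √C)) := by field_simp
      _ < K ^ s * ε ^ 2 * (1 / (2 * √C)) := by gcongr
      _ = _ := by field_simp

end WienerSpace

theorem theorem2 (α s κ : ℝ) (hα : 0 < α) (hκ : κ = 1 ∨ κ = -1)
    (hs : (1 / 2 - α ≤ -(1 / 2) ∧ s ≤ 1 / 2 - α) ∨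
      (-(1 / 2) < 1 / 2 - α ∧ s < 1 / 2 - α ∧ s ≠ 0))
    (ε : ℝ) (hε : 0 < ε) :
    ∃ (a b : ℝ) (u : ℝ → UnitAddCircle → ℂ) (t : ℝ),
      a < 0 ∧ 0 < t ∧ t < b ∧ t < ε ∧
      IsSmoothSolution α κ a b u ∧
      sobolevNorm s (u 0) < ε ∧ ε⁻¹ < sobolevNorm s (u t) := by
  have hκ' : |κ| = 1 := by rcases hκ with rfl | rfl <;> simp
  rcases hs with ⟨h1, h2⟩ | ⟨h1, h2, h3⟩
  · exact WienerSpace.normInflation_of_neg hα hκ' hε (by linarith) (Or.inl ⟨h1, h2⟩)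
  · rcases h3.lt_or_gt with h3 | h3
    · exact WienerSpace.normInflation_of_neg hα hκ' hε h3 (Or.inr ⟨h1, h2⟩)
    · exact WienerSpace.normInflation_of_pos hα hκ' hε h3 h2
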